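/- An $\mathfrak{sl}_3$ bottom web with $n$ boundary points is an oriented plane graph $w$ in the upper half-plane, considered up to isotopy fixing the $x$-axis, with univalent boundary vertices at the points $1,\dots,n$ of the $x$-axis and trivalent internal vertices above the axis, such that every vertex is a source or a sink; $w$ may be disconnected, may have oriented circle components without vertices, and the boundary vertices may have arbitrary orientations. The faces of $w$ are the connected components of its complement in the upper half-plane, and $w$ is reduced (non-elliptic) if every face that does not touch the $x$-axis has at least six boundary edges, where a circle counts as one boundary edge of each face next to it. The depth of a face is its distance from the unbounded face in the dual graph. The $d$-band is the closure of the union of the faces of depth $d$, the $d$-arc is the intersection of the $d$-band and the $(d-1)$-band, and the band diagram $B(w)$ is the union of all $d$-arcs; it is anchored if it has no closed components, i.e. if each of its connected components reaches the $x$-axis. The shadow of $w$ is the sequence $S_1(w)\supseteq S_2(w)\supseteq\cdots$, where $S_d(w)\subseteq\mathbb{R}$ is the set of points of the $x$-axis that belong to a $k$-band for some $k\ge d$. **Proposition.** (1) The band diagram of every reduced $\mathfrak{sl}_3$ bottom web is anchored (hence, up to isotopy, it is given by the crossingless matching of boundary vertices that its components define). (2) Let $w,w'$ be reduced $\mathfrak{sl}_3$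 bottom webs with the same number $n$ of boundary points. Their band diagrams agree up to isotopy (i.e. define the same matching) if and only if their shadows are equal. If moreover $w$ and $w'$ have the same boundary orientation (for example, if all boundary vertices of both are sources), then each of these two equivalent conditions implies that $w$ and $w'$ are isotopic as oriented webs. Thus a reduced $\mathfrak{sl}_3$ bottom web with given boundary orientation is determined by its band diagram, and equivalently by its shadow. -/

import Mathlib

namespace SL3Web

/-- The half-edges (darts) of a trivalent graph with `n` univalent boundary vertices and set `V` of
internal vertices: one half-edge at each boundary vertex and three at each internal vertex. The
half-edges `inner v 0, inner v 1, inner v 2` are listed in counterclockwise cyclic order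
around `v`. -/
inductive HalfEdge (n : ℕ) (V : Type) : Type
  | bdry (i : Fin n) : HalfEdge n V
  | inner (v : V) (k : ZMod 3) : HalfEdge n V

/-- The vertex at which a half-edge is based: a boundary vertex or an internal vertex. -/
def HalfEdge.vertex {n : ℕ} {V : Type} : HalfEdge n V → Fin n ⊕ V
  | .bdry i => Sum.inl i
  | .inner v _ => Sum.inr v

/-- The combinatorial data of an oriented graph drawn in the closed upper half-plane, with boundary
vertices at the integer points `1, …, n` of the `x`-axis (boundary vertex `i : Fin n` is the point
`i + 1`), with trivalent internal vertices, and possibly with circle components.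

Gap `j : Fin (n + 1)` is the open interval of the `x`-axis between the boundary points `j` and
`j + 1`; gap `0` is unbounded on the left and gap `n` is unbounded on the right.

These data do not yet say that the surface carrying the drawing is the half-plane; see
`BottomWeb`. -/
structure Diagram (n : ℕ) where
  /-- internal (trivalent) vertices -/
  V : Type
  /-- circle components, i.e. closed oriented curves without vertices -/
  O : Type
  /-- faces, i.e. connected components of the complement in the upper half-plane -/
  F : Type
  finV : Finite V
  finO : Finite O
  finF : Finite F
  /-- the other half of the edge to which a half-edge belongs -/
  mate : HalfEdge n V → HalfEdge n V
  mate_mate : ∀ h, mate (mate h) = h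
  /-- `true` for a source (all edges point away from the vertex), `false` for a sink -/
  isSource : Fin n ⊕ V → Bool
  /-- every edge is oriented from a source to a sink -/
  isSource_mate : ∀ h, isSource (mate h).vertex = !(isSource h.vertex)
  /-- the face on the left of the edge of a half-edge, seen when leaving the base vertex -/
  left : HalfEdge n V → F
  /-- the face just above a gap of the `x`-axis -/
  gap : Fin (n + 1) → F
  /-- the face on the left of a circle, traversed along its orientation -/
  circleLeft : O → F
  /-- the face on the right of a circle, traversed along its orientation -/
  circleRight : O → F
  /-- At an internal vertex, the sector between a half-edge and the next one counterclockwise lies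
  to the left of the first and to the right of the second. -/
  left_inner : ∀ v k, left (.inner v k) = left (mate (.inner v (k + 1)))
  /-- The gap preceding a boundary vertex is to the left of its edge. -/
  left_bdry : ∀ i, left (.bdry i) = gap i.castSucc
  /-- The gap following a boundary vertex is to the right of its edge. -/
  right_bdry : ∀ i, left (mate (.bdry i)) = gap i.succ
  /-- The two ends of the `x`-axis touch the same face, the unbounded one. -/
  gap_last : gap (Fin.last n) = gap 0

attribute [instance] Diagram.finV Diagram.finO Diagram.finF

namespace Diagram

variable {n : ℕ} (w : Diagram n)

/-- The face on the right of the edge of a half-edge, seen when leaving the base vertex. -/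
def right (h : HalfEdge n w.V) : w.F := w.left (w.mate h)

/-- The unbounded face. -/
def unbounded : w.F := w.gap 0

/-- The dual graph: its vertices are the faces, and two distinct faces are adjacent if some edge
(or circle) separates them. -/
def dual : SimpleGraph w.F :=
  SimpleGraph.fromRel fun f g =>
    (∃ h, w.left h = f ∧ w.right h = g) ∨ (∃ c, w.circleLeft c = f ∧ w.circleRight c = g)

/-- Number of edges, circles not included. -/
noncomputable def numEdges : ℕ :=
  (Set.range fun h => s(h, w.mate h)).ncard

/-- The vertex of a half-edge after the `x`-axis has been collapsed to a single point `none`. -/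
def collapsedVertex : HalfEdge n w.V → Option w.V
  | .bdry _ => none
  | .inner v _ => some v

/-- The graph (without its circles) obtained by collapsing the `x`-axis to a single point `none`;
multiple edges and loops are dropped, which does not affect connected components. -/
def collapsed : SimpleGraph (Option w.V) :=
  SimpleGraph.fromRel fun a b =>
    ∃ h, w.collapsedVertex h = a ∧ w.collapsedVertex (w.mate h) = b

end Diagram

/-- An `sl₃` bottom web with `n` boundary points, up to planar isotopy, where the boundary points
carry arbitrary orientations: an oriented plane graph in the upper half-plane (possibly
disconnected, possibly with circle components), with univalent boundary vertices on the `x`-axis,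
trivalent internal vertices, and every vertex a source or a sink.

Collapsing the `x`-axis (with the point at infinity) turns the half-plane into a sphere and keeps
the faces. The data describe a drawing on the sphere if and only if all faces are linked by paths
crossing edges and Euler's formula `V + F = E + 1 + C` for plane graphs with `C` connected
components holds; here every circle is counted with one vertex, one edge and one component. -/
structure BottomWeb (n : ℕ) extends Diagram n where
  dual_connected : toDiagram.dual.Connected
  euler : (Nat.card V + 1 + Nat.card O) + Nat.card F =
    (toDiagram.numEdges + Nat.card O) +
      (1 + (Nat.card toDiagram.collapsed.ConnectedComponent + Nat.card O))

namespace BottomWeb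

variable {n : ℕ} (w : BottomWeb n)

/-- A closed face is a face that does not touch the `x`-axis. -/
def IsClosedFace (f : w.F) : Prop := ∀ j, w.gap j ≠ f

/-- The number of boundary edges of a face; a circle is a boundary edge of the faces on its two
sides. -/
noncomputable def numBoundaryEdges (f : w.F) : ℕ :=
  {h | w.left h = f}.ncard + {c | w.circleLeft c = f}.ncard + {c | w.circleRight c = f}.ncard

/-- A web is reduced (non-elliptic) if all closed faces have at least six boundary edges. -/
def Reduced : Prop := ∀ f, w.IsClosedFace f → 6 ≤ w.numBoundaryEdges f

/-- The depth of a face is its distance from the unbounded face in the dual graph. -/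
noncomputable def depth (f : w.F) : ℕ := w.dual.dist f w.unbounded

/-- An edge (given by one of its half-edges) belongs to the `d`-arc if it lies in the closure of
a face of depth `d` and in the closure of a face of depth `d - 1`. -/
def InArc (d : ℕ) (h : HalfEdge n w.V) : Prop :=
  (w.depth (w.left h) = d ∧ w.depth (w.right h) + 1 = d) ∨
    (w.depth (w.right h) = d ∧ w.depth (w.left h) + 1 = d)

/-- A circle belongs to the `d`-arc if one of its sides has depth `d` and the other `d - 1`. -/
def CircleInArc (d : ℕ) (c : w.O) : Prop :=
  (w.depth (w.circleLeft c) = d ∧ w.depth (w.circleRight c) + 1 = d) ∨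
    (w.depth (w.circleRight c) = d ∧ w.depth (w.circleLeft c) + 1 = d)

/-- An edge belongs to the band diagram, the union of the `d`-arcs over all `d`. -/
def InBand (h : HalfEdge n w.V) : Prop := ∃ d, w.InArc d h

/-- A circle belongs to the band diagram. -/
def CircleInBand (c : w.O) : Prop := ∃ d, w.CircleInArc d c

/-- The band diagram (without circles) as a graph on the boundary and internal vertices of the web:
two vertices are adjacent if some edge of the band diagram joins them. -/
def band : SimpleGraph (Fin n ⊕ w.V) :=
  SimpleGraph.fromRel fun a b => ∃ h, w.InBand h ∧ h.vertex = a ∧ (w.mate h).vertex = b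

/-- The band diagram is anchored, i.e. it has no closed components: it contains no circle, and the
component of each of its edges reaches the `x`-axis. -/
def Anchored : Prop :=
  (∀ c, ¬ w.CircleInBand c) ∧
    ∀ h, w.InBand h → ∃ i : Fin n, w.band.Reachable h.vertex (Sum.inl i)

/-- The anchored part of the band diagram up to isotopy, i.e. the crossingless matching of boundary
vertices that it forms: two distinct boundary vertices are matched if they are joined by a component
of the band diagram. -/
def bandMatching (i j : Fin n) : Prop :=
  i ≠ j ∧ w.band.Reachable (Sum.inl i) (Sum.inl j)

/-- The closure of gap `j` of the `x`-axis: the interval `[j, j + 1]`, extended to `-∞` if `j = 0`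
and to `+∞` if `j = n`. -/
def closedGap (n : ℕ) (j : Fin (n + 1)) : Set ℝ :=
  {x | (j ≠ 0 → ((j : ℕ) : ℝ) ≤ x) ∧ (j ≠ Fin.last n → x ≤ ((j : ℕ) : ℝ) + 1)}

/-- The shadow: its `d`-th term is the set of points of the `x`-axis that belong to a `k`-band (the
closure of the union of the faces of depth `k`) for some `k ≥ d`. -/
def shadow (d : ℕ) : Set ℝ :=
  {x | ∃ j : Fin (n + 1), d ≤ w.depth (w.gap j) ∧ x ∈ closedGap n j}

/-- Two webs have the same boundary orientation if each boundary vertex is a source in both or a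
sink in both. -/
def SameBoundary (w w' : BottomWeb n) : Prop :=
  ∀ i : Fin n, w.isSource (Sum.inl i) = w'.isSource (Sum.inl i)

/-- The map of half-edges given by a map `f` of internal vertices and a cyclic relabelling
`k ↦ k + r v` of the half-edges at each of them. -/
def mapHalfEdge {V V' : Type} (f : V → V') (r : V → ZMod 3) : HalfEdge n V → HalfEdge n V'
  | .bdry i => .bdry i
  | .inner v k => .inner (f v) (k + r v)

/-- An isomorphism of webs: bijections of internal vertices, circles and faces fixing the boundary
vertices and preserving all the data (edges, orientations, cyclic orders and adjacent faces). Two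
webs are isomorphic if and only if they are isotopic in the half-plane. -/
structure Iso (w w' : BottomWeb n) where
  vert : w.V ≃ w'.V
  rot : w.V → ZMod 3
  circle : w.O ≃ w'.O
  face : w.F ≃ w'.F
  map_mate : ∀ h, mapHalfEdge vert rot (w.mate h) = w'.mate (mapHalfEdge vert rot h)
  map_source : ∀ h : HalfEdge n w.V,
    w'.isSource (mapHalfEdge vert rot h).vertex = w.isSource h.vertex
  map_left : ∀ h, w'.left (mapHalfEdge vert rot h) = face (w.left h)
  map_gap : ∀ j, w'.gap j = face (w.gap j)
  map_circleLeft : ∀ c, w'.circleLeft (circle c) = face (w.circleLeft c)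
  map_circleRight : ∀ c, w'.circleRight (circle c) = face (w.circleRight c)

end BottomWeb

end SL3Web

/-! The combinatorial data know planarity only through Euler's formula, so the planar topology is
extracted by linear algebra. In the space of functions on edges, coboundaries of functions on faces
are orthogonal to coboundaries of functions on vertices, which gives a genus inequality for every
part of the web (`euler_inequality`). Weighed against the six-edge condition off the component of
the `x`-axis, it excludes circles and floating components (`connected_of_reduced`). For a connected
web Euler's formula makes the two spaces orthogonal complements, so flows conserved at vertices have
potentials on faces, and flows conserved at faces have potentials on vertices. This replaces the
Jordan curve theorem: modulo two, a closed curve through faces has two sides (`exists_separation`).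
Modulo three, the orientation colours the faces so that the two sides of an edge always differ
(`left_ne_right`).

The key fact is `convex`: no edge between depths `k` and `k - 1` has internal ends at both of which
the third sector has depth `k - 1`. The induction on `k` rests on Gauss-Bonnet: a region of closed
faces whose complement is connected has at least six convex boundary edges (`six_le_ncard_convex`).
Granted convexity at level `k`, every component of the complement of the faces of depth less than
`k` reaches the axis. For the components needed this persists when one face of depth `k`, or two
such faces meeting along an edge, are added to the ball, since they create at most three or four
convex edges. Consequently the edges from a face of depth `k` to lower faces are consecutive
(`lower_consecutive`), and a flat edge has exactly one end whose third sector is lower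
(`outer_or_outer`, `not_outer_outer`). A convex edge at level `k + 1` would then lie on a face of
depth `k` with at most five edges.

Anchoring: a closed component of the band diagram would separate, modulo two, some face of depth `k`
from all gaps of the axis, although that face reaches the axis outside the ball. Matching: the band
component that starts at a step up in the depths of the gaps ends at the first return
(`exists_partner`), so matching, depths of the gaps and shadow determine one another
(`bandMatching_eq_iff`, `shadow_eq_iff`).

Uniqueness is a growth algorithm. A frontier, a path of faces with both ends at the unbounded face,
sweeps upwards from the axis. At a peak of depth along it only three local pictures are possible: a
single edge, a Y or an H (`peak`). Orientations and depths tell which one occurs, so two webs with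
equal boundary orientation and equal gap depths grow by the same moves (`exists_step`) until the
frontier is empty. The half-edges are then matched bijectively, and faces follow because they are
cycles of half-edges (`sameCycle`). -/

namespace SL3Web

/-! ### Linear algebra: orthogonal subspaces and ranks -/

section LinearAlgebra

open Module

variable {k : Type*} [Field k]

/-- Two subspaces of `ι → k` that are orthogonal under the dot product have complementary size. -/
theorem finrank_add_finrank_le_of_orthogonal {ι U W : Type*} [Fintype ι] [AddCommGroup U]
    [Module k U] [AddCommGroup W] [Module k W] (L₁ : U →ₗ[k] ι → k) (L₂ : W →ₗ[k] ι → k)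
    (h : ∀ u w, L₁ u ⬝ᵥ L₂ w = 0) :
    finrank k (LinearMap.range L₁) + finrank k (LinearMap.range L₂) ≤ Fintype.card ι := by
  classical
  have h1 := Subspace.finrank_add_finrank_dualAnnihilator_eq (LinearMap.range L₂)
  rw [finrank_fintype_fun_eq_card] at h1
  have h2 : (LinearMap.range L₁).map (dotProductEquiv k ι).toLinearMap ≤
      (LinearMap.range L₂).dualAnnihilator := by
    rintro _ ⟨_, ⟨u, rfl⟩, rfl⟩
    rw [Submodule.mem_dualAnnihilator]
    rintro _ ⟨w, rfl⟩
    simpa using h u w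
  have h3 := Submodule.finrank_mono h2
  have h4 : finrank k ((LinearMap.range L₁).map (dotProductEquiv k ι).toLinearMap) =
    finrank k (LinearMap.range L₁) := LinearEquiv.finrank_map_eq (dotProductEquiv k ι) _
  omega

/-- If the ranges of `L₁` and `L₂` are orthogonal and large enough, then each is the orthogonal
complement of the other. -/
theorem exists_eq_of_orthogonal {ι U W : Type*} [Fintype ι] [AddCommGroup U]
    [Module k U] [AddCommGroup W] [Module k W] (L₁ : U →ₗ[k] ι → k) (L₂ : W →ₗ[k] ι → k)
    (h : ∀ u w, L₁ u ⬝ᵥ L₂ w = 0)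
    (hr : Fintype.card ι ≤ finrank k (LinearMap.range L₁) + finrank k (LinearMap.range L₂))
    (g : ι → k) (hg : ∀ w, g ⬝ᵥ L₂ w = 0) : ∃ u, L₁ u = g := by
  let L : U × k →ₗ[k] ι → k := L₁.coprod (LinearMap.toSpanSingleton k _ g)
  -- Adjoining `g` to the range of `L₁` keeps it orthogonal to the range of `L₂`, so the dimension
  -- bound forbids any growth.
  have h1 := finrank_add_finrank_le_of_orthogonal L L₂ (by
    rintro ⟨u, c⟩ w
    simp [L, add_dotProduct, smul_dotProduct, h, hg])
  have h2 : LinearMap.range L₁ ≤ LinearMap.range L := by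
    rintro _ ⟨u, rfl⟩
    exact ⟨(u, 0), by simp [L]⟩
  have h3 := Submodule.eq_of_le_of_finrank_le h2 (by omega)
  have h4 : g ∈ LinearMap.range L := ⟨(0, 1), by simp [L]⟩
  rw [← h3] at h4
  exact h4

/-- A linear map that kills only constant functions has corank at most one. -/
theorem card_le_finrank_range_add_one {β M : Type*} [Fintype β] [AddCommGroup M] [Module k M]
    (L : (β → k) →ₗ[k] M) (h : ∀ u, L u = 0 → ∀ a b, u a = u b) :
    Fintype.card β ≤ finrank k (LinearMap.range L) + 1 := by
  have h1 := LinearMap.finrank_range_add_finrank_ker L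
  rw [finrank_fintype_fun_eq_card] at h1
  have h2 : LinearMap.ker L ≤ Submodule.span k {(fun _ => 1 : β → k)} := by
    intro u hu
    rw [Submodule.mem_span_singleton]
    by_cases hβ : Nonempty β
    · obtain ⟨b⟩ := hβ
      exact ⟨u b, funext fun a => by simp [h u hu a b]⟩
    · exact ⟨0, funext fun a => (hβ ⟨a⟩).elim⟩
  have h3 := Submodule.finrank_mono h2
  have h4 := finrank_span_le_card (R := k) ({(fun _ => 1 : β → k)} : Set (β → k))
  simp at h4
  omega

theorem card_eq_finrank_range {β M : Type*} [Fintype β] [AddCommGroup M] [Module k M]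
    (L : (β → k) →ₗ[k] M) (h : ∀ u, L u = 0 → u = 0) :
    Fintype.card β = finrank k (LinearMap.range L) := by
  rw [LinearMap.finrank_range_of_inj, finrank_fintype_fun_eq_card]
  exact (injective_iff_map_eq_zero L).2 h

end LinearAlgebra

/-! ### Half-edges and the rotation around a vertex -/

namespace HalfEdge

variable {n : ℕ} {V : Type}

/-- The next half-edge clockwise at the same vertex; the boundary vertices are regarded as a single
vertex, at which the boundary half-edges are arranged cyclically. -/
def turn : Equiv.Perm (HalfEdge n V) where
  toFun
    | .bdry i => .bdry (finRotate n i)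
    | .inner v k => .inner v (k - 1)
  invFun
    | .bdry i => .bdry ((finRotate n).symm i)
    | .inner v k => .inner v (k + 1)
  left_inv
    | .bdry i => congrArg _ (Equiv.symm_apply_apply _ i)
    | .inner _ k => congrArg _ (sub_add_cancel k 1)
  right_inv
    | .bdry i => congrArg _ (Equiv.apply_symm_apply _ i)
    | .inner _ k => congrArg _ (add_sub_cancel_right k 1)

/-- The half-edge is based at an internal vertex. -/
def IsInner (h : HalfEdge n V) : Prop := ∃ v k, h = .inner v k

@[simp] theorem isInner_inner (v : V) (k : ZMod 3) : (inner v k : HalfEdge n V).IsInner :=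
  ⟨v, k, rfl⟩

@[simp] theorem not_isInner_bdry (i : Fin n) : ¬ (bdry i : HalfEdge n V).IsInner := by
  rintro ⟨v, k, h⟩
  cases h

@[simp] theorem turn_inner (v : V) (k : ZMod 3) :
    turn (inner v k : HalfEdge n V) = inner v (k - 1) := rfl

@[simp] theorem turn_bdry (i : Fin n) :
    turn (bdry i : HalfEdge n V) = bdry (finRotate n i) := rfl

theorem turn_turn_turn {h : HalfEdge n V} (hh : h.IsInner) : turn (turn (turn h)) = h := by
  obtain ⟨v, k, rfl⟩ := hh
  have : k - 1 - 1 - 1 = k := by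
    have : (3 : ZMod 3) = 0 := rfl
    linear_combination -this
  simp [this]

@[simp] theorem isInner_turn {h : HalfEdge n V} : (turn h).IsInner ↔ h.IsInner := by
  cases h <;> simp

/-- Half-edges as a sum type. -/
def equivSum : HalfEdge n V ≃ Fin n ⊕ V × ZMod 3 where
  toFun
    | .bdry i => Sum.inl i
    | .inner v k => Sum.inr (v, k)
  invFun
    | Sum.inl i => .bdry i
    | Sum.inr (v, k) => .inner v k
  left_inv h := by cases h <;> rfl
  right_inv h := by rcases h with _ | ⟨_, _⟩ <;> rfl

noncomputable instance [Fintype V] : Fintype (HalfEdge n V) :=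
  Fintype.ofEquiv _ equivSum.symm

theorem sum_eq {M : Type*} [AddCommMonoid M] [Fintype V] (f : HalfEdge n V → M) :
    ∑ h, f h = ∑ i, f (.bdry i) + ∑ v, ∑ k, f (.inner v k) := by
  rw [← Equiv.sum_comp equivSum.symm, Fintype.sum_sum_type, Fintype.sum_prod_type]
  rfl

end HalfEdge

open HalfEdge

/-! ### Sides of edges, orientation, and orthogonality of coboundaries -/

namespace Diagram

variable {n : ℕ} (w : Diagram n)

noncomputable instance : Fintype w.V := Fintype.ofFinite _
noncomputable instance : Fintype w.F := Fintype.ofFinite _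
noncomputable instance : Fintype w.O := Fintype.ofFinite _

@[simp] theorem mate_mate' (h : HalfEdge n w.V) : w.mate (w.mate h) = h := w.mate_mate h

/-- The involution exchanging the two halves of each edge, as a permutation. -/
def matePerm : Equiv.Perm (HalfEdge n w.V) where
  toFun := w.mate
  invFun := w.mate
  left_inv := w.mate_mate
  right_inv := w.mate_mate

@[simp] theorem matePerm_apply (h : HalfEdge n w.V) : w.matePerm h = w.mate h := rfl

theorem mate_injective : Function.Injective w.mate := w.matePerm.injective

theorem mate_eq_iff {g h : HalfEdge n w.V} : w.mate g = h ↔ g = w.mate h :=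
  ⟨fun e => by rw [← e, w.mate_mate], fun e => by rw [e, w.mate_mate]⟩

@[simp] theorem right_mate (h : HalfEdge n w.V) : w.right (w.mate h) = w.left h := by
  simp [right]

theorem left_mate (h : HalfEdge n w.V) : w.left (w.mate h) = w.right h := rfl

-- Clockwise after `h` comes the sector on its right. At the last boundary point the cyclic order
-- closes up because both ends of the axis touch the unbounded face (`gap_last`).
@[simp] theorem left_turn (h : HalfEdge n w.V) : w.left (turn h) = w.right h := by
  cases h with
  | inner v k =>
    have := w.left_inner v (k - 1)
    rw [sub_add_cancel] at this
    exact this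
  | bdry i =>
    rw [turn_bdry, w.left_bdry, right, w.right_bdry]
    cases n with
    | zero => exact i.elim0
    | succ m =>
      rcases Fin.eq_castSucc_or_eq_last i with ⟨j, rfl⟩ | rfl
      · congr 1
        ext
        have : (j.castSucc : Fin (m + 1)) = ⟨j.val, by omega⟩ := rfl
        rw [this, finRotate_of_lt j.isLt]
        simp
      · rw [finRotate_last]
        simpa using w.gap_last.symm

/-- The source (as opposed to sink) half-edges; each edge has exactly one of them. -/
def IsOut (h : HalfEdge n w.V) : Prop := w.isSource h.vertex = true

theorem isOut_mate (h : HalfEdge n w.V) : w.IsOut (w.mate h) ↔ ¬ w.IsOut h := by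
  simp [IsOut, w.isSource_mate]

@[simp] theorem collapsedVertex_turn (h : HalfEdge n w.V) :
    w.collapsedVertex (turn h) = w.collapsedVertex h := by
  cases h <;> rfl

open Classical in
-- Edges run from sources to sinks, so `mate` exchanges the out half-edges with the others. The out
-- half-edges serve as the set of edges from here on.
theorem sum_out_add {M : Type*} [AddCommMonoid M] (f : HalfEdge n w.V → M) :
    ∑ h : {h // w.IsOut h}, (f h + f (w.mate h)) = ∑ h, f h := by
  rw [Finset.sum_add_distrib, ← Fintype.sum_subtype_add_sum_subtype w.IsOut f]
  congr 1
  let e : {h // w.IsOut h} ≃ {h // ¬ w.IsOut h} :=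
    w.matePerm.subtypeEquiv fun h => by simp [w.isOut_mate]
  exact Fintype.sum_equiv e _ _ fun h => rfl

open Classical in
/-- Coboundaries of functions on faces are orthogonal to coboundaries of functions on vertices. -/
theorem sum_coboundary_mul {k : Type*} [CommRing k] (a b : HalfEdge n w.V → k)
    (ha : ∀ h, a (turn h) = a (w.mate h)) (hb : ∀ h, b (turn h) = b h) :
    ∑ h : {h // w.IsOut h}, (a h - a (w.mate h)) * (b (w.mate h) - b h) = 0 := by
  have h1 := w.sum_out_add (fun h => a h * b (w.mate h) - a h * b h)
  -- Reindexing the left side by `mate` and the right side by `turn` makes both equal to the sum of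
  -- `a (mate h) * b h`.
  have h2 : ∑ h, a h * b (w.mate h) = ∑ h, a h * b h := by
    rw [← Equiv.sum_comp w.matePerm, ← Equiv.sum_comp turn (fun h => a h * b h)]
    simp [ha, hb]
  rw [Finset.sum_sub_distrib, h2, sub_self] at h1
  rw [← h1]
  refine Finset.sum_congr rfl fun h _ => ?_
  simp only [mate_mate']
  ring

theorem numEdges_eq : w.numEdges = Nat.card {h // w.IsOut h} := by
  rw [numEdges, ← Nat.card_coe_set_eq]
  symm
  refine Nat.card_congr (Equiv.ofBijective (fun h => ⟨s(h.1, w.mate h.1), h.1, rfl⟩) ⟨?_, ?_⟩)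
  · rintro ⟨a, ha⟩ ⟨b, hb⟩ hab
    have hab := congrArg Subtype.val hab
    simp only [Sym2.eq_iff] at hab
    rcases hab with h | h
    · exact Subtype.ext h.1
    · rw [h.1, w.isOut_mate] at ha
      exact (ha hb).elim
  · rintro ⟨_, h, rfl⟩
    by_cases hh : w.IsOut h
    · exact ⟨⟨h, hh⟩, rfl⟩
    · exact ⟨⟨w.mate h, (w.isOut_mate h).2 hh⟩, Subtype.ext (by simp [Sym2.eq_swap])⟩

theorem collapsed_adj_or_eq (h : HalfEdge n w.V) :
    w.collapsed.Reachable (w.collapsedVertex h) (w.collapsedVertex (w.mate h)) := by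
  by_cases e : w.collapsedVertex h = w.collapsedVertex (w.mate h)
  · rw [e]
  · exact SimpleGraph.Adj.reachable ((SimpleGraph.fromRel_adj _ _ _).2 ⟨e, Or.inl ⟨h, rfl, rfl⟩⟩)

/-- Induction on the half-edges of the component of the `x`-axis. -/
theorem induction_of_reachable {Q : HalfEdge n w.V → Prop} (h0 : ∀ i, Q (.bdry i))
    (ht : ∀ v k, Q (.inner v k) → Q (.inner v (k + 1))) (hm : ∀ h, Q h → Q (w.mate h))
    (h : HalfEdge n w.V) (hr : w.collapsed.Reachable none (w.collapsedVertex h)) : Q h := by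
  have ht' : ∀ v k l, Q (.inner v k) → Q (.inner v l) := by
    intro v k l hk
    have h1 := ht v k hk
    have h2 := ht v _ h1
    have : ∀ k l : ZMod 3, l = k ∨ l = k + 1 ∨ l = k + 1 + 1 := by decide
    rcases this k l with rfl | rfl | rfl <;> assumption
  have key : ∀ x, w.collapsed.Reachable none x → ∀ h, w.collapsedVertex h = x → Q h := by
    intro x hx
    rw [SimpleGraph.reachable_iff_reflTransGen] at hx
    have base : ∀ h, w.collapsedVertex h = none → Q h := by
      rintro (i | ⟨v, k⟩) h
      · exact h0 i
      · cases h
    induction hx with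
    | refl => exact base
    | @tail y z _ hyz ih =>
      have hg : ∃ g, w.collapsedVertex g = y ∧ w.collapsedVertex (w.mate g) = z := by
        rw [collapsed, SimpleGraph.fromRel_adj] at hyz
        rcases hyz.2 with ⟨g, hg⟩ | ⟨g, hg⟩
        · exact ⟨g, hg⟩
        · exact ⟨w.mate g, by simpa using hg.symm⟩
      obtain ⟨g, hg1, hg2⟩ := hg
      have hQ := hm _ (ih g hg1)
      intro h hh
      cases z with
      | none => exact base h hh
      | some v =>
        generalize w.mate g = g' at hQ hg2
        cases g' <;> cases h <;> simp only [collapsedVertex, Option.some.injEq, reduceCtorEq] at hg2 hh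
        subst hg2 hh
        exact ht' _ _ _ hQ
  exact key _ hr h rfl

end Diagram

end SL3Web

namespace SL3Web

open HalfEdge Module

namespace Diagram

variable {n : ℕ} (w : Diagram n)

/-! ### Coboundary maps on part of a web and the genus inequality -/

section Coboundary

variable (k : Type) [Field k] {Φ : Type} (ℓ : HalfEdge n w.V → Φ) (PB : Φ → Prop)
  (PX : Option w.V → Prop) (PE : HalfEdge n w.V → Prop)

/-- The coboundary of functions on the faces satisfying `PB`, on the edges satisfying `PE`. -/
noncomputable def faceCoboundary :
    ({f // PB f} → k) →ₗ[k] ({h // w.IsOut h ∧ PE h} → k) :=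
  (LinearMap.funLeft k k (fun h => ℓ h.1) - LinearMap.funLeft k k (fun h => ℓ (w.mate h.1))) ∘ₗ
    Function.ExtendByZero.linearMap k Subtype.val

/-- The coboundary of functions on the vertices satisfying `PX`, on the edges satisfying `PE`. -/
noncomputable def vertexCoboundary :
    ({x // PX x} → k) →ₗ[k] ({h // w.IsOut h ∧ PE h} → k) :=
  (LinearMap.funLeft k k (fun h => w.collapsedVertex (w.mate h.1)) -
    LinearMap.funLeft k k (fun h => w.collapsedVertex h.1)) ∘ₗ
    Function.ExtendByZero.linearMap k Subtype.val

variable {k PB PX PE}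

theorem faceCoboundary_apply (c : {f // PB f} → k) (h : {h // w.IsOut h ∧ PE h}) :
    w.faceCoboundary k ℓ PB PE c h =
      Function.extend Subtype.val c 0 (ℓ h) - Function.extend Subtype.val c 0 (ℓ (w.mate h)) := rfl

theorem vertexCoboundary_apply (c : {x // PX x} → k) (h : {h // w.IsOut h ∧ PE h}) :
    w.vertexCoboundary k PX PE c h =
      Function.extend Subtype.val c 0 (w.collapsedVertex (w.mate h)) -
        Function.extend Subtype.val c 0 (w.collapsedVertex h) := rfl

theorem extend_val {α M : Type*} [Zero M] {P : α → Prop} (c : {a // P a} → M) {a : α} (ha : P a) :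
    Function.extend Subtype.val c 0 a = c ⟨a, ha⟩ :=
  Subtype.val_injective.extend_apply c 0 ⟨a, ha⟩

theorem extend_of_not {α M : Type*} [Zero M] {P : α → Prop} (c : {a // P a} → M) {a : α}
    (ha : ¬ P a) : Function.extend Subtype.val c 0 a = 0 :=
  Function.extend_apply' _ _ _ (by rintro ⟨⟨b, hb⟩, rfl⟩; exact ha hb)

variable {ℓ}

/-- An edge outside `PE` contributes nothing to the pairing, as one of the two coboundaries vanishes
there. The labelling `ℓ` need not be the face map: any labelling constant along the boundary walk of
a face will do, and the cycles of `walk` are used later. -/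
theorem coboundary_orthogonal [Fintype {h // w.IsOut h ∧ PE h}] (hℓ : ∀ h, ℓ (turn h) = ℓ (w.mate h))
    (hPE : ∀ h, ¬ PE h → (¬ PB (ℓ h) ∧ ¬ PB (ℓ (w.mate h))) ∨
      (¬ PX (w.collapsedVertex h) ∧ ¬ PX (w.collapsedVertex (w.mate h))))
    (p : {f // PB f} → k) (y : {x // PX x} → k) :
    w.faceCoboundary k ℓ PB PE p ⬝ᵥ w.vertexCoboundary k PX PE y = 0 := by
  classical
  rw [← w.sum_coboundary_mul (fun h => Function.extend Subtype.val p 0 (ℓ h))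
    (fun h => Function.extend Subtype.val y 0 (w.collapsedVertex h)) (by simp [hℓ]) (by simp)]
  rw [dotProduct]
  let F : HalfEdge n w.V → k := fun h =>
    (Function.extend Subtype.val p 0 (ℓ h) - Function.extend Subtype.val p 0 (ℓ (w.mate h))) *
    (Function.extend Subtype.val y 0 (w.collapsedVertex (w.mate h)) -
      Function.extend Subtype.val y 0 (w.collapsedVertex h))
  change ∑ h : {h // w.IsOut h ∧ PE h}, F h = ∑ h : {h // w.IsOut h}, F h
  rw [← Finset.sum_subtype (s := Finset.univ.filter fun h => w.IsOut h ∧ PE h) (by simp) F,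
    ← Finset.sum_subtype (s := Finset.univ.filter fun h => w.IsOut h) (by simp) F]
  refine Finset.sum_subset (by intro h; simp +contextual) fun h h1 h2 => ?_
  have h3 : ¬ PE h := by simp_all
  rcases hPE h h3 with h4 | h4
  · simp only [F]
    rw [extend_of_not _ h4.1, extend_of_not _ h4.2]
    simp
  · simp only [F]
    rw [extend_of_not _ h4.1, extend_of_not _ h4.2]
    simp

open Classical in
-- Combined with the rank bounds below, this says that a part of the web has nonnegative genus.
theorem euler_inequality [Fintype Φ] (hℓ : ∀ h, ℓ (turn h) = ℓ (w.mate h))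
    (hPE : ∀ h, ¬ PE h → (¬ PB (ℓ h) ∧ ¬ PB (ℓ (w.mate h))) ∨
      (¬ PX (w.collapsedVertex h) ∧ ¬ PX (w.collapsedVertex (w.mate h)))) :
    finrank k (LinearMap.range (w.faceCoboundary k ℓ PB PE)) +
      finrank k (LinearMap.range (w.vertexCoboundary k PX PE)) ≤
      Nat.card {h // w.IsOut h ∧ PE h} := by
  rw [Nat.card_eq_fintype_card]
  exact finrank_add_finrank_le_of_orthogonal _ _ (w.coboundary_orthogonal hℓ hPE)

/-- A property of edges may be checked on the half-edges that point out of their vertex. -/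
theorem forall_edge {Q : HalfEdge n w.V → Prop} (hQ : ∀ h, Q h → Q (w.mate h))
    (h : ∀ h, w.IsOut h → Q h) (g : HalfEdge n w.V) : Q g := by
  by_cases hg : w.IsOut g
  · exact h g hg
  · simpa using hQ _ (h (w.mate g) ((w.isOut_mate g).2 hg))

/-- The hypothesis `hc` encodes connectivity: the kernel contains only constants and costs one
dimension. -/
theorem card_le_finrank_faceCoboundary [Finite Φ] (hPE : ∀ h, PE h → PE (w.mate h))
    (hc : ∀ c : Φ → k, (∀ h, PE h → c (ℓ h) = c (ℓ (w.mate h))) →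
      ∀ f g, PB f → PB g → c f = c g) :
    Nat.card {f // PB f} ≤ finrank k (LinearMap.range (w.faceCoboundary k ℓ PB PE)) + 1 := by
  classical
  have := Fintype.ofFinite Φ
  rw [Nat.card_eq_fintype_card]
  refine card_le_finrank_range_add_one _ fun u hu a b => ?_
  have := hc (Function.extend Subtype.val u 0) ?_ a b a.2 b.2
  · rwa [extend_val _ a.2, extend_val _ b.2] at this
  · refine w.forall_edge (fun h hQ hP => ?_) fun h ho hP => ?_
    · rw [mate_mate']
      simpa using (hQ (by simpa using hPE _ hP)).symm
    · exact sub_eq_zero.1 (congrFun hu ⟨h, ho, hP⟩)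

theorem card_le_finrank_vertexCoboundary (hPE : ∀ h, PE h → PE (w.mate h))
    (hc : ∀ c : Option w.V → k,
      (∀ h, PE h → c (w.collapsedVertex h) = c (w.collapsedVertex (w.mate h))) →
      ∀ f g, PX f → PX g → c f = c g) :
    Nat.card {x // PX x} ≤ finrank k (LinearMap.range (w.vertexCoboundary k PX PE)) + 1 := by
  classical
  rw [Nat.card_eq_fintype_card]
  refine card_le_finrank_range_add_one _ fun u hu a b => ?_
  have := hc (Function.extend Subtype.val u 0) ?_ a b a.2 b.2
  · rwa [extend_val _ a.2, extend_val _ b.2] at this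
  · refine w.forall_edge (fun h hQ hP => ?_) fun h ho hP => ?_
    · rw [mate_mate']
      simpa using (hQ (by simpa using hPE _ hP)).symm
    · exact (sub_eq_zero.1 (congrFun hu ⟨h, ho, hP⟩)).symm

/-- This serves when some faces are left out of `PB`: extension by zero fixes the constant, and no
dimension is lost. -/
theorem card_le_finrank_faceCoboundary_of_injective [Finite Φ] (hPE : ∀ h, PE h → PE (w.mate h))
    (hc : ∀ c : Φ → k, (∀ f, ¬ PB f → c f = 0) → (∀ h, PE h → c (ℓ h) = c (ℓ (w.mate h))) →
      ∀ f, c f = 0) :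
    Nat.card {f // PB f} ≤ finrank k (LinearMap.range (w.faceCoboundary k ℓ PB PE)) := by
  classical
  have := Fintype.ofFinite Φ
  rw [Nat.card_eq_fintype_card]
  refine (card_eq_finrank_range _ fun u hu => funext fun a => ?_).le
  have := hc (Function.extend Subtype.val u 0) (fun f hf => extend_of_not _ hf) ?_ a
  · rwa [extend_val _ a.2] at this
  · refine w.forall_edge (fun h hQ hP => ?_) fun h ho hP => ?_
    · rw [mate_mate']
      simpa using (hQ (by simpa using hPE _ hP)).symm
    · exact sub_eq_zero.1 (congrFun hu ⟨h, ho, hP⟩)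

end Coboundary

/-- A function on vertices that is constant along edges is constant on connected components. -/
theorem eq_of_reachable {α : Type*} {c : Option w.V → α}
    (hc : ∀ h, w.collapsed.Reachable none (w.collapsedVertex h) →
      c (w.collapsedVertex h) = c (w.collapsedVertex (w.mate h))) {x : Option w.V}
    (hx : w.collapsed.Reachable none x) : c x = c none := by
  have hx' := hx
  rw [SimpleGraph.reachable_iff_reflTransGen] at hx
  induction hx with
  | refl => rfl
  | @tail y z hy hyz ih =>
    have hy' := (SimpleGraph.reachable_iff_reflTransGen _ _).2 hy
    rw [← ih hy']
    rw [collapsed, SimpleGraph.fromRel_adj] at hyz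
    rcases hyz.2 with ⟨g, rfl, rfl⟩ | ⟨g, rfl, rfl⟩
    · exact (hc g hy').symm
    · exact hc g hx'

theorem gap_eq_left {f : w.F} {j : Fin (n + 1)} (hj : w.gap j = f) :
    f = w.unbounded ∨ ∃ i, w.left (.bdry i) = f := by
  subst hj
  rcases Fin.eq_castSucc_or_eq_last j with ⟨i, rfl⟩ | rfl
  · exact Or.inr ⟨i, w.left_bdry i⟩
  · exact Or.inl w.gap_last

theorem unbounded_eq_left_bdry (i : Fin n) : ∃ j, w.unbounded = w.left (.bdry j) := by
  cases n with
  | zero => exact i.elim0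
  | succ m => exact ⟨0, by rw [w.left_bdry]; rfl⟩

/-- The boundary half-edges form a single orbit of `turn`. -/
theorem left_bdry_induction {Q : HalfEdge n w.V → Prop} (ht : ∀ h, Q h → Q (turn h))
    {j : Fin n} (hj : Q (.bdry j)) (i : Fin n) : Q (.bdry i) := by
  cases n with
  | zero => exact i.elim0
  | succ m =>
    have h0 : ∀ t : ℕ, Q (.bdry (((finRotate (m + 1)) ^ t) j)) := by
      intro t
      induction t with
      | zero => exact hj
      | succ t ih =>
        have := ht _ ih
        rwa [turn_bdry, ← Equiv.Perm.mul_apply, ← pow_succ'] at this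
    -- With one boundary point the rotation is the identity, which does not count as a cycle.
    by_cases hm : m = 0
    · subst hm
      rwa [show i = j from Fin.ext (by omega)]
    · have hc : (finRotate (m + 1)).IsCycle := by
        obtain ⟨m', rfl⟩ := Nat.exists_eq_succ_of_ne_zero hm
        exact isCycle_finRotate
      have hs : ∀ x, finRotate (m + 1) x ≠ x := by
        intro x
        obtain ⟨m', rfl⟩ := Nat.exists_eq_succ_of_ne_zero hm
        have := support_finRotate (n := m')
        have hx : x ∈ (finRotate (m' + 2)).support := by rw [this]; simp
        exact Equiv.Perm.mem_support.1 hx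
      obtain ⟨t, ht⟩ := (hc.sameCycle (hs j) (hs i)).exists_nat_pow_eq
      rw [← ht]
      exact h0 t

end Diagram

end SL3Web

/-! ### Reduced webs have no circles and no floating components -/

namespace SL3Web

open HalfEdge Module

namespace Diagram

variable {n : ℕ} (w : Diagram n)

open Classical in
theorem sum_ncard_left (s : Finset w.F) :
    ∑ f ∈ s, {h | w.left h = f}.ncard = (Finset.univ.filter fun h => w.left h ∈ s).card := by
  rw [Finset.card_eq_sum_card_fiberwise (f := w.left) (t := s) (by intro h; simp)]
  refine Finset.sum_congr rfl fun f hf => ?_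
  rw [Set.ncard_eq_toFinset_card']
  congr 1
  ext h
  simp only [Set.mem_toFinset, Set.mem_ofPred_eq, Finset.mem_filter, Finset.mem_univ, true_and]
  constructor
  · rintro rfl
    exact ⟨hf, rfl⟩
  · exact fun h => h.2

open Classical in
theorem sum_ncard_circle (c : w.O → w.F) (s : Finset w.F) :
    ∑ f ∈ s, {o | c o = f}.ncard ≤ Nat.card w.O := by
  calc ∑ f ∈ s, {o | c o = f}.ncard = ∑ f ∈ s, (Finset.univ.filter fun o => c o = f).card := by
        refine Finset.sum_congr rfl fun f _ => ?_
        rw [Set.ncard_eq_toFinset_card']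
        congr 1
        ext
        simp
    _ ≤ ∑ f, (Finset.univ.filter fun o => c o = f).card :=
        Finset.sum_le_sum_of_subset (Finset.subset_univ s)
    _ = Nat.card w.O := by
        rw [← Finset.card_eq_sum_card_fiberwise (f := c) (s := Finset.univ) (by intro h; simp)]
        simp

theorem reachable_turn {h : HalfEdge n w.V} :
    w.collapsed.Reachable none (w.collapsedVertex (turn h)) ↔
      w.collapsed.Reachable none (w.collapsedVertex h) := by simp

theorem reachable_mate {h : HalfEdge n w.V} :
    w.collapsed.Reachable none (w.collapsedVertex (w.mate h)) ↔
      w.collapsed.Reachable none (w.collapsedVertex h) :=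
  ⟨fun e => e.trans (w.collapsed_adj_or_eq h).symm, fun e => e.trans (w.collapsed_adj_or_eq h)⟩

/-- A function constant under `turn` and `mate` on the component of the `x`-axis is constant. -/
theorem eq_of_turn_of_mate {α : Type*} {c : HalfEdge n w.V → α}
    (ht : ∀ h, w.collapsed.Reachable none (w.collapsedVertex h) → c (turn h) = c h)
    (hm : ∀ h, w.collapsed.Reachable none (w.collapsedVertex h) → c (w.mate h) = c h)
    (h g : HalfEdge n w.V) (hh : w.collapsed.Reachable none (w.collapsedVertex h))
    (hg : w.collapsed.Reachable none (w.collapsedVertex g)) : c h = c g := by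
  suffices key : ∀ i : Fin n, ∀ h : HalfEdge n w.V,
      w.collapsed.Reachable none (w.collapsedVertex h) → c h = c (.bdry i) by
    rcases h with i | ⟨v, k⟩
    · exact (key i g hg).symm
    · rcases g with i | ⟨u, l⟩
      · exact key i _ hh
      · cases n with
        | succ m => rw [key 0 _ hh, key 0 _ hg]
        | zero =>
          exfalso
          -- Without boundary points the collapsed axis is isolated, since `isSome` is constant
          -- along edges.
          have := w.eq_of_reachable (c := fun x => x.isSome) ?_ hg
          · cases this
          · intro a ha
            have h1 : ∀ b : HalfEdge 0 w.V, (w.collapsedVertex b).isSome = true := by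
              rintro (i | ⟨v, k⟩)
              · exact i.elim0
              · rfl
            rw [h1, h1]
  intro i h hh
  have h1 := w.induction_of_reachable
    (Q := fun h => w.collapsed.Reachable none (w.collapsedVertex h) → c h = c (.bdry i))
    ?_ ?_ ?_ h hh hh
  · exact h1
  · intro j hj
    refine (w.left_bdry_induction (Q := fun h =>
      w.collapsed.Reachable none (w.collapsedVertex h) ∧ c h = c (.bdry i)) ?_ (j := i) ?_ j).2
    · rintro h ⟨h1, h2⟩
      exact ⟨w.reachable_turn.2 h1, (ht h h1).trans h2⟩
    · exact ⟨SimpleGraph.Reachable.refl _, rfl⟩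
  · intro v k h1 h2
    have h3 := ht _ h2
    rw [turn_inner, add_sub_cancel_right] at h3
    rw [← h3]
    exact h1 h2
  · intro h h1 h2
    rw [w.reachable_mate] at h2
    exact (hm h h2).trans (h1 h2)

end Diagram

namespace BottomWeb

variable {n : ℕ} (w : BottomWeb n)

/-- In a reduced web there are no circles and no components away from the `x`-axis. -/
theorem connected_of_reduced (hw : w.Reduced) : IsEmpty w.O ∧ w.collapsed.Connected := by
  classical
  -- `KX`, `K` and `KF` single out the vertices, half-edges and faces of the component of the axis.
  -- Every face outside `KF` is closed, so the six-edge condition applies to it.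
  let KX : Option w.V → Prop := fun x => w.collapsed.Reachable none x
  let K : HalfEdge n w.V → Prop := fun h => KX (w.collapsedVertex h)
  let KF : w.F → Prop := fun f => f = w.unbounded ∨ ∃ h, K h ∧ w.left h = f
  have hK : ∀ h, K h → K (w.mate h) := fun h => w.reachable_mate.2
  have hK' : ∀ h, ¬ K h → ¬ K (w.mate h) := fun h => mt w.reachable_mate.1
  have e1 := w.euler_inequality (k := ℚ) (ℓ := w.left) (PB := KF) (PX := KX) (PE := K)
    (fun h => w.left_turn h) (fun h hh => Or.inr ⟨hh, hK' h hh⟩)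
  have e2 := w.card_le_finrank_faceCoboundary (k := ℚ) (ℓ := w.left) (PB := KF) (PE := K) hK (by
    intro c hc
    have h2 := w.eq_of_turn_of_mate (c := fun h => c (w.left h))
      (fun h hh => by rw [w.left_turn]; exact (hc h hh).symm) (fun h hh => (hc h hh).symm)
    have h3 : ∀ f, KF f → c f = c w.unbounded := by
      rintro f (rfl | ⟨h, hh, rfl⟩)
      · rfl
      · by_cases hn : Nonempty (Fin n)
        · obtain ⟨i⟩ := hn
          obtain ⟨j, hj⟩ := w.unbounded_eq_left_bdry i
          rw [hj]
          exact h2 _ _ hh (SimpleGraph.Reachable.refl _)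
        · exfalso
          have := w.eq_of_reachable (c := fun x => x.isSome) ?_ hh
          · cases h with
            | bdry i => exact hn ⟨i⟩
            | inner v k => cases this
          · intro a ha
            have h1 : ∀ b : HalfEdge n w.V, (w.collapsedVertex b).isSome = true := by
              rintro (i | ⟨v, k⟩)
              · exact (hn ⟨i⟩).elim
              · rfl
            rw [h1, h1]
    intro f g hf hg
    rw [h3 f hf, h3 g hg])
  have e3 := w.card_le_finrank_vertexCoboundary (k := ℚ) (PX := KX) (PE := K) hK (by
    intro c hc f g hf hg
    rw [w.eq_of_reachable hc hf, w.eq_of_reachable hc hg])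
  -- counting
  have c1 : Nat.card {x // KX x} + Nat.card {v // ¬ KX (some v)} = Nat.card w.V + 1 := by
    have h1 : Nat.card {v // ¬ KX (some v)} = Nat.card {x // ¬ KX x} := by
      refine Nat.card_congr (Equiv.ofBijective (fun v => ⟨some v.1, v.2⟩) ⟨?_, ?_⟩)
      · rintro ⟨a, ha⟩ ⟨b, hb⟩ hab
        simpa using hab
      · rintro ⟨x, hx⟩
        cases x with
        | none => exact (hx (SimpleGraph.Reachable.refl _)).elim
        | some v => exact ⟨⟨v, hx⟩, rfl⟩
    rw [h1, ← Finite.card_option, Nat.card_eq_fintype_card, Nat.card_eq_fintype_card,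
      Nat.card_eq_fintype_card, Fintype.card_subtype_compl]
    have := Fintype.card_subtype_le KX
    omega
  have c2 : Nat.card {h // w.IsOut h ∧ K h} + Nat.card {h // w.IsOut h ∧ ¬ K h} = w.numEdges := by
    rw [w.numEdges_eq]
    simp only [Nat.card_eq_fintype_card, Fintype.card_subtype]
    rw [← Finset.card_union_of_disjoint]
    · congr 1
      ext h
      simp
      tauto
    · rw [Finset.disjoint_filter]
      tauto
  have c3 : (Finset.univ.filter fun h => ¬ K h).card = 2 * Nat.card {h // w.IsOut h ∧ ¬ K h} := by
    have := w.sum_out_add (fun h => if ¬ K h then 1 else 0)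
    rw [Finset.card_filter, ← this, Nat.card_eq_fintype_card, Fintype.card_subtype,
      Finset.card_filter, Finset.mul_sum]
    rw [← Finset.sum_subtype (s := Finset.univ.filter fun h => w.IsOut h) (by simp)
      (fun h => (if ¬ K h then 1 else 0) + (if ¬ K (w.mate h) then 1 else 0)), Finset.sum_filter]
    refine Finset.sum_congr rfl fun h _ => ?_
    have : K (w.mate h) ↔ K h := w.reachable_mate
    by_cases h1 : w.IsOut h <;> by_cases h2 : K h <;> simp [h1, h2, this]
  have c4 : (Finset.univ.filter fun h => ¬ K h).card = 3 * Nat.card {v // ¬ KX (some v)} := by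
    rw [Finset.card_filter, HalfEdge.sum_eq, Nat.card_eq_fintype_card, Fintype.card_subtype,
      Finset.card_filter, Finset.mul_sum]
    have h1 : ∀ i : Fin n, K (.bdry i) := fun i => SimpleGraph.Reachable.refl _
    have h2 : ∀ v k, K (.inner v k) ↔ KX (some v) := fun v k => Iff.rfl
    simp only [h1, h2]
    simp
  have c5 : Nat.card {f // KF f} + (Finset.univ.filter fun f => ¬ KF f).card = Nat.card w.F := by
    rw [Nat.card_eq_fintype_card, Fintype.card_subtype, Nat.card_eq_fintype_card,
      Finset.card_filter_add_card_filter_not]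
    rfl
  have c6 : 6 * (Finset.univ.filter fun f => ¬ KF f).card ≤
      (Finset.univ.filter fun h => ¬ K h).card + Nat.card w.O + Nat.card w.O := by
    set s := Finset.univ.filter fun f => ¬ KF f with hs
    calc 6 * s.card = ∑ f ∈ s, 6 := by simp [mul_comm]
      _ ≤ ∑ f ∈ s, w.numBoundaryEdges f := by
          refine Finset.sum_le_sum fun f hf => hw f fun j hj => ?_
          have hf' : ¬ KF f := by simpa [hs] using hf
          rcases w.gap_eq_left hj with h | ⟨i, hi⟩
          · exact hf' (Or.inl h)
          · exact hf' (Or.inr ⟨_, SimpleGraph.Reachable.refl _, hi⟩)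
      _ = ∑ f ∈ s, {h | w.left h = f}.ncard + ∑ f ∈ s, {c | w.circleLeft c = f}.ncard +
          ∑ f ∈ s, {c | w.circleRight c = f}.ncard := by
          rw [← Finset.sum_add_distrib, ← Finset.sum_add_distrib]
          rfl
      _ ≤ _ := by
          rw [w.sum_ncard_left]
          gcongr
          · intro hh hK
            simp only [hs, Finset.mem_filter, Finset.mem_univ, true_and] at hh
            exact hh (Or.inr ⟨_, hK, rfl⟩)
          · exact w.sum_ncard_circle _ _
          · exact w.sum_ncard_circle _ _
  have c7 := w.euler
  have hne : Nonempty w.collapsed.ConnectedComponent := ⟨w.collapsed.connectedComponentMk none⟩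
  have c8 : 0 < Nat.card w.collapsed.ConnectedComponent := Nat.card_pos
  -- Let `V'`, `E'`, `F'` count what lies off the component of the axis, and `C`, `O` the components
  -- and the circles. Euler's formula and the genus inequality give `E' + C + O ≤ 1 + V' + F'`. With
  -- `2E' = 3V'` and `6F' ≤ 2E' + 2O` there remains `C + 2O/3 ≤ 1`.
  have c9 : Nat.card w.collapsed.ConnectedComponent = 1 ∧ Nat.card w.O = 0 := by omega
  refine ⟨?_, ?_⟩
  · rcases Nat.card_eq_zero.1 c9.2 with h | h
    · exact h
    · exact (not_finite_iff_infinite.2 h w.finO).elim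
  · have := (Nat.card_eq_one_iff_unique.1 c9.1).1
    have : w.collapsed.Preconnected := fun a b =>
      SimpleGraph.ConnectedComponent.exact (Subsingleton.elim _ _)
    exact ⟨this⟩

end BottomWeb

end SL3Web

/-! ### Connected webs: potentials, distinct sides of edges, faces as cycles -/

namespace SL3Web

open HalfEdge Module

namespace BottomWeb

variable {n : ℕ} {w : BottomWeb n}

/-- The web has no circles and all its components reach the `x`-axis. -/
structure IsConn (w : BottomWeb n) : Prop where
  noCircle : IsEmpty w.O
  conn : w.collapsed.Connected

theorem Reduced.isConn (hw : w.Reduced) : w.IsConn :=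
  ⟨(w.connected_of_reduced hw).1, (w.connected_of_reduced hw).2⟩

namespace IsConn

theorem card_add_card (hw : w.IsConn) : Nat.card w.V + Nat.card w.F = w.numEdges + 1 := by
  have h1 := w.euler
  have h2 : Nat.card w.O = 0 := Nat.card_eq_zero.2 (Or.inl hw.noCircle)
  have h3 : Nat.card w.collapsed.ConnectedComponent = 1 := by
    have := hw.conn.preconnected.subsingleton_connectedComponent
    have : Nonempty w.collapsed.ConnectedComponent := ⟨w.collapsed.connectedComponentMk none⟩
    exact Nat.card_eq_one_iff_unique.2 ⟨inferInstance, inferInstance⟩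
  omega

theorem dual_adj (hw : w.IsConn) {f g : w.F} (h : w.dual.Adj f g) :
    f ≠ g ∧ ∃ h, w.left h = f ∧ w.right h = g := by
  have := hw.noCircle
  rw [Diagram.dual, SimpleGraph.fromRel_adj] at h
  refine ⟨h.1, ?_⟩
  rcases h.2 with (h | ⟨c, _⟩) | (⟨h, h1, h2⟩ | ⟨c, _⟩)
  · exact h
  · exact isEmptyElim c
  · exact ⟨w.mate h, h2, by rw [w.right_mate, h1]⟩
  · exact isEmptyElim c

theorem face_induction (hw : w.IsConn) {Q : w.F → Prop} (h : ∀ h, Q (w.left h) → Q (w.right h))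
    {f : w.F} (hf : Q f) (g : w.F) : Q g := by
  have := (SimpleGraph.reachable_iff_reflTransGen _ _).1 (w.dual_connected.preconnected f g)
  induction this with
  | refl => exact hf
  | tail _ hbc ih =>
    obtain ⟨_, h', rfl, rfl⟩ := hw.dual_adj hbc
    exact h h' ih

theorem face_const (hw : w.IsConn) {α : Type*} {c : w.F → α}
    (h : ∀ h, c (w.left h) = c (w.right h)) (f g : w.F) : c f = c g :=
  (hw.face_induction (Q := fun g => c g = c f) (fun a ha => by rw [← h, ha]) rfl g).symm

theorem vertex_const (hw : w.IsConn) {α : Type*} {c : Option w.V → α}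
    (h : ∀ h, c (w.collapsedVertex h) = c (w.collapsedVertex (w.mate h))) (x y : Option w.V) :
    c x = c y := by
  rw [w.eq_of_reachable (fun a _ => h a) (hw.conn.preconnected none x),
    w.eq_of_reachable (fun a _ => h a) (hw.conn.preconnected none y)]

theorem halfEdge_const (hw : w.IsConn) {α : Type*} {c : HalfEdge n w.V → α}
    (ht : ∀ h, c (turn h) = c h) (hm : ∀ h, c (w.mate h) = c h) (h g : HalfEdge n w.V) :
    c h = c g :=
  w.eq_of_turn_of_mate (fun h _ => ht h) (fun h _ => hm h) h g (hw.conn.preconnected _ _)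
    (hw.conn.preconnected _ _)

variable {k : Type} [Field k]

theorem rank_face (hw : w.IsConn) : Nat.card w.F ≤
    finrank k (LinearMap.range (w.faceCoboundary k w.left (fun _ => True) (fun _ => True))) + 1 := by
  have := w.card_le_finrank_faceCoboundary (k := k) (ℓ := w.left) (PB := fun _ => True)
    (PE := fun _ => True) (fun _ _ => trivial)
    (fun c hc f g _ _ => hw.face_const (fun h => hc h trivial) f g)
  rwa [Nat.card_congr (Equiv.subtypeUnivEquiv (fun _ => trivial))] at this

/-- The collapsed axis is an extra vertex and makes up for the dimension lost to constants. With
`rank_face` and `card_add_card`, the two coboundary spaces fill the space of functions on edges. -/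
theorem rank_vertex (hw : w.IsConn) : Nat.card w.V ≤
    finrank k (LinearMap.range (w.vertexCoboundary k (fun _ => True) (fun _ => True))) := by
  have := w.card_le_finrank_vertexCoboundary (k := k) (PX := fun _ => True)
    (PE := fun _ => True) (fun _ _ => trivial)
    (fun c hc f g _ _ => hw.vertex_const (fun h => hc h trivial) f g)
  rw [Nat.card_congr (Equiv.subtypeUnivEquiv (fun _ => trivial)), Finite.card_option] at this
  omega

theorem card_edges : Nat.card {h // w.IsOut h ∧ True} = w.numEdges := by
  rw [w.numEdges_eq]
  simp

/-- A flow on the edges that is conserved at the internal vertices comes from a function on the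
faces. -/
theorem exists_face_potential (hw : w.IsConn) (g : HalfEdge n w.V → k)
    (hg : ∀ h, g (w.mate h) = - g h) (hv : ∀ v, ∑ j, g (.inner v j) = 0) :
    ∃ p : w.F → k, ∀ h, g h = p (w.left h) - p (w.right h) := by
  classical
  have h1 := exists_eq_of_orthogonal _ _ (w.coboundary_orthogonal (k := k) (ℓ := w.left)
    (PB := fun _ => True) (PX := fun _ => True) (PE := fun _ => True) (fun h => w.left_turn h)
    (by simp)) (by
      rw [← Nat.card_eq_fintype_card, card_edges]
      have h1 := hw.rank_face (k := k)
      have h2 := hw.rank_vertex (k := k)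
      have h3 := hw.card_add_card
      omega) (fun h => g h) (by
      intro y
      set z : Option w.V → k := Function.extend Subtype.val y 0
      have h1 := w.sum_out_add (fun h => g h * z (w.collapsedVertex h))
      -- Conservation at the collapsed axis is not assumed. By antisymmetry the total flow is zero,
      -- and the internal vertices contribute nothing to it.
      have h2 : ∑ h, g h = 0 := by
        rw [← w.sum_out_add]
        exact Finset.sum_eq_zero fun h _ => by rw [hg]; ring
      have h3 : ∑ h, g h * z (w.collapsedVertex h) = 0 := by
        rw [HalfEdge.sum_eq] at h2 ⊢
        simp only [hv, Finset.sum_const_zero, add_zero] at h2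
        have h4 : ∀ v, ∑ j, g (.inner v j) * z (w.collapsedVertex (.inner v j)) = 0 := fun v => by
          simp only [Diagram.collapsedVertex]
          rw [← Finset.sum_mul, hv, zero_mul]
        simp only [h4, Finset.sum_const_zero, add_zero]
        simp only [Diagram.collapsedVertex]
        rw [← Finset.sum_mul, h2, zero_mul]
      rw [h3] at h1
      rw [dotProduct, ← neg_eq_zero, ← h1, ← Finset.sum_neg_distrib]
      refine Fintype.sum_equiv (Equiv.subtypeEquivRight (by simp)) _ _ fun h => ?_
      rw [w.vertexCoboundary_apply]
      simp only [Equiv.subtypeEquivRight_apply_coe, hg]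
      ring)
  obtain ⟨u, hu⟩ := h1
  refine ⟨Function.extend Subtype.val u 0, ?_⟩
  refine w.forall_edge (fun h hh => ?_) fun h ho => ?_
  · rw [hg, hh, w.right_mate, w.left_mate]
    ring
  · exact (congrFun hu ⟨h, ho, trivial⟩).symm

/-- A flow on the dual edges that is conserved at the faces comes from a function on the
vertices. -/
theorem exists_vertex_potential (hw : w.IsConn) (g : HalfEdge n w.V → k)
    (hg : ∀ h, g (w.mate h) = - g h)
    (hf : ∀ q : w.F → k, ∑ h, g h * q (w.left h) = 0) :
    ∃ y : Option w.V → k, ∀ h, g h = y (w.collapsedVertex (w.mate h)) - y (w.collapsedVertex h) := by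
  classical
  have h1 := exists_eq_of_orthogonal _ _ (fun u v => (dotProduct_comm _ _).trans
    (w.coboundary_orthogonal (k := k) (ℓ := w.left)
    (PB := fun _ => True) (PX := fun _ => True) (PE := fun _ => True) (fun h => w.left_turn h)
    (by simp) v u)) (by
      rw [← Nat.card_eq_fintype_card, card_edges]
      have h1 := hw.rank_face (k := k)
      have h2 := hw.rank_vertex (k := k)
      have h3 := hw.card_add_card
      omega) (fun h => g h) (by
      intro y
      set z : w.F → k := Function.extend Subtype.val y 0 with hz
      have h1 := w.sum_out_add (fun h => g h * z (w.left h))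
      rw [hf] at h1
      rw [dotProduct, ← h1]
      refine Fintype.sum_equiv (Equiv.subtypeEquivRight (by simp)) _ _ fun h => ?_
      rw [w.faceCoboundary_apply]
      simp only [Equiv.subtypeEquivRight_apply_coe, hg, ← hz]
      ring)
  obtain ⟨u, hu⟩ := h1
  refine ⟨Function.extend Subtype.val u 0, ?_⟩
  refine w.forall_edge (fun h hh => ?_) fun h ho => ?_
  · rw [hg, hh, w.mate_mate']
    ring
  · exact (congrFun hu ⟨h, ho, trivial⟩).symm

/-- The faces are three-coloured: the two sides of an edge are different faces. -/
theorem left_ne_right (hw : w.IsConn) (h : HalfEdge n w.V) : w.left h ≠ w.right h := by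
  classical
  have : Fact (Nat.Prime 3) := ⟨Nat.prime_three⟩
  -- The unit flow along all edges is conserved modulo three at trivalent sources and sinks, so its
  -- potential changes by `±1` across each edge.
  obtain ⟨p, hp⟩ := hw.exists_face_potential (k := ZMod 3) (fun h => if w.IsOut h then 1 else -1)
    (fun h => by by_cases hh : w.IsOut h <;> simp [w.isOut_mate, hh])
    (fun v => by
      have h1 : ∀ j, w.IsOut (.inner v j) ↔ w.IsOut (.inner v 0) := fun j => Iff.rfl
      simp only [h1, Finset.sum_const, Finset.card_univ, ZMod.card, nsmul_eq_mul]
      have h3 : ((3 : ℕ) : ZMod 3) = 0 := rfl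
      rw [h3, zero_mul])
  intro e
  have := hp h
  rw [e, sub_self] at this
  split_ifs at this
  · exact one_ne_zero this
  · exact neg_ne_zero.2 one_ne_zero this

end IsConn

variable (w) in
/-- The next half-edge of the boundary of the face on the left. -/
def walk : Equiv.Perm (HalfEdge n w.V) := w.matePerm.trans turn

theorem walk_apply (h : HalfEdge n w.V) : w.walk h = turn (w.mate h) := rfl

@[simp] theorem left_walk (h : HalfEdge n w.V) : w.left (w.walk h) = w.left h := by
  rw [walk_apply, w.left_turn, w.right_mate]

theorem left_eq_of_sameCycle {h g : HalfEdge n w.V} (hg : w.walk.SameCycle h g) :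
    w.left h = w.left g := by
  classical
  obtain ⟨t, rfl⟩ := hg.exists_nat_pow_eq
  induction t with
  | zero => rfl
  | succ t ih =>
    rw [pow_succ', Equiv.Perm.mul_apply, left_walk]
    exact ih ((Equiv.Perm.SameCycle.refl _ _).pow_right)

namespace IsConn

theorem exists_left_eq (hw : w.IsConn) (h0 : HalfEdge n w.V) (f : w.F) : ∃ h, w.left h = f :=
  hw.face_induction (Q := fun f => ∃ h, w.left h = f) (fun h _ => ⟨w.mate h, rfl⟩) ⟨h0, rfl⟩ f

/-- The half-edges with a given face on the left form a single cycle. -/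
theorem sameCycle (hw : w.IsConn) {h g : HalfEdge n w.V} (hg : w.left h = w.left g) :
    w.walk.SameCycle h g := by
  classical
  -- A priori a face may have several boundary cycles. The genus inequality with cycles in place of
  -- faces shows that there are no more cycles than faces.
  let s : Setoid (HalfEdge n w.V) := Equiv.Perm.SameCycle.setoid w.walk
  let Φ := Quotient s
  have : Fintype Φ := Fintype.ofFinite _
  let ℓ : HalfEdge n w.V → Φ := fun h => ⟦h⟧
  have hℓ : ∀ h, ℓ (turn h) = ℓ (w.mate h) := by
    intro h
    refine Quotient.sound ?_
    change w.walk.SameCycle _ _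
    have : turn h = w.walk (w.mate h) := by rw [walk_apply, w.mate_mate]
    rw [this]
    exact Equiv.Perm.sameCycle_apply_left.2 (Equiv.Perm.SameCycle.refl _ _)
  have e1 := w.euler_inequality (k := ℚ) (ℓ := ℓ) (PB := fun _ => True) (PX := fun _ => True)
    (PE := fun _ => True) hℓ (by simp)
  have e2 := w.card_le_finrank_faceCoboundary (k := ℚ) (ℓ := ℓ) (PB := fun _ => True)
    (PE := fun _ => True) (fun _ _ => trivial) (by
      intro c hc f g _ _
      obtain ⟨a, rfl⟩ := Quotient.exists_rep f
      obtain ⟨b, rfl⟩ := Quotient.exists_rep g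
      exact hw.halfEdge_const (c := fun h => c (ℓ h))
        (fun h => by rw [hℓ]; exact (hc h trivial).symm) (fun h => (hc h trivial).symm) a b)
  rw [Nat.card_congr (Equiv.subtypeUnivEquiv (fun _ => trivial))] at e2
  have e3 := hw.rank_vertex (k := ℚ)
  rw [card_edges] at e1
  have e4 := hw.card_add_card
  let π : Φ → w.F := Quotient.lift w.left fun a b hab => left_eq_of_sameCycle hab
  have hπ : Function.Surjective π := by
    intro f
    obtain ⟨a, ha⟩ := hw.exists_left_eq h f
    exact ⟨⟦a⟧, ha⟩
  have e5 : Nat.card Φ ≤ Nat.card w.F := by omega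
  have hinj : Function.Injective π := by
    rw [Nat.card_eq_fintype_card, Nat.card_eq_fintype_card] at e5
    exact ((Fintype.bijective_iff_surjective_and_card π).2
      ⟨hπ, le_antisymm e5 (Fintype.card_le_of_surjective π hπ)⟩).1
  exact Quotient.exact (hinj (a₁ := ⟦h⟧) (a₂ := ⟦g⟧) hg)

/-- In a reduced web, a set of at most five internal half-edges is not closed under walking around
a face. -/
theorem not_short_face (hw : w.IsConn) (hr : w.Reduced) (R : Finset (HalfEdge n w.V))
    (hR : R.card ≤ 5) {h : HalfEdge n w.V} (hh : h ∈ R) (hc : ∀ g ∈ R, g.IsInner ∧ w.walk g ∈ R) :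
    False := by
  classical
  have := hw.noCircle
  have key : ∀ g, w.left g = w.left h → g ∈ R := by
    intro g hg
    obtain ⟨t, rfl⟩ := (hw.sameCycle hg.symm).exists_nat_pow_eq
    clear hg
    induction t with
    | zero => exact hh
    | succ t ih =>
      rw [pow_succ', Equiv.Perm.mul_apply]
      exact (hc _ ih).2
  have h1 : w.IsClosedFace (w.left h) := by
    intro j hj
    obtain ⟨i, hi⟩ : ∃ i, w.left (.bdry i) = w.left h := by
      rcases w.gap_eq_left hj with e | e
      · by_cases hn : Nonempty (Fin n)
        · obtain ⟨i⟩ := hn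
          obtain ⟨j, hj⟩ := w.unbounded_eq_left_bdry i
          exact ⟨j, by rw [e, hj]⟩
        · exfalso
          have := hw.vertex_const (c := fun x => x.isSome) ?_ none (w.collapsedVertex h)
          · cases h with
            | bdry i => exact hn ⟨i⟩
            | inner v k => cases this
          · intro a
            have h1 : ∀ b : HalfEdge n w.V, (w.collapsedVertex b).isSome = true := by
              rintro (i | ⟨v, k⟩)
              · exact (hn ⟨i⟩).elim
              · rfl
            rw [h1, h1]
      · exact e
    exact not_isInner_bdry i (hc _ (key _ hi)).1
  have h2 := hr _ h1
  have h3 : {c | w.circleLeft c = w.left h}.ncard = 0 := by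
    rw [Set.eq_empty_of_isEmpty {c | w.circleLeft c = w.left h}, Set.ncard_empty]
  have h4 : {c | w.circleRight c = w.left h}.ncard = 0 := by
    rw [Set.eq_empty_of_isEmpty {c | w.circleRight c = w.left h}, Set.ncard_empty]
  rw [numBoundaryEdges, h3, h4] at h2
  have h5 : {g | w.left g = w.left h}.ncard ≤ R.card := by
    rw [← Set.ncard_coe_finset]
    exact Set.ncard_le_ncard (fun g hg => key g hg) (Finset.finite_toSet R)
  omega

end IsConn

end BottomWeb

end SL3Web

/-! ### Regions of faces: Gauss-Bonnet and separation modulo two -/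

namespace SL3Web

open HalfEdge

namespace BottomWeb

variable {n : ℕ} {w : BottomWeb n}

theorem IsConn.nonempty_fin (hw : w.IsConn) (h : HalfEdge n w.V) : Nonempty (Fin n) := by
  by_contra hn
  have := hw.vertex_const (c := fun x => x.isSome) ?_ none (w.collapsedVertex h)
  · cases h with
    | bdry i => exact hn ⟨i⟩
    | inner v k => cases this
  · intro a
    have h1 : ∀ b : HalfEdge n w.V, (w.collapsedVertex b).isSome = true := by
      rintro (i | ⟨v, k⟩)
      · exact (hn ⟨i⟩).elim
      · rfl
    rw [h1, h1]

/-- Reachability of faces through faces in `U`. -/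
def Linked (w : BottomWeb n) (U : Set w.F) : w.F → w.F → Prop :=
  Relation.ReflTransGen fun f g => g ∈ U ∧ ∃ h, w.left h = f ∧ w.right h = g

theorem Linked.mem {U : Set w.F} {f g : w.F} (h : w.Linked U f g) (hf : f ∈ U) : g ∈ U := by
  induction h with
  | refl => exact hf
  | tail _ h _ => exact h.1

theorem Linked.mono {U U' : Set w.F} (hU : U ⊆ U') {f g : w.F} (h : w.Linked U f g) :
    w.Linked U' f g :=
  Relation.ReflTransGen.mono (fun _ _ h => ⟨hU h.1, h.2⟩) _ _ h

theorem Linked.step {U : Set w.F} {f : w.F} {h : HalfEdge n w.V}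
    (hf : w.Linked U f (w.left h)) (hU : w.right h ∈ U) : w.Linked U f (w.right h) :=
  hf.tail ⟨hU, h, rfl, rfl⟩

/-- The connected component of a face among the faces in `U`. -/
def comp (w : BottomWeb n) (U : Set w.F) (f : w.F) : Set w.F := {g | w.Linked U f g}

theorem self_mem_comp {U : Set w.F} {f : w.F} : f ∈ w.comp U f := Relation.ReflTransGen.refl

theorem comp_subset {U : Set w.F} {f : w.F} (hf : f ∈ U) : w.comp U f ⊆ U := fun _ h => h.mem hf

theorem linked_comp {U : Set w.F} {f g : w.F} (h : g ∈ w.comp U f) :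
    w.Linked (w.comp U f) f g := by
  induction h with
  | refl => exact Relation.ReflTransGen.refl
  | tail h1 h2 ih => exact ih.tail ⟨h1.tail h2, h2.2⟩

theorem right_notMem_of_comp {U : Set w.F} {f : w.F} {h : HalfEdge n w.V}
    (h1 : w.left h ∈ w.comp U f) (h2 : w.right h ∉ w.comp U f) : w.right h ∉ U :=
  fun h3 => h2 (Linked.step h1 h3)

namespace IsConn

/-- A face that borders the component but lies outside it belongs to `S`. Hence a path of faces
leaves the component only through `S`, which is linked to the unbounded face. This makes components
admissible in Gauss-Bonnet. -/
theorem linked_compl_comp (hw : w.IsConn) {S : Set w.F}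
    (hS : ∀ f ∈ S, w.Linked S w.unbounded f) {f : w.F} (hf : f ∉ S) {g : w.F}
    (hg : g ∉ w.comp Sᶜ f) : w.Linked (w.comp Sᶜ f)ᶜ w.unbounded g := by
  have hSA : S ⊆ (w.comp Sᶜ f)ᶜ := fun x hx hx' => comp_subset hf hx' hx
  refine hw.face_induction (Q := fun g => g ∉ w.comp Sᶜ f →
    w.Linked (w.comp Sᶜ f)ᶜ w.unbounded g) ?_ (f := w.unbounded)
    (fun _ => Relation.ReflTransGen.refl) g hg
  intro h h1 h2
  by_cases h3 : w.right h ∈ S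
  · exact (hS _ h3).mono hSA
  · by_cases h4 : w.left h ∈ w.comp Sᶜ f
    · exact (right_notMem_of_comp h4 h2 h3).elim
    · exact (h1 h4).step h2

/-- A function on vertices that is constant along the edges of a connected set of faces is constant
on the vertices of these faces. -/
theorem eq_of_linked (hw : w.IsConn) {α : Type*} {y : Option w.V → α} {U : Set w.F}
    (hy : ∀ h, w.left h ∈ U → y (w.collapsedVertex h) = y (w.collapsedVertex (w.mate h)))
    {f g : w.F} (hf : f ∈ U) (hfg : w.Linked U f g) {a b : HalfEdge n w.V}
    (ha : w.left a = f) (hb : w.left b = g) :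
    y (w.collapsedVertex a) = y (w.collapsedVertex b) := by
  classical
  have h1 : ∀ a b, w.left a ∈ U → w.left a = w.left b →
      y (w.collapsedVertex a) = y (w.collapsedVertex b) := by
    intro a b ha hab
    obtain ⟨t, rfl⟩ := (hw.sameCycle hab).exists_nat_pow_eq
    clear hab
    have h2 : ∀ t, w.left ((w.walk ^ t) a) = w.left a ∧
        y (w.collapsedVertex ((w.walk ^ t) a)) = y (w.collapsedVertex a) := by
      intro t
      induction t with
      | zero => exact ⟨rfl, rfl⟩
      | succ t ih =>
        rw [pow_succ', Equiv.Perm.mul_apply, left_walk]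
        refine ⟨ih.1, ?_⟩
        rw [walk_apply, w.collapsedVertex_turn, ← hy _ (by rw [ih.1]; exact ha), ih.2]
    exact (h2 t).2.symm
  induction hfg generalizing b with
  | refl => exact h1 a b (ha ▸ hf) (ha.trans hb.symm)
  | @tail c d hc hd ih =>
    obtain ⟨hd1, h, rfl, rfl⟩ := hd
    rw [ih rfl, hy h (Linked.mem hc hf)]
    exact h1 _ _ (by simpa [w.left_mate] using hd1) hb.symm

/-- Gauss-Bonnet for a disc made of closed faces of a reduced web: its boundary has at least six
edges with both ends convex. -/
theorem six_le_ncard_convex (hw : w.IsConn) (hr : w.Reduced) {A : Set w.F} (hne : A.Nonempty)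
    (hcl : ∀ f ∈ A, w.IsClosedFace f) (hB : ∀ f ∉ A, w.Linked Aᶜ w.unbounded f) :
    6 ≤ {h | w.left h ∈ A ∧ w.right h ∉ A ∧ w.left (turn (turn h)) ∉ A ∧
      w.left (turn (turn (w.mate h))) ∉ A}.ncard := by
  classical
  have := hw.noCircle
  have hunb : w.unbounded ∉ A := fun h => hcl _ h 0 rfl
  obtain ⟨f0, hf0⟩ := hne
  obtain ⟨h0⟩ : Nonempty (HalfEdge n w.V) := by
    by_contra hn
    have := hw.face_const (c := id) (fun h => (hn ⟨h⟩).elim) f0 w.unbounded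
    exact hunb ((show f0 = w.unbounded from this) ▸ hf0)
  obtain ⟨i0⟩ := hw.nonempty_fin h0
  -- These predicates select all that touches the outside of `A`. Subtracted from Euler's formula,
  -- the genus inequality for this part shows that the faces of `A`, minus the edges and plus the
  -- vertices interior to `A`, number at least one.
  let PB : w.F → Prop := fun f => f ∉ A
  let PX : Option w.V → Prop := fun x => ∃ h, w.left h ∉ A ∧ w.collapsedVertex h = x
  let PE : HalfEdge n w.V → Prop := fun h => w.left h ∉ A ∨ w.right h ∉ A
  have hPE : ∀ h, PE h → PE (w.mate h) := by
    rintro h (hh | hh)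
    · exact Or.inr (by rwa [w.right_mate])
    · exact Or.inl hh
  have hbd : ∀ i, w.left (.bdry i) ∉ A := fun i h => hcl _ h _ (w.left_bdry i).symm
  have e1 := w.euler_inequality (k := ℚ) (ℓ := w.left) (PB := PB) (PX := PX) (PE := PE)
    (fun h => w.left_turn h) (fun h hh => Or.inl
      ⟨fun h' => hh (Or.inl h'), fun h' => hh (Or.inr h')⟩)
  have e2 := w.card_le_finrank_faceCoboundary_of_injective (k := ℚ) (ℓ := w.left) (PB := PB)
    (PE := PE) hPE (by
    intro c hc hc' f
    have h0 : c f0 = 0 := hc f0 (fun h => h hf0)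
    rw [← h0]
    refine hw.face_const (fun h => ?_) f f0
    by_cases hh : PE h
    · exact hc' h hh
    · have h1 : w.left h ∈ A ∧ w.right h ∈ A := by simpa [PE] using hh
      rw [hc _ (fun h => h h1.1), hc _ (fun h => h h1.2)])
  have e3 := w.card_le_finrank_vertexCoboundary (k := ℚ) (PX := PX) (PE := PE) hPE (by
    rintro c hc f g ⟨a, ha, rfl⟩ ⟨b, hb, rfl⟩
    obtain ⟨u, hu⟩ := hw.exists_left_eq h0 w.unbounded
    have hy : ∀ h, w.left h ∈ Aᶜ → c (w.collapsedVertex h) = c (w.collapsedVertex (w.mate h)) :=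
      fun h hh => hc h (Or.inl hh)
    rw [← hw.eq_of_linked hy hunb (hB _ ha) hu rfl, ← hw.eq_of_linked hy hunb (hB _ hb) hu rfl])
  let a : HalfEdge n w.V → ℤ := fun h => if w.left h ∈ A then 1 else 0
  have hturn : ∀ h, a (turn h) = a (w.mate h) := fun h => by simp only [a, w.left_turn]; rfl
  have hturn' : ∀ h, a (turn (w.mate h)) = a h := fun h => by rw [hturn, w.mate_mate']
  have habd : ∀ i, a (.bdry i) = 0 := fun i => if_neg (hbd i)
  have ha01 : ∀ h, a h = 0 ∨ a h = 1 := fun h => by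
    simp only [a]; split_ifs <;> simp
  have c1 : (Nat.card {x // PX x} : ℤ) +
      ∑ v, a (.inner v 0) * a (.inner v 1) * a (.inner v 2) = Nat.card w.V + 1 := by
    have h1 : PX none := ⟨.bdry i0, hbd i0, rfl⟩
    have h2 : ∀ v, (if PX (some v) then (1 : ℤ) else 0) =
        1 - a (.inner v 0) * a (.inner v 1) * a (.inner v 2) := by
      intro v
      have h3 : PX (some v) ↔ ∃ k, w.left (.inner v k) ∉ A := by
        constructor
        · rintro ⟨h, hh, hv⟩
          cases h with
          | bdry i => cases hv
          | inner u k =>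
            cases hv
            exact ⟨k, hh⟩
        · rintro ⟨k, hk⟩
          exact ⟨_, hk, rfl⟩
      have h4 : (∃ k, w.left (.inner v k) ∉ A) ↔
          (w.left (.inner v 0) ∉ A ∨ w.left (.inner v 1) ∉ A ∨ w.left (.inner v 2) ∉ A) := by
        constructor
        · rintro ⟨k, hk⟩
          have : ∀ k : ZMod 3, k = 0 ∨ k = 1 ∨ k = 2 := by decide
          rcases this k with rfl | rfl | rfl <;> tauto
        · rintro (h | h | h) <;> exact ⟨_, h⟩
      simp only [h3, h4, a]
      by_cases p0 : w.left (.inner v 0) ∈ A <;> by_cases p1 : w.left (.inner v 1) ∈ A <;>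
        by_cases p2 : w.left (.inner v 2) ∈ A <;> simp [p0, p1, p2]
    have h3 : (Nat.card {x // PX x} : ℤ) = ∑ x, if PX x then (1 : ℤ) else 0 := by
      rw [Nat.card_eq_fintype_card, Fintype.card_subtype, Finset.card_filter]
      push_cast
      rfl
    rw [h3, Fintype.sum_option, if_pos h1]
    simp only [h2, Finset.sum_sub_distrib, Finset.sum_const, Finset.card_univ]
    rw [Nat.card_eq_fintype_card]
    simp
    ring
  have c2 : 2 * (Nat.card {h // w.IsOut h ∧ PE h} : ℤ) + ∑ h, a h * a (turn h) =
      2 * w.numEdges := by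
    have h1 : ∑ h : {h // w.IsOut h}, (a h * a (turn h.1) + a (w.mate h) * a (turn (w.mate h))) =
      ∑ h : {h // w.IsOut h}, 2 * (1 - if PE h then (1 : ℤ) else 0) := by
      refine Finset.sum_congr rfl fun h _ => ?_
      rw [hturn, hturn']
      have : w.left (w.mate h) = w.right h := rfl
      simp only [a, PE, this]
      by_cases p0 : w.left h ∈ A <;> by_cases p1 : w.right h ∈ A <;> simp [p0, p1]
    rw [w.sum_out_add (fun h => a h * a (turn h)), ← Finset.mul_sum] at h1
    rw [h1, w.numEdges_eq, Finset.sum_sub_distrib]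
    have h2 : (Nat.card {h // w.IsOut h ∧ PE h} : ℤ) =
        ∑ h : {h // w.IsOut h}, if PE h then (1 : ℤ) else 0 := by
      rw [Finset.sum_boole, Nat.card_eq_fintype_card, Fintype.card_subtype]
      congr 1
      rw [← Finset.card_map (Function.Embedding.subtype w.IsOut)]
      congr 1
      ext h
      simp
      tauto
    rw [h2, Nat.card_eq_fintype_card]
    simp
    ring
  have c3 : (Nat.card {f // PB f} : ℤ) + (Finset.univ.filter fun f => f ∈ A).card =
      Nat.card w.F := by
    rw [Nat.card_eq_fintype_card, Fintype.card_subtype, Nat.card_eq_fintype_card, add_comm]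
    norm_cast
    exact Finset.card_filter_add_card_filter_not _
  have c4 : 6 * ((Finset.univ.filter fun f => f ∈ A).card : ℤ) ≤ ∑ h, a h := by
    set s := Finset.univ.filter fun f => f ∈ A with hs
    have h1 : 6 * s.card ≤ (Finset.univ.filter fun h => w.left h ∈ s).card := by
      calc 6 * s.card = ∑ f ∈ s, 6 := by simp [mul_comm]
        _ ≤ ∑ f ∈ s, w.numBoundaryEdges f :=
            Finset.sum_le_sum fun f hf => hr f (hcl f (by simpa [hs] using hf))
        _ = ∑ f ∈ s, {h | w.left h = f}.ncard := by
            refine Finset.sum_congr rfl fun f _ => ?_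
            rw [numBoundaryEdges, Set.eq_empty_of_isEmpty {c | w.circleLeft c = f},
              Set.eq_empty_of_isEmpty {c | w.circleRight c = f}]
            simp
        _ = _ := w.sum_ncard_left s
    have h2 : ∑ h, a h = (Finset.univ.filter fun h => w.left h ∈ s).card := by
      simp only [a, Finset.sum_boole, hs, Finset.mem_filter, Finset.mem_univ, true_and]
    rw [h2]
    exact_mod_cast h1
  have c5 := hw.card_add_card
  -- The turning number of the boundary of `A` at the base of `h`, with `A` on the left: `1` at a
  -- convex vertex, `-1` at a concave one. `T'` is the same with `A` on the right.
  let T : HalfEdge n w.V → ℤ := fun h => a h * (1 - a (turn h)) * (1 - 2 * a (turn (turn h)))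
  let T' : HalfEdge n w.V → ℤ := fun h =>
    (1 - a h) * a (turn h) * (1 - 2 * a (turn (turn h)))
  have hz3 : ∀ g : ZMod 3 → ℤ, ∑ k, g k = g 0 + g 1 + g 2 := fun g => Fin.sum_univ_three g
  have hm0 : (0 - 1 : ZMod 3) = 2 := by decide
  have hm1 : (1 - 1 : ZMod 3) = 0 := by decide
  have hm2 : (2 - 1 : ZMod 3) = 1 := by decide
  -- A vertex with one, two or three sectors in `A` contributes `1`, `-1`, `0` to both sides. Since
  -- each face of `A` has at least six edges, the right side is at least six times the count bounded
  -- through `PB`, `PX`, `PE`.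
  have d1 : ∑ h, T h = ∑ h, a h - 3 * ∑ h, a h * a (turn h) +
      6 * ∑ v, a (.inner v 0) * a (.inner v 1) * a (.inner v 2) := by
    simp only [HalfEdge.sum_eq, T, turn_bdry, habd, hz3, turn_inner, hm0, hm1, hm2]
    simp only [Finset.mul_sum, zero_mul, Finset.sum_const_zero, zero_add, mul_zero]
    rw [← Finset.sum_sub_distrib, ← Finset.sum_add_distrib]
    refine Finset.sum_congr rfl fun v _ => ?_
    rcases ha01 (.inner v 0) with p0 | p0 <;> rcases ha01 (.inner v 1) with p1 | p1 <;>
      rcases ha01 (.inner v 2) with p2 | p2 <;> rw [p0, p1, p2] <;> norm_num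
  have d2 : ∑ h, T' h = ∑ h, T h := by
    simp only [HalfEdge.sum_eq, T, T', turn_bdry, habd, hz3, turn_inner, hm0, hm1, hm2]
    refine congrArg₂ (· + ·) (by simp) (Finset.sum_congr rfl fun v _ => ?_)
    rcases ha01 (.inner v 0) with p0 | p0 <;> rcases ha01 (.inner v 1) with p1 | p1 <;>
      rcases ha01 (.inner v 2) with p2 | p2 <;> rw [p0, p1, p2] <;> norm_num
  have d3 : ∑ h, T' h = ∑ h, T' (w.mate h) := (Equiv.sum_comp w.matePerm T').symm
  set C := {h | w.left h ∈ A ∧ w.right h ∉ A ∧ w.left (turn (turn h)) ∉ A ∧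
      w.left (turn (turn (w.mate h))) ∉ A} with hC
  -- A boundary edge collects `T` at one end and `T'` at the other: `2` if both ends are convex, at
  -- most `0` otherwise.
  have d4 : ∑ h, (T h + T' (w.mate h)) ≤ ∑ h, 2 * if h ∈ C then (1 : ℤ) else 0 := by
    refine Finset.sum_le_sum fun h _ => ?_
    have h1 : w.right h = w.left (turn h) := (w.left_turn h).symm
    simp only [T, T', ← hturn h, hturn', hC, Set.mem_ofPred_eq, h1]
    simp only [a]
    by_cases p0 : w.left h ∈ A <;> by_cases p1 : w.left (turn h) ∈ A <;>
      by_cases p2 : w.left (turn (turn h)) ∈ A <;>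
      by_cases p3 : w.left (turn (turn (w.mate h))) ∈ A <;>
      simp [p0, p1, p2, p3, -Diagram.left_turn]
  have d5 : ∑ h, (if h ∈ C then (1 : ℤ) else 0) = C.ncard := by
    rw [Finset.sum_boole, Set.ncard_eq_toFinset_card']
    congr 2
    ext h
    simp
  rw [← Finset.mul_sum, d5, Finset.sum_add_distrib, ← d3, d2] at d4
  omega

/-- A path of faces gives a function on the edges that it crosses, modulo two. -/
theorem exists_crossing {S : Set w.F} {f g : w.F} (hf : f ∈ S)
    (h : w.Linked S f g) : ∃ z : HalfEdge n w.V → ZMod 2, (∀ h, z (w.mate h) = z h) ∧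
      (∀ h, w.left h ∉ S → z h = 0) ∧
      ∀ q : w.F → ZMod 2, ∑ h, z h * q (w.left h) = q f + q g := by
  classical
  induction h with
  | refl => exact ⟨0, by simp, by simp, fun q => by simp [CharTwo.add_self_eq_zero]⟩
  | @tail b c hb hc ih =>
    obtain ⟨z, h1, h2, h3⟩ := ih
    obtain ⟨hc, x, rfl, rfl⟩ := hc
    have hx : w.left x ∈ S := Linked.mem hb hf
    refine ⟨z + Pi.single x 1 + Pi.single (w.mate x) 1, ?_, ?_, ?_⟩
    · intro h
      simp only [Pi.add_apply, h1, Pi.single_apply, w.mate_eq_iff, w.mate_mate']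
      ring
    · intro h hh
      have e1 : h ≠ x := by rintro rfl; exact hh hx
      have e2 : h ≠ w.mate x := by rintro rfl; exact hh hc
      simp [h2 h hh, e1, e2]
    · intro q
      simp only [Pi.add_apply, add_mul, Finset.sum_add_distrib, h3, Pi.single_apply, ite_mul,
        one_mul, zero_mul, Finset.sum_ite_eq', Finset.mem_univ, if_true, w.left_mate]
      have : q (w.left x) + q (w.left x) = 0 := CharTwo.add_self_eq_zero _
      linear_combination this

/-- Starting from `σ a`, the orbit meets `b` before it returns to `a`, so `Y` does not change on the
way. -/
theorem _root_.SL3Web.eq_of_walk_between {α β : Type*} [Finite α] (σ : Equiv.Perm α) (Y : α → β)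
    {a b : α} (hab : σ.SameCycle a b) (hne : a ≠ b)
    (hY : ∀ x, σ.SameCycle a x → x ≠ a → x ≠ b → Y (σ x) = Y x) : Y (σ a) = Y b := by
  classical
  obtain ⟨t, ht⟩ := hab.exists_nat_pow_eq
  have hex : ∃ t, (σ ^ t) (σ a) = b := by
    cases t with
    | zero => exact (hne ht).elim
    | succ t => exact ⟨t, by rw [← Equiv.Perm.mul_apply, ← pow_succ, ht]⟩
  have hmin : ∀ s < Nat.find hex, (σ ^ s) (σ a) ≠ b := fun s hs => Nat.find_min hex hs
  have hT := Nat.find_spec hex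
  set T := Nat.find hex
  have hna : ∀ s < T, (σ ^ s) (σ a) ≠ a := by
    intro s hs hsa
    refine hmin (T - (s + 1)) (by omega) ?_
    have : σ ^ T = σ ^ (T - (s + 1)) * σ * σ ^ s := by
      rw [← pow_succ, ← pow_add]
      congr 1
      omega
    rwa [this, Equiv.Perm.mul_apply, Equiv.Perm.mul_apply, hsa] at hT
  have key : ∀ s ≤ T, Y ((σ ^ s) (σ a)) = Y (σ a) := by
    intro s
    induction s with
    | zero => intro _; rfl
    | succ s ih =>
      intro hs
      rw [pow_succ', Equiv.Perm.mul_apply, hY _ _ (hna s (by omega)) (hmin s (by omega)),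
        ih (by omega)]
      simp [Equiv.Perm.SameCycle.refl]
  rw [← key T le_rfl, hT]

/-- Two edges between a face `e` and a connected set `S` of faces separate the half-plane. -/
theorem exists_separation (hw : w.IsConn) {S : Set w.F} (h0 : w.unbounded ∈ S)
    (hS : ∀ f ∈ S, w.Linked S w.unbounded f) {m₁ m₂ : HalfEdge n w.V}
    (he : w.left m₁ ∉ S) (h12 : w.left m₁ = w.left m₂) (h1 : w.right m₁ ∈ S) (h2 : w.right m₂ ∈ S)
    (hne : m₁ ≠ m₂) : ∃ y : Option w.V → ZMod 2,
      (∀ h, w.left h ∉ S → h ≠ m₁ → h ≠ m₂ →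
        y (w.collapsedVertex h) = y (w.collapsedVertex (w.mate h))) ∧
      y (w.collapsedVertex m₁) ≠ y (w.collapsedVertex m₂) ∧
      y (w.collapsedVertex (w.mate m₁)) = y (w.collapsedVertex m₂) ∧
      y (w.collapsedVertex (w.mate m₂)) = y (w.collapsedVertex m₁) := by
  classical
  obtain ⟨z₁, a1, a2, a3⟩ := exists_crossing h0 (hS _ h1)
  obtain ⟨z₂, b1, b2, b3⟩ := exists_crossing h0 (hS _ h2)
  -- A closed curve runs from the unbounded face through `S` to `m₁`, across the face `left m₁` to
  -- `m₂`, and back through `S`. Its crossings with edges are conserved modulo two at faces, and `y`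
  -- records the side of the curve.
  obtain ⟨y, hy⟩ := hw.exists_vertex_potential (k := ZMod 2)
    (z₁ + z₂ + Pi.single m₁ 1 + Pi.single (w.mate m₁) 1 + Pi.single m₂ 1 +
      Pi.single (w.mate m₂) 1) (by
      intro h
      simp only [Pi.add_apply, a1, b1, Pi.single_apply, w.mate_eq_iff, w.mate_mate']
      rw [CharTwo.neg_eq]
      ring) (by
      intro q
      simp only [Pi.add_apply, add_mul, Finset.sum_add_distrib, a3, b3, Pi.single_apply, ite_mul,
        one_mul, zero_mul, Finset.sum_ite_eq', Finset.mem_univ, if_true, w.left_mate, ← h12]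
      have e1 : q w.unbounded + q w.unbounded = 0 := CharTwo.add_self_eq_zero _
      have e2 : q (w.right m₁) + q (w.right m₁) = 0 := CharTwo.add_self_eq_zero _
      have e3 : q (w.right m₂) + q (w.right m₂) = 0 := CharTwo.add_self_eq_zero _
      have e4 : q (w.left m₁) + q (w.left m₁) = 0 := CharTwo.add_self_eq_zero _
      linear_combination e1 + e2 + e3 + e4)
  have hS' : ∀ h, w.left h ∉ S → h ≠ w.mate m₁ ∧ h ≠ w.mate m₂ := fun h hh =>
    ⟨by rintro rfl; exact hh h1, by rintro rfl; exact hh h2⟩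
  have k1 : ∀ h, w.left h ∉ S → h ≠ m₁ → h ≠ m₂ →
        y (w.collapsedVertex h) = y (w.collapsedVertex (w.mate h)) := by
    intro h hh n1 n2
    have := hy h
    simp only [Pi.add_apply, a2 h hh, b2 h hh, Pi.single_apply, n1, n2, (hS' h hh).1,
      (hS' h hh).2, if_false, add_zero] at this
    exact (sub_eq_zero.1 this.symm).symm
  have k2 : y (w.collapsedVertex m₁) ≠ y (w.collapsedVertex (w.mate m₁)) := by
    intro e
    have := hy m₁
    simp [Pi.add_apply, a2 _ he, b2 _ he, hne, (hS' _ he).1, (hS' _ he).2, e] at this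
  have hw1 := eq_of_walk_between w.walk (fun h => y (w.collapsedVertex h))
    (hw.sameCycle h12) hne (by
      intro x hx n1 n2
      rw [walk_apply, w.collapsedVertex_turn]
      exact (k1 x (by rwa [← left_eq_of_sameCycle hx]) n1 n2).symm)
  have hw2 := eq_of_walk_between w.walk (fun h => y (w.collapsedVertex h))
    (hw.sameCycle h12.symm) hne.symm (by
      intro x hx n1 n2
      rw [walk_apply, w.collapsedVertex_turn]
      exact (k1 x (by rwa [← left_eq_of_sameCycle hx, ← h12]) n2 n1).symm)
  simp only [walk_apply, w.collapsedVertex_turn] at hw1 hw2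
  exact ⟨y, k1, by rwa [← hw1], hw1, hw2⟩

/-- A connected set `A` of faces avoiding `S` and the face `e` has at most one corner where, walking
around `e`, one passes from `S` to `A`. -/
theorem start_corner_unique (hw : w.IsConn) {S A : Set w.F} (h0 : w.unbounded ∈ S)
    (hS : ∀ f ∈ S, w.Linked S w.unbounded f) {f : w.F} (hf : f ∈ A)
    (hA : ∀ g ∈ A, w.Linked A f g) (hAS : ∀ g ∈ A, g ∉ S) {g₁ g₂ : HalfEdge n w.V}
    (he : w.left g₁ ∉ S) (heA : w.left g₁ ∉ A) (h12 : w.left g₁ = w.left g₂)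
    (r1 : w.right g₁ ∈ A) (r2 : w.right g₂ ∈ A)
    (s1 : w.left (turn.symm g₁) ∈ S) (s2 : w.left (turn.symm g₂) ∈ S) : g₁ = g₂ := by
  by_contra hne
  have hl : ∀ g, w.left (w.mate (turn.symm g)) = w.left g := fun g => by
    rw [w.left_mate, ← w.left_turn, Equiv.apply_symm_apply]
  -- `mate (turn.symm g)` is the edge just before `g` around the face, and it leads to `S`. The
  -- curve through these two edges leaves the two corners on opposite sides, whereas the connected
  -- set `A` lies on one side.
  obtain ⟨y, y1, y2, y3, y4⟩ := hw.exists_separation h0 hS (m₁ := w.mate (turn.symm g₁))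
    (m₂ := w.mate (turn.symm g₂)) (by rwa [hl]) (by rw [hl, hl, h12]) (by rwa [w.right_mate])
    (by rwa [w.right_mate]) (fun e => hne (turn.symm.injective (w.mate_injective e)))
  have hy : ∀ h, w.left h ∈ A → y (w.collapsedVertex h) = y (w.collapsedVertex (w.mate h)) := by
    intro h hh
    refine y1 h (hAS _ hh) ?_ ?_
    · rintro rfl
      rw [hl] at hh
      exact heA hh
    · rintro rfl
      rw [hl, ← h12] at hh
      exact heA hh
  have hcv : ∀ g, w.collapsedVertex (turn.symm g) = w.collapsedVertex g := fun g => by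
    rw [← w.collapsedVertex_turn, Equiv.apply_symm_apply]
  have hAc : ∀ a, w.left a ∈ A → ∀ b, w.left b ∈ A →
      y (w.collapsedVertex a) = y (w.collapsedVertex b) := fun a ha b hb => by
    obtain ⟨c, hc⟩ := hw.exists_left_eq g₁ f
    rw [← hw.eq_of_linked hy hf (hA _ ha) hc rfl, ← hw.eq_of_linked hy hf (hA _ hb) hc rfl]
  have e1 := hy (w.mate g₁) r1
  have e2 := hy (w.mate g₂) r2
  rw [w.mate_mate'] at e1 e2
  rw [w.mate_mate', hcv] at y3 y4
  have := hAc _ r1 _ r2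
  rw [e1, e2] at this
  exact y2 (by rw [← y3, ← y4, this])

/-- A connected set `A` of faces avoiding `S` and the face `e` has at most one corner where, walking
around `e`, one passes from `A` to `S`. -/
theorem end_corner_unique (hw : w.IsConn) {S A : Set w.F} (h0 : w.unbounded ∈ S)
    (hS : ∀ f ∈ S, w.Linked S w.unbounded f) {f : w.F} (hf : f ∈ A)
    (hA : ∀ g ∈ A, w.Linked A f g) (hAS : ∀ g ∈ A, g ∉ S) {g₁ g₂ : HalfEdge n w.V}
    (he : w.left g₁ ∉ S) (heA : w.left g₁ ∉ A) (h12 : w.left g₁ = w.left g₂)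
    (r1 : w.right g₁ ∈ A) (r2 : w.right g₂ ∈ A)
    (s1 : w.right (w.walk g₁) ∈ S) (s2 : w.right (w.walk g₂) ∈ S) : g₁ = g₂ := by
  by_contra hne
  obtain ⟨y, y1, y2, y3, y4⟩ := hw.exists_separation h0 hS (m₁ := w.walk g₁)
    (m₂ := w.walk g₂) (by rwa [left_walk]) (by rw [left_walk, left_walk, h12]) s1 s2
    (fun e => hne (w.walk.injective e))
  have hy : ∀ h, w.left h ∈ A → y (w.collapsedVertex h) = y (w.collapsedVertex (w.mate h)) := by
    intro h hh
    refine y1 h (hAS _ hh) ?_ ?_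
    · rintro rfl
      rw [left_walk] at hh
      exact heA hh
    · rintro rfl
      rw [left_walk, ← h12] at hh
      exact heA hh
  obtain ⟨c, hc⟩ := hw.exists_left_eq g₁ f
  refine y2 ?_
  rw [walk_apply, walk_apply, w.collapsedVertex_turn, w.collapsedVertex_turn,
    ← hw.eq_of_linked hy hf (hA _ r1) hc rfl, ← hw.eq_of_linked hy hf (hA _ r2) hc rfl]

end IsConn

end BottomWeb

end SL3Web

/-! ### Depth, balls, and components reaching the axis -/

namespace SL3Web

open HalfEdge

namespace BottomWeb

variable {n : ℕ} {w : BottomWeb n}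

section Depth

@[simp] theorem depth_unbounded : w.depth w.unbounded = 0 := SimpleGraph.dist_self

theorem depth_eq_zero {f : w.F} (h : w.depth f = 0) : f = w.unbounded := by
  rcases SimpleGraph.dist_eq_zero_iff_eq_or_not_reachable.1 h with h | h
  · exact h
  · exact (h (w.dual_connected.preconnected _ _)).elim

theorem depth_right_le (h : HalfEdge n w.V) : w.depth (w.right h) ≤ w.depth (w.left h) + 1 := by
  by_cases e : w.left h = w.right h
  · rw [e]; omega
  · have h1 : w.dual.Adj (w.right h) (w.left h) := by
      rw [Diagram.dual, SimpleGraph.fromRel_adj]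
      exact ⟨fun h => e h.symm, Or.inr (Or.inl ⟨h, rfl, rfl⟩)⟩
    have h2 := w.dual_connected.dist_triangle (u := w.right h) (v := w.left h) (w := w.unbounded)
    rw [SimpleGraph.dist_eq_one_iff_adj.2 h1] at h2
    simp only [depth]
    omega

theorem depth_left_le (h : HalfEdge n w.V) : w.depth (w.left h) ≤ w.depth (w.right h) + 1 := by
  simpa [w.left_mate] using depth_right_le (w.mate h)

theorem IsConn.exists_lower (hw : w.IsConn) {f : w.F} {k : ℕ} (hf : w.depth f = k + 1) :
    ∃ h, w.left h = f ∧ w.depth (w.right h) = k := by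
  obtain ⟨p, hp⟩ := (w.dual_connected.preconnected f w.unbounded).exists_walk_length_eq_dist
  cases p with
  | nil =>
    change 0 = w.depth w.unbounded at hp
    rw [depth_unbounded] at hf
    omega
  | cons hadj q =>
    obtain ⟨_, h, rfl, rfl⟩ := hw.dual_adj hadj
    refine ⟨h, rfl, ?_⟩
    have h1 : w.depth (w.right h) ≤ q.length := SimpleGraph.dist_le q
    have h2 := depth_left_le h
    rw [SimpleGraph.Walk.length_cons] at hp
    change q.length + 1 = w.depth (w.left h) at hp
    omega

/-- The faces of depth less than `k`. -/
def ball (w : BottomWeb n) (k : ℕ) : Set w.F := {f | w.depth f < k}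

theorem mem_ball {f : w.F} {k : ℕ} : f ∈ w.ball k ↔ w.depth f < k := Iff.rfl

theorem IsConn.linked_ball (hw : w.IsConn) {k : ℕ} {f : w.F} (hf : f ∈ w.ball k) :
    w.Linked (w.ball k) w.unbounded f := by
  have key : ∀ d f, w.depth f = d → d < k → w.Linked (w.ball k) w.unbounded f := by
    intro d
    induction d with
    | zero =>
      intro f hf _
      rw [depth_eq_zero hf]
      exact Relation.ReflTransGen.refl
    | succ d ih =>
      intro f hf hd
      obtain ⟨h, rfl, h2⟩ := hw.exists_lower hf
      have h3 := ih _ h2 (by omega)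
      rw [← w.left_mate] at h3
      rw [← w.right_mate]
      refine h3.step ?_
      rw [w.right_mate, mem_ball]
      omega
  exact key _ f rfl hf

theorem linked_insert {S : Set w.F} (hS : ∀ f ∈ S, w.Linked S w.unbounded f) {h : HalfEdge n w.V}
    (hh : w.right h ∈ S) : ∀ f ∈ insert (w.left h) S, w.Linked (insert (w.left h) S) w.unbounded f := by
  rintro f (rfl | hf)
  · have h1 := (hS _ hh).mono (Set.subset_insert (w.left h) S)
    rw [← w.left_mate] at h1
    have h2 := h1.step (by rw [w.right_mate]; exact Set.mem_insert _ _)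
    rwa [w.right_mate] at h2
  · exact (hS _ hf).mono (Set.subset_insert _ _)

end Depth

theorem left_turn_turn_mem_iff {h : HalfEdge n w.V} (hh : h.IsInner) :
    w.right (turn (turn h)) = w.left h := by
  rw [← w.left_turn, turn_turn_turn hh]

theorem IsConn.third_ne_left (hw : w.IsConn) {h : HalfEdge n w.V} (hh : h.IsInner) :
    w.left (turn (turn h)) ≠ w.left h := by
  have := hw.left_ne_right (turn (turn h))
  rwa [left_turn_turn_mem_iff hh] at this

theorem IsConn.third_ne_right (hw : w.IsConn) (h : HalfEdge n w.V) :
    w.left (turn (turn h)) ≠ w.right h := by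
  have := hw.left_ne_right (turn h)
  rw [w.left_turn (turn h)]
  rw [w.left_turn] at this
  exact this.symm

theorem depth_third_le {h : HalfEdge n w.V} (hh : h.IsInner) :
    w.depth (w.left (turn (turn h))) ≤ w.depth (w.left h) + 1 := by
  have := depth_left_le (turn (turn h))
  rwa [left_turn_turn_mem_iff hh] at this

theorem depth_le_third {h : HalfEdge n w.V} (hh : h.IsInner) :
    w.depth (w.left h) ≤ w.depth (w.left (turn (turn h))) + 1 := by
  have := depth_right_le (turn (turn h))
  rwa [left_turn_turn_mem_iff hh] at this

theorem exists_bdry_left (h : HalfEdge n w.V) (hw : w.IsConn) (j : Fin (n + 1)) :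
    ∃ i, w.left (.bdry i) = w.gap j := by
  obtain ⟨i⟩ := hw.nonempty_fin h
  rcases w.gap_eq_left (f := w.gap j) rfl with e | e
  · obtain ⟨j, hj⟩ := w.unbounded_eq_left_bdry i
    exact ⟨j, by rw [e, hj]⟩
  · exact e

theorem ncard_le_of_classes {α : Type*} {s : Set α} {m : ℕ} (P : Fin m → α → Prop)
    (h1 : ∀ a ∈ s, ∃ i, P i a) (h2 : ∀ i, ∀ a ∈ s, ∀ b ∈ s, P i a → P i b → a = b) :
    s.ncard ≤ m := by
  choose c hc using fun a : s => h1 a.1 a.2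
  rw [← Nat.card_coe_set_eq, ← Nat.card_fin m]
  refine Nat.card_le_card_of_injective c fun a b hab => Subtype.ext ?_
  exact h2 _ _ a.2 _ b.2 (hc a) (hab ▸ hc b)

namespace IsConn

/-- A component of the complement of `S` that does not touch the `x`-axis has at least six convex
edges. -/
theorem six_le_of_closed_comp (hw : w.IsConn) (hr : w.Reduced) {S : Set w.F}
    (hS : ∀ f ∈ S, w.Linked S w.unbounded f) {f : w.F} (hf : f ∉ S)
    (hcl : ∀ j, w.gap j ∉ w.comp Sᶜ f) :
    6 ≤ {h : HalfEdge n w.V | h.IsInner ∧ (w.mate h).IsInner ∧ w.left h ∈ w.comp Sᶜ f ∧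
      w.right h ∈ S ∧ w.left (turn (turn h)) ∈ S ∧ w.left (turn (turn (w.mate h))) ∈ S}.ncard := by
  refine (hw.six_le_ncard_convex hr (A := w.comp Sᶜ f) ⟨f, self_mem_comp⟩
    (fun g hg j hj => hcl j (hj ▸ hg)) (fun g hg => hw.linked_compl_comp hS hf hg)).trans
    (Set.ncard_le_ncard ?_ (Set.toFinite _))
  rintro h ⟨h1, h2, h3, h4⟩
  have i1 : h.IsInner := by
    cases h with
    | inner v k => simp
    | bdry i => exact (hcl _ (w.left_bdry i ▸ h1)).elim
  have i2 : (w.mate h).IsInner := by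
    cases e : w.mate h with
    | inner v k => simp
    | bdry i =>
      rw [w.mate_eq_iff] at e
      rw [e, w.right_bdry] at h1
      exact (hcl _ h1).elim
  have key : ∀ g, w.right g ∈ w.comp Sᶜ f → w.left g ∉ w.comp Sᶜ f → w.left g ∈ S := by
    intro g h1 h2
    have := right_notMem_of_comp (h := w.mate g) h1 (by rwa [w.right_mate])
    rw [w.right_mate] at this
    simpa using this
  refine ⟨i1, i2, h1, ?_, ?_, ?_⟩
  · exact key (w.mate h) (by rwa [w.right_mate]) h2
  · exact key _ (by rwa [left_turn_turn_mem_iff i1]) h3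
  · have := key (w.mate (turn (w.mate h)))
    rw [w.right_mate, w.left_mate, w.left_turn, w.right_mate, ← w.left_turn] at this
    exact this h1 h4

/-- A function that is constant along the edges of a component touching the `x`-axis takes at its
vertices the value that it has at the `x`-axis. -/
theorem eq_none_of_touches (hw : w.IsConn) {α : Type*} {y : Option w.V → α} {U : Set w.F}
    {f : w.F}
    (hy : ∀ h, w.left h ∈ w.comp U f → y (w.collapsedVertex h) = y (w.collapsedVertex (w.mate h)))
    {j : Fin (n + 1)} (hj : w.gap j ∈ w.comp U f) {b : HalfEdge n w.V} (hb : w.left b = f) :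
    y (w.collapsedVertex b) = y none := by
  obtain ⟨i, hi⟩ := exists_bdry_left b hw j
  exact hw.eq_of_linked hy self_mem_comp (linked_comp hj) hb hi

end IsConn

/-- Along the edges between faces of depth `k` and faces of depth `k - 1`, no two consecutive
vertices are convex. -/
def Convex (w : BottomWeb n) (k : ℕ) : Prop :=
  ∀ h : HalfEdge n w.V, h.IsInner → (w.mate h).IsInner → w.depth (w.left h) = k →
    w.depth (w.right h) + 1 = k → w.depth (w.left (turn (turn h))) + 1 = k →
    w.depth (w.left (turn (turn (w.mate h)))) + 1 = k → False

/-- Adjacent faces differ in depth by at most one, so membership in the ball or its complement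
forces the exact depths `k - 1` and `k`. -/
theorem Convex.not_ball {k : ℕ} (hc : w.Convex k) {h : HalfEdge n w.V} (h1 : h.IsInner)
    (h2 : (w.mate h).IsInner) (h3 : w.left h ∉ w.ball k) (h4 : w.right h ∈ w.ball k)
    (h5 : w.left (turn (turn h)) ∈ w.ball k) (h6 : w.left (turn (turn (w.mate h))) ∈ w.ball k) :
    False := by
  rw [mem_ball] at *
  have e1 := depth_left_le h
  have e2 := depth_le_third h1
  have e3 : w.depth (w.left h) ≤ w.depth (w.left (turn (turn (w.mate h)))) + 1 := by
    have := depth_left_le (turn (w.mate h))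
    rwa [w.left_turn, w.right_mate, ← w.left_turn] at this
  exact hc h h1 h2 (by omega) (by omega) (by omega) (by omega)

/-- The data of a connected set `A` of faces avoiding the connected set `S` and the face `e`. -/
structure Corners (w : BottomWeb n) (S A : Set w.F) (e f : w.F) : Prop where
  unb : w.unbounded ∈ S
  linked : ∀ g ∈ S, w.Linked S w.unbounded g
  mem : f ∈ A
  conn : ∀ g ∈ A, w.Linked A f g
  disj : ∀ g ∈ A, g ∉ S
  notMem : e ∉ S
  notMem' : e ∉ A

namespace Corners

variable {S A : Set w.F} {e f : w.F}

theorem start_unique (hw : w.IsConn) (c : w.Corners S A e f) {g₁ g₂ : HalfEdge n w.V}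
    (l1 : w.left g₁ = e) (l2 : w.left g₂ = e) (r1 : w.right g₁ ∈ A) (r2 : w.right g₂ ∈ A)
    (s1 : w.left (turn.symm g₁) ∈ S) (s2 : w.left (turn.symm g₂) ∈ S) : g₁ = g₂ :=
  hw.start_corner_unique c.unb c.linked c.mem c.conn c.disj (l1 ▸ c.notMem) (l1 ▸ c.notMem')
    (l1.trans l2.symm) r1 r2 s1 s2

theorem end_unique (hw : w.IsConn) (c : w.Corners S A e f) {g₁ g₂ : HalfEdge n w.V}
    (l1 : w.left g₁ = e) (l2 : w.left g₂ = e) (r1 : w.right g₁ ∈ A) (r2 : w.right g₂ ∈ A)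
    (s1 : w.right (w.walk g₁) ∈ S) (s2 : w.right (w.walk g₂) ∈ S) : g₁ = g₂ :=
  hw.end_corner_unique c.unb c.linked c.mem c.conn c.disj (l1 ▸ c.notMem) (l1 ▸ c.notMem')
    (l1.trans l2.symm) r1 r2 s1 s2

theorem right_unique (hw : w.IsConn) (c : w.Corners S A e f) {h₁ h₂ : HalfEdge n w.V}
    (l1 : w.left h₁ ∈ A) (l2 : w.left h₂ ∈ A) (r1 : w.right h₁ = e) (r2 : w.right h₂ = e)
    (s1 : w.left (turn (turn h₁)) ∈ S) (s2 : w.left (turn (turn h₂)) ∈ S) : h₁ = h₂ := by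
  refine w.mate_injective (c.end_unique hw r1 r2 (by rwa [w.right_mate]) (by rwa [w.right_mate])
    ?_ ?_) <;>
  rwa [walk_apply, w.mate_mate', ← w.left_turn]

theorem source_unique (hw : w.IsConn) (c : w.Corners S A e f) {h₁ h₂ : HalfEdge n w.V}
    (i1 : h₁.IsInner) (i2 : h₂.IsInner)
    (l1 : w.left h₁ ∈ A) (l2 : w.left h₂ ∈ A) (r1 : w.right h₁ ∈ S) (r2 : w.right h₂ ∈ S)
    (s1 : w.left (turn (turn h₁)) = e) (s2 : w.left (turn (turn h₂)) = e) : h₁ = h₂ := by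
  refine turn.injective (turn.injective (c.start_unique hw s1 s2
    (by rwa [left_turn_turn_mem_iff i1]) (by rwa [left_turn_turn_mem_iff i2]) ?_ ?_)) <;>
  rwa [Equiv.symm_apply_apply, w.left_turn]

theorem target_unique (hw : w.IsConn) (c : w.Corners S A e f) {h₁ h₂ : HalfEdge n w.V}
    (i1 : (w.mate h₁).IsInner) (i2 : (w.mate h₂).IsInner)
    (l1 : w.left h₁ ∈ A) (l2 : w.left h₂ ∈ A) (r1 : w.right h₁ ∈ S) (r2 : w.right h₂ ∈ S)
    (s1 : w.left (turn (turn (w.mate h₁))) = e) (s2 : w.left (turn (turn (w.mate h₂))) = e) :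
    h₁ = h₂ := by
  refine w.mate_injective (turn.injective (w.mate_injective (c.end_unique hw (e := e)
    ?_ ?_ ?_ ?_ ?_ ?_)))
  · rw [w.left_mate, ← w.left_turn, s1]
  · rw [w.left_mate, ← w.left_turn, s2]
  · rwa [w.right_mate, w.left_turn, w.right_mate]
  · rwa [w.right_mate, w.left_turn, w.right_mate]
  · rwa [walk_apply, w.mate_mate', left_turn_turn_mem_iff i1, w.left_mate]
  · rwa [walk_apply, w.mate_mate', left_turn_turn_mem_iff i2, w.left_mate]

end Corners

namespace IsConn

/-- Otherwise Gauss-Bonnet would give the component six convex edges, and convexity of the ball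
allows none. -/
theorem ball_touches (hw : w.IsConn) (hr : w.Reduced) {k : ℕ} (hc : w.Convex k) {f : w.F}
    (hf : f ∉ w.ball k) : ∃ j, w.gap j ∈ w.comp (w.ball k)ᶜ f := by
  by_contra hcl
  push Not at hcl
  have h6 := hw.six_le_of_closed_comp hr (fun g hg => hw.linked_ball hg) hf hcl
  rw [Set.eq_empty_of_forall_notMem (s := {h | _})] at h6
  · simp at h6
  rintro h ⟨h1, h2, h3, h4, h5, h6⟩
  exact hc.not_ball h1 h2 (comp_subset hf h3) h4 h5 h6

/-- Once `e` joins the ball, a convex edge must involve `e`: on its right, or in the third sector at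
its start or at its end. Uniqueness of corners allows at most one of each kind, and three is less
than six. -/
theorem insert_touches (hw : w.IsConn) (hr : w.Reduced) {k : ℕ} (hc : w.Convex k)
    {e : w.F} (he : w.depth e = k) (hk : 0 < k) {f : w.F}
    (hf : f ∉ insert e (w.ball k)) : ∃ j, w.gap j ∈ w.comp (insert e (w.ball k))ᶜ f := by
  by_contra hcl
  push Not at hcl
  obtain ⟨d, rfl⟩ : ∃ d, k = d + 1 := ⟨k - 1, by omega⟩
  obtain ⟨m, rfl, hm⟩ := hw.exists_lower he
  have heb : w.left m ∉ w.ball (d + 1) := by rw [mem_ball]; omega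
  have h6 := hw.six_le_of_closed_comp hr (linked_insert (fun g hg => hw.linked_ball hg)
    (h := m) (by rw [mem_ball]; omega)) hf hcl
  have c : w.Corners (w.ball (d + 1)) (w.comp (insert (w.left m) (w.ball (d + 1)))ᶜ f)
      (w.left m) f :=
    { unb := by rw [mem_ball, depth_unbounded]; omega
      linked := fun g hg => hw.linked_ball hg
      mem := self_mem_comp
      conn := fun g hg => linked_comp hg
      disj := fun g hg h => comp_subset hf hg (Or.inr h)
      notMem := heb
      notMem' := fun h => comp_subset hf h (Or.inl rfl) }
  have h3 := ncard_le_of_classes (m := 3) (s := {h : HalfEdge n w.V | h.IsInner ∧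
      (w.mate h).IsInner ∧ w.left h ∈ w.comp (insert (w.left m) (w.ball (d + 1)))ᶜ f ∧
      w.right h ∈ insert (w.left m) (w.ball (d + 1)) ∧
      w.left (turn (turn h)) ∈ insert (w.left m) (w.ball (d + 1)) ∧
      w.left (turn (turn (w.mate h))) ∈ insert (w.left m) (w.ball (d + 1))})
    ![fun h => w.right h = w.left m,
      fun h => w.right h ∈ w.ball (d + 1) ∧ w.left (turn (turn h)) = w.left m,
      fun h => w.right h ∈ w.ball (d + 1) ∧ w.left (turn (turn (w.mate h))) = w.left m] ?_ ?_
  · exact absurd (h6.trans h3) (by omega)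
  · rintro h ⟨h1, h2, h3, h4, h5, h6⟩
    rcases h4 with h4 | h4
    · exact ⟨0, h4⟩
    rcases h5 with h5 | h5
    · exact ⟨1, h4, h5⟩
    rcases h6 with h6 | h6
    · exact ⟨2, h4, h6⟩
    exact (hc.not_ball h1 h2 (fun h => comp_subset hf h3 (Or.inr h)) h4 h5 h6).elim
  · intro i
    rintro a ⟨a1, a2, a3, -, a5, a6⟩ b ⟨b1, b2, b3, -, b5, b6⟩
    fin_cases i
    · intro ha hb
      change w.right a = _ at ha
      change w.right b = _ at hb
      refine c.right_unique hw a3 b3 ha hb (a5.resolve_left ?_) (b5.resolve_left ?_)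
      · rw [← ha]; exact hw.third_ne_right a
      · rw [← hb]; exact hw.third_ne_right b
    · rintro ⟨ha, ha'⟩ ⟨hb, hb'⟩
      exact c.source_unique hw a1 b1 a3 b3 ha hb ha' hb'
    · rintro ⟨ha, ha'⟩ ⟨hb, hb'⟩
      exact c.target_unique hw a2 b2 a3 b3 ha hb ha' hb'

/-- If three faces outside a convex ball of depth `k` meet at a vertex and two of them have depth
`k`, then the third can be linked to the `x`-axis avoiding the ball and the other two. -/
theorem insert_insert_touches (hw : w.IsConn) (hr : w.Reduced) {k : ℕ} (hc : w.Convex k)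
    {s : HalfEdge n w.V} (hs : s.IsInner) (hl : w.depth (w.left s) = k)
    (hrt : w.depth (w.right s) = k) (hk : 0 < k) (ht : w.left (turn (turn s)) ∉ w.ball k) :
    ∃ j, w.gap j ∈ w.comp (insert (w.left s) (insert (w.right s) (w.ball k)))ᶜ
      (w.left (turn (turn s))) := by
  by_contra hcl
  push Not at hcl
  set f := w.left (turn (turn s)) with hfdef
  obtain ⟨d, rfl⟩ : ∃ d, k = d + 1 := ⟨k - 1, by omega⟩
  obtain ⟨m, hme, hm⟩ := hw.exists_lower hl
  obtain ⟨m', hme', hm'⟩ := hw.exists_lower hrt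
  set B := w.ball (d + 1) with hB
  have hls : w.left s ∉ B := by rw [hB, mem_ball]; omega
  have hrs : w.right s ∉ B := by rw [hB, mem_ball]; omega
  have l0 : ∀ f ∈ B, w.Linked B w.unbounded f := fun g hg => hw.linked_ball hg
  have l1 : ∀ f ∈ insert (w.left s) B, w.Linked (insert (w.left s) B) w.unbounded f := by
    rw [← hme]
    exact linked_insert l0 (by rw [hB, mem_ball]; omega)
  have l2 : ∀ f ∈ insert (w.right s) B, w.Linked (insert (w.right s) B) w.unbounded f := by
    rw [← hme']
    exact linked_insert l0 (by rw [hB, mem_ball]; omega)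
  have hne := hw.left_ne_right s
  set S := insert (w.left s) (insert (w.right s) B) with hSdef
  have hS : ∀ f ∈ S, w.Linked S w.unbounded f := linked_insert l2 (Set.mem_insert _ _)
  have hf : f ∉ S := by
    rintro (h | h | h)
    · exact hw.third_ne_left hs h
    · exact hw.third_ne_right s h
    · exact ht h
  have h6 := hw.six_le_of_closed_comp hr hS hf hcl
  have hunb : w.unbounded ∈ B := by rw [hB, mem_ball, depth_unbounded]; omega
  have c : w.Corners (insert (w.right s) B) (w.comp Sᶜ f) (w.left s) f :=
    { unb := Or.inr hunb
      linked := l2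
      mem := self_mem_comp
      conn := fun g hg => linked_comp hg
      disj := fun g hg h => comp_subset hf hg (Or.inr h)
      notMem := by
        rintro (h | h)
        · exact hne h
        · exact hls h
      notMem' := fun h => comp_subset hf h (Or.inl rfl) }
  have c' : w.Corners (insert (w.left s) B) (w.comp Sᶜ f) (w.right s) f :=
    { unb := Or.inr hunb
      linked := l1
      mem := self_mem_comp
      conn := fun g hg => linked_comp hg
      disj := by
        rintro g hg (h | h)
        · exact comp_subset hf hg (Or.inl h)
        · exact comp_subset hf hg (Or.inr (Or.inr h))
      notMem := by
        rintro (h | h)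
        · exact hne h.symm
        · exact hrs h
      notMem' := fun h => comp_subset hf h (Or.inr (Or.inl rfl)) }
  -- Each of the two faces can lie to the right of one convex edge, or fill the third sector at its
  -- start or end. Two of these six kinds are void: the vertex of `s` already provides the unique
  -- start corner of `right s` and the unique end corner of `left s`.
  have h4 := ncard_le_of_classes (m := 4) (s := {h : HalfEdge n w.V | h.IsInner ∧
      (w.mate h).IsInner ∧ w.left h ∈ w.comp Sᶜ f ∧ w.right h ∈ S ∧ w.left (turn (turn h)) ∈ S ∧
      w.left (turn (turn (w.mate h))) ∈ S})
    ![fun h => w.right h = w.left s, fun h => w.right h = w.right s,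
      fun h => w.right h ∈ B ∧ w.left (turn (turn h)) = w.left s,
      fun h => w.right h ∈ B ∧ w.left (turn (turn (w.mate h))) = w.right s] ?_ ?_
  · exact absurd (h6.trans h4) (by omega)
  · rintro h ⟨h1, h2, h3, h4, h5, h6⟩
    rcases h4 with h4 | h4 | h4
    · exact ⟨0, h4⟩
    · exact ⟨1, h4⟩
    rcases h5 with h5 | h5 | h5
    · exact ⟨2, h4, h5⟩
    · exfalso
      have := c'.start_unique hw (g₁ := turn (turn h)) (g₂ := turn s) h5 (w.left_turn s)
        (by rwa [left_turn_turn_mem_iff h1]) (by rw [← w.left_turn]; exact self_mem_comp)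
        (by rw [Equiv.symm_apply_apply, w.left_turn]; exact Or.inr h4)
        (by rw [Equiv.symm_apply_apply]; exact Or.inl rfl)
      rw [← turn.injective this, w.left_turn] at hls
      exact hls h4
    rcases h6 with h6 | h6 | h6
    · exfalso
      have := c.end_unique hw (g₁ := w.mate (turn (w.mate h))) (g₂ := w.mate (turn (turn s)))
        (by rw [w.left_mate, ← w.left_turn, h6])
        (by rw [w.left_mate, left_turn_turn_mem_iff hs])
        (by rwa [w.right_mate, w.left_turn, w.right_mate])
        (by rw [w.right_mate]; exact self_mem_comp)
        (by
          rw [walk_apply, w.mate_mate', left_turn_turn_mem_iff h2, w.left_mate]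
          exact Or.inr h4)
        (by
          rw [walk_apply, w.mate_mate', turn_turn_turn hs]
          exact Or.inl rfl)
      have := turn.injective (w.mate_injective this)
      rw [← w.left_turn, ← this] at hrs
      exact hrs h4
    · exact ⟨3, h4, h6⟩
    exact (hc.not_ball h1 h2 (fun h => comp_subset hf h3 (Or.inr (Or.inr h))) h4 h5 h6).elim
  · intro i
    rintro a ⟨a1, a2, a3, -, a5, a6⟩ b ⟨b1, b2, b3, -, b5, b6⟩
    fin_cases i
    · intro ha hb
      change w.right a = _ at ha
      change w.right b = _ at hb
      refine c.right_unique hw a3 b3 ha hb (a5.resolve_left ?_) (b5.resolve_left ?_)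
      · rw [← ha]; exact hw.third_ne_right a
      · rw [← hb]; exact hw.third_ne_right b
    · intro ha hb
      change w.right a = _ at ha
      change w.right b = _ at hb
      rw [hSdef, Set.insert_comm] at a5 b5
      refine c'.right_unique hw a3 b3 ha hb (a5.resolve_left ?_) (b5.resolve_left ?_)
      · rw [← ha]; exact hw.third_ne_right a
      · rw [← hb]; exact hw.third_ne_right b
    · rintro ⟨ha, ha'⟩ ⟨hb, hb'⟩
      exact c.source_unique hw a1 b1 a3 b3 (Or.inr ha) (Or.inr hb) ha' hb'
    · rintro ⟨ha, ha'⟩ ⟨hb, hb'⟩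
      exact c'.target_unique hw a2 b2 a3 b3 (Or.inr ha) (Or.inr hb) ha' hb'

end IsConn

end BottomWeb

end SL3Web

/-! ### Convexity at every depth -/

namespace SL3Web

open HalfEdge

namespace BottomWeb

variable {n : ℕ} {w : BottomWeb n}

theorem isInner_of_collapsedVertex {h : HalfEdge n w.V} (hh : w.collapsedVertex h ≠ none) :
    h.IsInner := by
  cases h with
  | bdry i => exact (hh rfl).elim
  | inner v k => simp

theorem right_walk_eq (h : HalfEdge n w.V) :
    w.right (w.walk h) = w.left (turn (turn (w.mate h))) := by
  rw [walk_apply, ← w.left_turn]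

theorem left_mate_turn_turn {h : HalfEdge n w.V} (hh : h.IsInner) :
    w.left (w.mate (turn (turn h))) = w.left h := by
  rw [w.left_mate, left_turn_turn_mem_iff hh]

theorem right_mate_turn_turn (h : HalfEdge n w.V) :
    w.right (w.mate (turn (turn h))) = w.left (turn (turn h)) := w.right_mate _

theorem walk_mate_turn_turn {h : HalfEdge n w.V} (hh : h.IsInner) :
    w.walk (w.mate (turn (turn h))) = h := by
  rw [walk_apply, w.mate_mate', turn_turn_turn hh]

namespace IsConn

/-- On the side of the curve away from the axis, a face next to `left m₁` and outside the ball would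
reach the axis without crossing the curve (`insert_touches`). So the edges of `left m₁` on that side
lead into the ball, and if the edge after `m₁` were not `m₂`, it would be convex. -/
theorem walk_eq_of_separation (hw : w.IsConn) (hr : w.Reduced) {k : ℕ} (hc : w.Convex k)
    {m₁ m₂ : HalfEdge n w.V} (h12 : w.left m₁ = w.left m₂) (hd : w.depth (w.left m₁) = k)
    (h1 : w.depth (w.right m₁) + 1 = k) (h2 : w.depth (w.right m₂) + 1 = k)
    {y : Option w.V → ZMod 2} (y1 : ∀ h, w.left h ∉ w.ball k → h ≠ m₁ → h ≠ m₂ →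
        y (w.collapsedVertex h) = y (w.collapsedVertex (w.mate h)))
    (y2 : y (w.collapsedVertex m₁) ≠ y (w.collapsedVertex m₂))
    (y3 : y (w.collapsedVertex (w.mate m₁)) = y (w.collapsedVertex m₂))
    (y4 : y none ≠ y (w.collapsedVertex m₂)) : w.walk m₁ = m₂ ∧ m₂.IsInner := by
  have hR : ∀ g, w.left g = w.left m₁ → w.right g ∉ w.ball k →
      y (w.collapsedVertex g) = y none := by
    intro g hg hgr
    have hgr' : w.right g ∉ insert (w.left m₁) (w.ball k) := by
      rintro (h | h)
      · exact hw.left_ne_right g (hg.trans h.symm)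
      · exact hgr h
    obtain ⟨j, hj⟩ := hw.insert_touches hr hc hd (by omega) hgr'
    have := hw.eq_none_of_touches (y := y) ?_ hj (b := w.mate g) rfl
    · rw [← this]
      have h3 := y1 (w.mate g) hgr ?_ ?_
      · rw [h3, w.mate_mate']
      · intro e
        exact hw.left_ne_right g (by rw [hg, ← e, w.left_mate])
      · intro e
        exact hw.left_ne_right g (by rw [hg, h12, ← e, w.left_mate])
    · intro h hh
      have hh' := comp_subset hgr' hh
      refine y1 h (fun h => hh' (Or.inr h)) ?_ ?_
      · rintro rfl
        exact hh' (Or.inl rfl)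
      · rintro rfl
        exact hh' (Or.inl h12.symm)
  have hyw : ∀ h, y (w.collapsedVertex (w.walk h)) = y (w.collapsedVertex (w.mate h)) := fun h => by
    rw [walk_apply, w.collapsedVertex_turn]
  set g := w.walk m₁ with hg
  have hgy : y (w.collapsedVertex g) = y (w.collapsedVertex m₂) := (hyw m₁).trans y3
  have hgl : w.left g = w.left m₁ := left_walk _
  have hgi : g.IsInner := isInner_of_collapsedVertex fun e => y4 (by rw [← e, hgy])
  have hgr : w.right g ∈ w.ball k := by
    by_contra h
    exact y4 (by rw [← hR g hgl h, hgy])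
  by_cases hgm : g = m₂
  · exact ⟨hgm, hgm ▸ hgi⟩
  exfalso
  have hgm1 : g ≠ m₁ := fun e => y2 (by rw [← e, hgy])
  have hb : w.left m₁ ∉ w.ball k := by rw [mem_ball]; omega
  have hgb : w.left g ∉ w.ball k := by rwa [hgl]
  have hgy' : y (w.collapsedVertex (w.mate g)) = y (w.collapsedVertex m₂) := by
    rw [← y1 g hgb hgm1 hgm, hgy]
  have hgi' : (w.mate g).IsInner := isInner_of_collapsedVertex fun e => y4 (by rw [← e, hgy'])
  refine hc.not_ball hgi hgi' hgb hgr ?_ ?_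
  · have : (w.mate m₁).IsInner := isInner_turn.1 hgi
    rw [hg, walk_apply, turn_turn_turn this, w.left_mate, mem_ball]
    omega
  · rw [← right_walk_eq]
    by_contra h
    exact y4 (by rw [← hR (w.walk g) (by rw [left_walk, hgl]) h, hyw, hgy'])

/-- The edges leading from a face of depth `k` to faces of depth `k - 1` are consecutive. -/
theorem lower_consecutive (hw : w.IsConn) (hr : w.Reduced) {k : ℕ} (hc : w.Convex k)
    {m₁ m₂ : HalfEdge n w.V} (h12 : w.left m₁ = w.left m₂) (hd : w.depth (w.left m₁) = k)
    (h1 : w.depth (w.right m₁) + 1 = k) (h2 : w.depth (w.right m₂) + 1 = k) (hne : m₁ ≠ m₂) :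
    (w.walk m₁ = m₂ ∧ m₂.IsInner) ∨ (w.walk m₂ = m₁ ∧ m₁.IsInner) := by
  obtain ⟨y, y1, y2, y3, y4⟩ := hw.exists_separation (S := w.ball k)
    (by rw [mem_ball, depth_unbounded]; omega) (fun f hf => hw.linked_ball hf)
    (by rw [mem_ball]; omega) h12 (by rw [mem_ball]; omega) (by rw [mem_ball]; omega) hne
  by_cases h : y none = y (w.collapsedVertex m₂)
  · right
    exact hw.walk_eq_of_separation hr hc h12.symm (h12 ▸ hd) h2 h1
      (fun h a b c => y1 h a c b) y2.symm y4 (by rw [h]; exact y2.symm)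
  · left
    exact hw.walk_eq_of_separation hr hc h12 hd h1 h2 y1 y2 y3 h

end IsConn

/-- The two sides of the edge have the same depth. -/
def Flat (w : BottomWeb n) (h : HalfEdge n w.V) : Prop :=
  w.depth (w.left h) = w.depth (w.right h)

/-- The half-edge is based at an internal vertex whose third sector is one step closer to the
unbounded face than the face on the left. -/
def Outer (w : BottomWeb n) (h : HalfEdge n w.V) : Prop :=
  h.IsInner ∧ w.depth (w.left (turn (turn h))) + 1 = w.depth (w.left h)

theorem Flat.mate {h : HalfEdge n w.V} (hh : w.Flat h) : w.Flat (w.mate h) := by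
  rw [Flat, w.left_mate, w.right_mate]
  exact Eq.symm hh

theorem IsConn.depth_pos_of_flat (hw : w.IsConn) {h : HalfEdge n w.V} (hh : w.Flat h) :
    0 < w.depth (w.left h) := by
  rw [Flat] at hh
  by_contra h0
  exact hw.left_ne_right h (by
    rw [depth_eq_zero (f := w.left h) (by omega), depth_eq_zero (f := w.right h) (by omega)])

namespace IsConn

/-- The closed curve through `s` and a lower edge of `left s` separates the ends of `s`. An end that
is not outer is joined to the axis off the curve: it lies on the axis, or `insert_insert_touches`
applies. Both ends cannot be joined in this way. -/
theorem outer_or_outer (hw : w.IsConn) (hr : w.Reduced) {s : HalfEdge n w.V} (hs : w.Flat s)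
    (hc : w.Convex (w.depth (w.left s))) : w.Outer s ∨ w.Outer (w.mate s) := by
  by_contra hcon
  rw [not_or] at hcon
  have hk := hw.depth_pos_of_flat hs
  set k := w.depth (w.left s) with hkdef
  have hks : w.depth (w.right s) = k := Eq.symm hs
  obtain ⟨d, hd⟩ : ∃ d, k = d + 1 := ⟨k - 1, by omega⟩
  obtain ⟨m, hme, hm⟩ := hw.exists_lower (hkdef.symm.trans hd)
  obtain ⟨m', hme', hm'⟩ := hw.exists_lower (hks.trans hd)
  have hne := hw.left_ne_right s
  have l2 : ∀ f ∈ insert (w.right s) (w.ball k),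
      w.Linked (insert (w.right s) (w.ball k)) w.unbounded f := by
    rw [← hme']
    exact linked_insert (fun g hg => hw.linked_ball hg) (by rw [mem_ball]; omega)
  obtain ⟨y, y1, y2, y3, y4⟩ := hw.exists_separation (S := insert (w.right s) (w.ball k))
    (m₁ := s) (m₂ := m) (Or.inr (by rw [mem_ball, depth_unbounded]; omega)) l2 (by
      rintro (h | h)
      · exact hne h
      · rw [mem_ball] at h
        omega) hme.symm (Or.inl rfl) (Or.inr (by rw [mem_ball]; omega)) (by
      rintro rfl
      omega)
  have key : ∀ t, w.depth (w.left t) = k → w.depth (w.right t) = k → ¬ w.Outer t →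
      insert (w.left t) (insert (w.right t) (w.ball k)) =
        insert (w.left s) (insert (w.right s) (w.ball k)) →
      y (w.collapsedVertex t) = y none := by
    intro t ht1 ht2 hto hins
    by_cases hti : t.IsInner
    · have h1 : w.left (turn (turn t)) ∉ w.ball k := by
        intro h
        rw [mem_ball] at h
        have := depth_le_third hti
        exact hto ⟨hti, by omega⟩
      obtain ⟨j, hj⟩ := hw.insert_insert_touches hr hc hti ht1 ht2 hk h1
      have h2 := hw.eq_none_of_touches (y := y) ?_ hj (b := turn (turn t)) rfl
      · rwa [w.collapsedVertex_turn, w.collapsedVertex_turn] at h2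
      · intro h hh
        have hh' := comp_subset (f := w.left (turn (turn t))) (by
          rintro (h | h | h)
          · exact hw.third_ne_left hti h
          · exact hw.third_ne_right t h
          · exact h1 h) hh
        rw [hins] at hh'
        refine y1 h (fun h => hh' (Or.inr h)) ?_ ?_
        · rintro rfl
          exact hh' (Or.inl rfl)
        · rintro rfl
          exact hh' (Or.inl hme)
    · cases t with
      | bdry i => rfl
      | inner v k => simp at hti
  have e1 := key s rfl hks hcon.1 rfl
  have e2 := key (w.mate s) hks (by rw [w.right_mate]) hcon.2 (by
    rw [w.right_mate, w.left_mate, Set.insert_comm])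
  exact y2 (by rw [e1, ← e2, y3])

/-- Walking around a face, the edges just before and just after a stretch of flat edges with outer
ends lead to lower faces, and are equal or follow each other. -/
theorem closing (hw : w.IsConn) (hr : w.Reduced) {s₁ s₂ : HalfEdge n w.V}
    (h12 : w.left s₁ = w.left s₂) (hs : w.Flat s₁) (hc : w.Convex (w.depth (w.left s₁)))
    (h1 : w.Outer s₁) (h2 : w.Outer (w.mate s₂)) (hs2 : w.Flat s₂) :
    ∃ m₁ m₂, m₁.IsInner ∧ m₂.IsInner ∧ w.walk m₁ = s₁ ∧ w.walk s₂ = m₂ ∧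
      (w.walk m₂ = m₁ ∨ w.walk m₂ = s₁) := by
  refine ⟨w.mate (turn (turn s₁)), w.walk s₂, ?_⟩
  have e1 := walk_mate_turn_turn h1.1
  have i2 : (w.walk s₂).IsInner := isInner_turn.2 h2.1
  have hk := h1.2
  have hk2 := h2.2
  rw [w.left_mate, ← show _ = _ from hs2, ← h12] at hk2
  by_cases e : w.mate (turn (turn s₁)) = w.walk s₂
  · rw [e] at e1 ⊢
    exact ⟨i2, i2, e1, rfl, Or.inr e1⟩
  · rcases hw.lower_consecutive hr (k := w.depth (w.left s₁)) hc
      (m₁ := w.mate (turn (turn s₁))) (m₂ := w.walk s₂)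
      (by rw [left_mate_turn_turn h1.1, left_walk, h12]) (by rw [left_mate_turn_turn h1.1])
      (by rw [right_mate_turn_turn, hk]) (by rw [right_walk_eq, hk2]) e with h | h
    · exfalso
      have h3 := h.1
      rw [e1] at h3
      have h4 : w.depth (w.right s₁) + 1 = w.depth (w.left s₁) := by
        rw [congrArg w.right h3, right_walk_eq, hk2]
      rw [Flat] at hs
      omega
    · exact ⟨h.2, i2, e1, rfl, Or.inl h.1⟩

/-- With two outer ends, the edges before and after `s` both lead to lower faces. By `closing` the
face on the left then has at most three edges. -/
theorem not_outer_outer (hw : w.IsConn) (hr : w.Reduced) {s : HalfEdge n w.V} (hs : w.Flat s)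
    (hc : w.Convex (w.depth (w.left s))) : ¬ (w.Outer s ∧ w.Outer (w.mate s)) := by
  classical
  rintro ⟨h1, h2⟩
  obtain ⟨m₁, m₂, i1, i2, w1, w2, w3⟩ := hw.closing hr rfl hs hc h1 h2 hs
  refine hw.not_short_face hr {m₁, s, m₂} (Finset.card_le_three.trans (by omega))
    (h := s) (by simp) ?_
  intro g hg
  simp only [Finset.mem_insert, Finset.mem_singleton] at hg ⊢
  rcases hg with rfl | rfl | rfl
  · exact ⟨i1, by simp [w1]⟩
  · exact ⟨h1.1, by simp [w2]⟩
  · exact ⟨i2, by tauto⟩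

/-- Let `h` be a convex edge at level `k + 1`. On the face `right h` of depth `k`, both neighbours
of `h` are flat. Their ends at `h` have a deeper third sector, so their far ends are the outer ones,
and `closing` leaves at most five edges for this face. -/
theorem convex_succ (hw : w.IsConn) (hr : w.Reduced) {k : ℕ} (hc : w.Convex k) :
    w.Convex (k + 1) := by
  classical
  intro h i1 i2 d1 d2 d3 d4
  set g := w.mate h with hg
  have hgl : w.left g = w.right h := rfl
  have hgk : w.depth (w.left g) = k := by rw [hgl]; omega
  have hgr : w.right g = w.left h := w.right_mate h
  set s₁ := w.mate (turn (turn g)) with hs₁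
  have h1l : w.left s₁ = w.left g := left_mate_turn_turn i2
  have h1w : w.walk s₁ = g := walk_mate_turn_turn i2
  have h1r : w.right s₁ = w.left (turn (turn g)) := right_mate_turn_turn g
  have h1f : w.Flat s₁ := by rw [Flat, h1l, h1r]; omega
  have h1o : w.Outer s₁ := by
    rcases hw.outer_or_outer hr h1f (by rwa [h1l, hgk]) with h3 | h3
    · exact h3
    · exfalso
      have h4 := h3.2
      rw [hs₁, w.mate_mate', turn_turn_turn i2, w.left_turn, hgr] at h4
      omega
  set s₂ := w.walk g with hs₂
  have hs₂' : s₂ = turn h := by rw [hs₂, walk_apply, hg, w.mate_mate']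
  have h2l : w.left s₂ = w.left g := left_walk _
  have h2r : w.right s₂ = w.left (turn (turn h)) := by rw [hs₂', ← w.left_turn]
  have h2f : w.Flat s₂ := by rw [Flat, h2l, h2r]; omega
  have i3 : s₂.IsInner := by rw [hs₂']; exact isInner_turn.2 i1
  have h2o : w.Outer (w.mate s₂) := by
    rcases hw.outer_or_outer hr h2f (by rwa [h2l, hgk]) with h3 | h3
    · exfalso
      have h4 := h3.2
      rw [h2l, hs₂', turn_turn_turn i1] at h4
      omega
    · exact h3
  obtain ⟨m₁, m₂, j1, j2, w1, w2, w3⟩ := hw.closing hr (h1l.trans h2l.symm) h1f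
    (by rwa [h1l, hgk]) h1o h2o h2f
  refine hw.not_short_face hr {m₁, s₁, g, s₂, m₂} Finset.card_le_five (h := g) (by simp) ?_
  intro x hx
  simp only [Finset.mem_insert, Finset.mem_singleton] at hx ⊢
  rcases hx with rfl | rfl | rfl | rfl | rfl
  · exact ⟨j1, by simp [w1]⟩
  · exact ⟨h1o.1, by simp [h1w]⟩
  · exact ⟨i2, by simp [← hs₂]⟩
  · exact ⟨i3, by simp [w2]⟩
  · exact ⟨j2, by tauto⟩

theorem convex (hw : w.IsConn) (hr : w.Reduced) (k : ℕ) : w.Convex k := by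
  induction k with
  | zero => intro h _ _ _ h2; omega
  | succ k ih => exact hw.convex_succ hr ih

end IsConn

end BottomWeb

end SL3Web

/-! ### The band diagram is anchored -/

namespace SL3Web

open HalfEdge

namespace BottomWeb

variable {n : ℕ} {w : BottomWeb n}

/-- The face on the right of the edge is one step deeper than the face on the left. -/
def Up (w : BottomWeb n) (h : HalfEdge n w.V) : Prop :=
  w.depth (w.left h) + 1 = w.depth (w.right h)

theorem up_mate {h : HalfEdge n w.V} :
    w.Up (w.mate h) ↔ w.depth (w.right h) + 1 = w.depth (w.left h) := by
  rw [Up, w.left_mate, w.right_mate]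

theorem up_or (h : HalfEdge n w.V) : w.Up h ∨ w.Flat h ∨ w.Up (w.mate h) := by
  rw [up_mate]
  have h1 := depth_left_le h
  have h2 := depth_right_le h
  simp only [Up, Flat]
  omega

theorem inBand_iff {h : HalfEdge n w.V} : w.InBand h ↔ w.Up h ∨ w.Up (w.mate h) := by
  rw [up_mate, Up]
  constructor
  · rintro ⟨d, ⟨h1, h2⟩ | ⟨h1, h2⟩⟩ <;> omega
  · rintro (h | h)
    · exact ⟨_, Or.inr ⟨rfl, h⟩⟩
    · exact ⟨_, Or.inl ⟨rfl, h⟩⟩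

theorem band_reachable {h : HalfEdge n w.V} (hh : w.InBand h) :
    w.band.Reachable h.vertex (w.mate h).vertex := by
  by_cases e : h.vertex = (w.mate h).vertex
  · rw [e]
  · exact SimpleGraph.Adj.reachable
      ((SimpleGraph.fromRel_adj _ _ _).2 ⟨e, Or.inl ⟨h, hh, rfl, rfl⟩⟩)

theorem exists_of_band_adj {a b : Fin n ⊕ w.V} (h : w.band.Adj a b) :
    ∃ g, w.InBand g ∧ g.vertex = a ∧ (w.mate g).vertex = b := by
  rw [band, SimpleGraph.fromRel_adj] at h
  rcases h.2 with h | ⟨g, h1, h2, h3⟩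
  · exact h
  · refine ⟨w.mate g, ?_, h3, by rwa [w.mate_mate']⟩
    rw [inBand_iff] at *
    rw [w.mate_mate']
    exact h1.symm

open Classical in
/-- A union of closed or anchored curves in the `k`-arc separates the half-plane into two parts, one
of them containing all faces of depth less than `k`. -/
theorem IsConn.exists_arc_potential (hw : w.IsConn) {k : ℕ} (hk : 0 < k)
    {R : Set (HalfEdge n w.V)} (hR : ∀ h ∈ R, w.Up h ∧ w.depth (w.right h) = k)
    (hb : ∀ v, ∑ j, ((if (.inner v j) ∈ R then 1 else 0) +
      (if w.mate (.inner v j) ∈ R then 1 else 0) : ZMod 2) = 0) :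
    ∃ p : w.F → ZMod 2, (∀ h, p (w.left h) + p (w.right h) =
      (if h ∈ R then 1 else 0) + (if w.mate h ∈ R then 1 else 0)) ∧
      (∀ f ∈ w.ball k, p f = 0) := by
  obtain ⟨p, hp⟩ := hw.exists_face_potential (k := ZMod 2)
    (fun h => (if h ∈ R then 1 else 0) + (if w.mate h ∈ R then 1 else 0))
    (fun h => by rw [CharTwo.neg_eq, w.mate_mate', add_comm]) hb
  refine ⟨fun f => p f + p w.unbounded, fun h => ?_, fun f hf => ?_⟩
  · rw [hp, CharTwo.sub_eq_add]
    have := CharTwo.add_self_eq_zero (p w.unbounded)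
    linear_combination this
  · rw [CharTwo.add_eq_zero]
    have := hw.linked_ball hf
    induction this with
    | refl => rfl
    | @tail b c hb hc ih =>
      have hb' : b ∈ w.ball k := Linked.mem hb (by rw [mem_ball, depth_unbounded]; exact hk)
      obtain ⟨hc, h, rfl, rfl⟩ := hc
      have h1 := hp h
      rw [if_neg, if_neg, add_zero] at h1
      · rw [← ih hb', sub_eq_zero.1 h1.symm]
      · intro h2
        have := (hR _ h2).2
        rw [w.right_mate] at this
        rw [mem_ball] at hb'
        omega
      · intro h2
        have := (hR _ h2).2
        rw [mem_ball] at hc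
        omega

/-- The band diagram of a reduced web has no closed components. -/
theorem anchored_of_reduced (hr : w.Reduced) : w.Anchored := by
  classical
  have hw := hr.isConn
  have := hw.noCircle
  refine ⟨fun c => isEmptyElim c, ?_⟩
  have key : ∀ h, w.Up h → ∃ i : Fin n, w.band.Reachable h.vertex (Sum.inl i) := by
    intro h hh
    by_contra hcon
    push Not at hcon
    set k := w.depth (w.right h) with hk
    have hk0 : 0 < k := by rw [Up] at hh; omega
    let R : Set (HalfEdge n w.V) := {x | (w.Up x ∧ w.depth (w.right x) = k) ∧
      w.band.Reachable h.vertex x.vertex}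
    have hRm : ∀ x ∈ R, w.band.Reachable h.vertex (w.mate x).vertex := fun x hx =>
      hx.2.trans (band_reachable (inBand_iff.2 (Or.inl hx.1.1)))
    obtain ⟨p, hp1, hp2⟩ := hw.exists_arc_potential hk0 (R := R) (fun x hx => hx.1) (by
      intro v
      by_cases hv : w.band.Reachable h.vertex (Sum.inr v)
      -- Around a vertex the edges of the `k`-arc are those across which `c` changes, so their
      -- number is even.
      · let c : ZMod 3 → ZMod 2 := fun j => if k ≤ w.depth (w.left (.inner v j)) then 1 else 0
        have hc : ∀ j, (if (.inner v j) ∈ R then 1 else 0) +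
            (if w.mate (.inner v j) ∈ R then 1 else 0) = c j + c (j - 1) := by
          intro j
          have e1 : w.left (.inner v (j - 1)) = w.right (.inner v j) :=
            w.left_turn (.inner v j)
          have e2 : (.inner v j) ∈ R ↔ w.Up (.inner v j) ∧ w.depth (w.right (.inner v j)) = k :=
            and_iff_left hv
          have e3 : w.mate (.inner v j) ∈ R ↔
              w.Up (w.mate (.inner v j)) ∧ w.depth (w.left (.inner v j)) = k := by
            constructor
            · rintro ⟨h1, -⟩
              rwa [w.right_mate] at h1
            · intro h1
              refine ⟨by rwa [w.right_mate], hv.trans ?_⟩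
              exact band_reachable (h := .inner v j) (inBand_iff.2 (Or.inr h1.1))
          rw [up_mate] at e3
          simp only [e2, e3, c, e1, Up]
          have h1 := depth_left_le (w := w) (.inner v j)
          have h2 := depth_right_le (w := w) (.inner v j)
          by_cases q1 : k ≤ w.depth (w.left (.inner v j)) <;>
            by_cases q2 : k ≤ w.depth (w.right (.inner v j))
          · rw [if_neg (by omega), if_neg (by omega), if_pos q1, if_pos q2]; rfl
          · rw [if_neg (by omega), if_pos (by omega), if_pos q1, if_neg q2]; rfl
          · rw [if_pos (by omega), if_neg (by omega), if_neg q1, if_pos q2]; rfl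
          · rw [if_neg (by omega), if_neg (by omega), if_neg q1, if_neg q2]
        have hs : ∑ j, c (j - 1) = ∑ j, c j := Equiv.sum_comp (Equiv.subRight 1) c
        refine (Finset.sum_congr rfl (g := fun j => c j + c (j - 1)) fun j _ => ?_).trans ?_
        · convert hc j
        rw [Finset.sum_add_distrib, hs]
        exact CharTwo.add_self_eq_zero _
      · refine Finset.sum_eq_zero fun j _ => ?_
        rw [if_neg, if_neg, add_zero]
        · intro hx
          have := hRm _ hx
          rw [w.mate_mate'] at this
          exact hv this
        · exact fun hx => hv hx.2)
    have hh' : h ∈ R := ⟨⟨hh, rfl⟩, SimpleGraph.Reachable.refl _⟩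
    have hb : ∀ i : Fin n, (.bdry i) ∉ R ∧ w.mate (.bdry i) ∉ R := by
      intro i
      refine ⟨fun hx => hcon i hx.2, fun hx => hcon i ?_⟩
      have := hRm _ hx
      rwa [w.mate_mate'] at this
    have hgap : ∀ j, p (w.gap j) = 0 := by
      intro j
      induction j using Fin.induction with
      | zero => exact hp2 _ (by rw [mem_ball]; exact depth_unbounded.trans_lt hk0)
      | succ j ih =>
        have := hp1 (.bdry j)
        rw [if_neg (hb j).1, if_neg (hb j).2, w.left_bdry, ih, Diagram.right, w.right_bdry] at this
        simpa using this
    have hrb : w.right h ∉ w.ball k := by rw [mem_ball]; omega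
    -- The potential vanishes on the ball and on all gaps, yet it jumps at `h` and is nonzero on
    -- `right h`. This face, however, reaches a gap outside the ball, where no edge of `R` is
    -- crossed.
    obtain ⟨j, hj⟩ := hw.ball_touches hr (hw.convex hr k) hrb
    have h1 : p (w.gap j) = p (w.right h) := by
      have := linked_comp hj
      refine Relation.ReflTransGen.head_induction_on
        (motive := fun a _ => a ∈ w.comp (w.ball k)ᶜ (w.right h) → p (w.gap j) = p a) this
        (fun _ => rfl) ?_ self_mem_comp
      rintro _ _ ⟨hc, x, rfl, rfl⟩ _ ih hl
      rw [ih hc]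
      have h2 := hp1 x
      have hl' := comp_subset hrb hl
      have hc' := comp_subset hrb hc
      rw [Set.mem_compl_iff, mem_ball, not_lt] at hl' hc'
      rw [if_neg, if_neg, add_zero, CharTwo.add_eq_zero] at h2
      · exact h2.symm
      · rintro ⟨⟨h3, h4⟩, -⟩
        rw [up_mate] at h3
        rw [w.right_mate] at h4
        omega
      · rintro ⟨⟨h3, h4⟩, -⟩
        rw [Up] at h3
        omega
    have h2 := hp1 h
    rw [if_pos hh', if_neg, ← h1, hgap, hp2 (w.left h)] at h2
    · simp at h2
    · rw [mem_ball]
      rw [Up] at hh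
      omega
    · rintro ⟨⟨h3, -⟩, -⟩
      rw [up_mate] at h3
      rw [Up] at hh
      omega
  intro h hh
  rcases inBand_iff.1 hh with h1 | h1
  · exact key h h1
  · obtain ⟨i, hi⟩ := key _ h1
    exact ⟨i, (band_reachable hh).trans hi⟩

/-! ### Matching and shadow in terms of the depths of the gaps -/

/-- The depth of the face above each gap of the `x`-axis. -/
noncomputable def gapDepth (w : BottomWeb n) (j : Fin (n + 1)) : ℕ := w.depth (w.gap j)

/-- The boundary points `i < j` are matched in the sequence `D` of depths: there is a step up at `i`
and the first return is the step down at `j`. -/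
def StepMatched (D : Fin (n + 1) → ℕ) (i j : Fin n) : Prop :=
  i < j ∧ D i.castSucc + 1 = D i.succ ∧ D j.succ + 1 = D i.succ ∧
    ∀ m : Fin (n + 1), i.castSucc < m → m ≤ j.castSucc → D i.succ ≤ D m

theorem StepMatched.unique {D : Fin (n + 1) → ℕ} {i j j' : Fin n} (h : StepMatched D i j)
    (h' : StepMatched D i j') : j = j' := by
  have key : ∀ {j j' : Fin n}, StepMatched D i j → StepMatched D i j' → ¬ j < j' := by
    intro j j' h h' hlt
    have h1 := h'.2.2.2 j.succ (by
      have := h.1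
      rw [Fin.lt_def] at *
      simp only [Fin.val_castSucc, Fin.val_succ]
      omega) (by
      rw [Fin.le_def]
      rw [Fin.lt_def] at hlt
      simp only [Fin.val_castSucc, Fin.val_succ]
      omega)
    have h2 := h.2.2.1
    omega
  rcases lt_trichotomy j j' with hlt | rfl | hlt
  · exact (key h h' hlt).elim
  · rfl
  · exact (key h' h hlt).elim

theorem exists_last_below {f : ℕ → ℕ} {k : ℕ} (h0 : f 0 < k) :
    ∀ m, k ≤ f m → ∃ t < m, f t < k ∧ ∀ s, t < s → s ≤ m → k ≤ f s := by
  intro m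
  induction m with
  | zero => intro h; omega
  | succ m ih =>
    intro hm
    by_cases h : f m < k
    · exact ⟨m, by omega, h, fun s h1 h2 => by rwa [show s = m + 1 by omega]⟩
    · obtain ⟨t, h1, h2, h3⟩ := ih (by omega)
      refine ⟨t, by omega, h2, fun s h4 h5 => ?_⟩
      rcases Nat.lt_or_ge m s with h6 | h6
      · rwa [show s = m + 1 by omega]
      · exact h3 s h4 h6

/-- The partner is the last earlier step from below the level `D i.castSucc`. As steps up have
height at most one, it starts exactly one below. -/
theorem exists_stepMatched_of_down {D : Fin (n + 1) → ℕ} (h0 : D 0 = 0)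
    (hstep : ∀ i : Fin n, D i.succ ≤ D i.castSucc + 1) {i : Fin n}
    (hi : D i.succ + 1 = D i.castSucc) : ∃ i₀, StepMatched D i₀ i := by
  let f : ℕ → ℕ := fun m => if h : m < n + 1 then D ⟨m, h⟩ else 0
  have hf : ∀ m : Fin (n + 1), f m = D m := fun m => dif_pos m.isLt
  obtain ⟨t, h1, h2, h3⟩ := exists_last_below (f := f) (k := D i.castSucc)
    (by rw [show f 0 = D 0 from hf 0, h0]; omega) i.val (by
      have := hf i.castSucc
      rw [Fin.val_castSucc] at this
      rw [this])
  have ht : t < n := by omega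
  have e1 : f t = D (Fin.castSucc ⟨t, ht⟩) := hf (Fin.castSucc ⟨t, ht⟩)
  have e2 : f (t + 1) = D (Fin.succ ⟨t, ht⟩) := hf (Fin.succ ⟨t, ht⟩)
  have e3 := h3 (t + 1) (by omega) (by omega)
  have e4 := hstep ⟨t, ht⟩
  refine ⟨⟨t, ht⟩, Fin.lt_def.2 h1, by omega, by omega, fun m h4 h5 => ?_⟩
  rw [← hf m]
  rw [Fin.lt_def] at h4
  rw [Fin.le_def] at h5
  have := h3 m h4 h5
  omega

theorem gapDepth_zero : w.gapDepth 0 = 0 := depth_unbounded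

theorem depth_left_bdry (i : Fin n) : w.depth (w.left (.bdry i)) = w.gapDepth i.castSucc := by
  rw [w.left_bdry, gapDepth]

theorem depth_right_bdry (i : Fin n) : w.depth (w.right (.bdry i)) = w.gapDepth i.succ := by
  rw [Diagram.right, w.right_bdry, gapDepth]

theorem vertex_eq_inl {h : HalfEdge n w.V} {i : Fin n} (hh : h.vertex = Sum.inl i) :
    h = .bdry i := by
  cases h with
  | bdry j => cases hh; rfl
  | inner v k => cases hh

theorem vertex_eq_inr {h : HalfEdge n w.V} {v : w.V} (hh : h.vertex = Sum.inr v) :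
    ∃ k, h = .inner v k := by
  cases h with
  | bdry j => cases hh
  | inner u k => cases hh; exact ⟨k, rfl⟩

theorem eq_or_turn {x y : HalfEdge n w.V} {v : w.V} (hx : x.vertex = Sum.inr v)
    (hy : y.vertex = Sum.inr v) : x = y ∨ y = turn x ∨ x = turn y := by
  obtain ⟨k, rfl⟩ := vertex_eq_inr hx
  obtain ⟨l, rfl⟩ := vertex_eq_inr hy
  simp only [turn_inner, HalfEdge.inner.injEq, true_and]
  have : ∀ k l : ZMod 3, k = l ∨ l = k - 1 ∨ k = l - 1 := by decide
  exact this k l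

/-- The three sectors at an internal vertex are pairwise adjacent, so only two consecutive depths
occur there. This prevents arcs from branching. -/
theorem depth_spread {x : HalfEdge n w.V} (hx : x.IsInner) :
    w.depth (w.left x) ≤ w.depth (w.right (turn x)) + 1 ∧
      w.depth (w.right (turn x)) ≤ w.depth (w.left x) + 1 := by
  rw [← w.left_turn]
  exact ⟨depth_le_third hx, depth_third_le hx⟩

/-- At most one band edge leaves an internal vertex with the deeper face on the right. -/
theorem up_source_unique {x y : HalfEdge n w.V} {v : w.V} (hx : x.vertex = Sum.inr v)
    (hy : y.vertex = Sum.inr v) (ux : w.Up x) (uy : w.Up y) : x = y := by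
  have key : ∀ {x y : HalfEdge n w.V}, x.IsInner → w.Up x → w.Up y → y ≠ turn x := by
    rintro x _ hx ux uy rfl
    have := depth_spread hx
    rw [Up] at ux uy
    rw [w.left_turn] at uy
    omega
  have ix : x.IsInner := by obtain ⟨k, rfl⟩ := vertex_eq_inr hx; simp
  have iy : y.IsInner := by obtain ⟨k, rfl⟩ := vertex_eq_inr hy; simp
  rcases eq_or_turn hx hy with h | h | h
  · exact h
  · exact (key ix ux uy h).elim
  · exact (key iy uy ux h).elim

theorem up_target_unique {x y : HalfEdge n w.V} {v : w.V} (hx : x.vertex = Sum.inr v)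
    (hy : y.vertex = Sum.inr v) (ux : w.Up (w.mate x)) (uy : w.Up (w.mate y)) : x = y := by
  have key : ∀ {x y : HalfEdge n w.V}, x.IsInner → w.Up (w.mate x) → w.Up (w.mate y) →
      y ≠ turn x := by
    rintro x _ hx ux uy rfl
    have := depth_spread hx
    rw [up_mate] at ux uy
    rw [w.left_turn] at uy
    omega
  have ix : x.IsInner := by obtain ⟨k, rfl⟩ := vertex_eq_inr hx; simp
  have iy : y.IsInner := by obtain ⟨k, rfl⟩ := vertex_eq_inr hy; simp
  rcases eq_or_turn hx hy with h | h | h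
  · exact h
  · exact (key ix ux uy h).elim
  · exact (key iy uy ux h).elim

/-- The band edge `y` continues the band edge `x`, both with the deeper face on the right. -/
def Next (w : BottomWeb n) (x y : HalfEdge n w.V) : Prop :=
  y.IsInner ∧ w.Up y ∧ w.depth (w.right y) = w.depth (w.right x) ∧ y.vertex = (w.mate x).vertex

/-- The third sector at the end of `x` has the depth of one of the two sides of `x`; the arc
continues between it and the other side. -/
theorem exists_next {x : HalfEdge n w.V} (hx : w.Up x) (hi : (w.mate x).IsInner) :
    ∃ y, w.Next x y := by
  have h1 := depth_third_le hi
  have h2 := depth_le_third hi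
  have h3 := depth_left_le (turn (w.mate x))
  have h4 := depth_right_le (turn (w.mate x))
  have h5 := left_turn_turn_mem_iff hi
  rw [← w.left_turn (turn _), w.left_turn (w.mate x), w.right_mate] at h3 h4
  rw [w.left_mate] at h1 h2
  have hv : ∀ g : HalfEdge n w.V, g.IsInner → (turn g).vertex = g.vertex := by
    rintro _ ⟨v, k, rfl⟩
    rfl
  rw [Up] at hx
  by_cases h : w.depth (w.left (turn (turn (w.mate x)))) = w.depth (w.right x)
  · refine ⟨turn (w.mate x), isInner_turn.2 hi, ?_, ?_, hv _ hi⟩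
    · rw [Up, w.left_turn, w.right_mate, ← w.left_turn, h, hx]
    · rw [← w.left_turn, h]
  · refine ⟨turn (turn (w.mate x)), isInner_turn.2 (isInner_turn.2 hi), ?_, ?_,
      (hv _ (isInner_turn.2 hi)).trans (hv _ hi)⟩
    · rw [Up, h5, w.left_mate]
      omega
    · rw [h5, w.left_mate]

open Classical in
/-- The component of the band diagram starting at a step up ends at the matching step down. -/
theorem IsConn.exists_partner (hw : w.IsConn) {i : Fin n}
    (hi : w.gapDepth i.castSucc + 1 = w.gapDepth i.succ) :
    ∃ j, StepMatched w.gapDepth i j ∧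
      ∀ j', w.band.Reachable (Sum.inl i) (Sum.inl j') ↔ j' = i ∨ j' = j := by
  set k := w.gapDepth i.succ with hk
  let R : Set (HalfEdge n w.V) := {x | Relation.ReflTransGen w.Next (.bdry i) x}
  have hupi : w.Up (.bdry i) := by rw [Up, depth_left_bdry, depth_right_bdry, hi]
  have hR : ∀ x ∈ R, w.Up x ∧ w.depth (w.right x) = k := by
    intro x hx
    induction hx with
    | refl => exact ⟨hupi, depth_right_bdry i⟩
    | tail _ h ih => exact ⟨h.2.1, h.2.2.1.trans ih.2⟩
  have hbase : (.bdry i) ∈ R := Relation.ReflTransGen.refl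
  have hprev : ∀ x ∈ R, x.IsInner → ∃ y ∈ R, (w.mate y).vertex = x.vertex := by
    intro x hx hxi
    rcases Relation.ReflTransGen.cases_tail hx with h | ⟨y, hy, h⟩
    · rw [h] at hxi
      simp at hxi
    · exact ⟨y, hy, h.2.2.2.symm⟩
  have hnext : ∀ x ∈ R, (w.mate x).IsInner → ∃ y ∈ R, y.vertex = (w.mate x).vertex := by
    intro x hx hxi
    obtain ⟨y, hy⟩ := exists_next (hR x hx).1 hxi
    exact ⟨y, Relation.ReflTransGen.tail hx hy, hy.2.2.2⟩
  have hbd : ∀ j, (.bdry j) ∈ R → j = i := by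
    intro j hj
    rcases Relation.ReflTransGen.cases_tail hj with h | ⟨y, hy, h⟩
    · cases h
      rfl
    · simpa using h.1
  have hk0 : 0 < k := by omega
  -- At an internal vertex the arc enters at most once and leaves at most once, and it does one
  -- exactly when it does the other. The potential marks the region that the arc cuts off.
  obtain ⟨p, hp1, hp2⟩ := hw.exists_arc_potential hk0 hR (by
    intro v
    rw [Finset.sum_add_distrib]
    have e1 : ∀ Q : ZMod 3 → Prop, (∀ a b, Q a → Q b → a = b) →
        ∑ j, (if Q j then 1 else 0 : ZMod 2) = if ∃ j, Q j then 1 else 0 := by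
      intro Q hQ
      by_cases h : ∃ j, Q j
      · obtain ⟨j, hj⟩ := h
        rw [if_pos ⟨j, hj⟩, Finset.sum_eq_single j, if_pos hj]
        · exact fun b _ hb => if_neg fun hb' => hb (hQ _ _ hb' hj)
        · simp
      · rw [if_neg h]
        exact Finset.sum_eq_zero fun j _ => if_neg fun hj => h ⟨j, hj⟩
    rw [e1 _ (fun a b ha hb => by
        have := up_source_unique (v := v) rfl rfl (hR _ ha).1 (hR _ hb).1
        simpa using this),
      e1 _ (fun a b ha hb => by
        have := up_target_unique (v := v) (x := .inner v a) (y := .inner v b) rfl rfl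
          (hR _ ha).1 (hR _ hb).1
        simpa using this)]
    have e2 : (∃ j, (.inner v j) ∈ R) ↔ ∃ j, w.mate (.inner v j) ∈ R := by
      constructor
      · rintro ⟨j, hj⟩
        obtain ⟨y, hy, hyv⟩ := hprev _ hj (by simp)
        obtain ⟨l, hl⟩ := vertex_eq_inr (v := v) (hyv.trans rfl)
        exact ⟨l, by rwa [← hl, w.mate_mate']⟩
      · rintro ⟨j, hj⟩
        obtain ⟨y, hy, hyv⟩ := hnext _ hj (by simp)
        obtain ⟨l, hl⟩ := vertex_eq_inr (v := v) (hyv.trans (by simp; rfl))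
        exact ⟨l, by rwa [← hl]⟩
    simp only [e2]
    exact CharTwo.add_self_eq_zero _)
  let E : Fin n → Prop := fun j => w.mate (.bdry j) ∈ R
  have hstep : ∀ j : Fin n, p (w.gap j.castSucc) + p (w.gap j.succ) =
      (if j = i then 1 else 0) + (if E j then 1 else 0) := by
    intro j
    have := hp1 (.bdry j)
    rw [w.left_bdry, Diagram.right, w.right_bdry] at this
    rw [this]
    congr 2
    exact propext ⟨hbd j, fun h => h ▸ hbase⟩
  have hEd : ∀ j, E j → w.gapDepth j.succ + 1 = k := by
    intro j hj
    have := hR _ hj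
    rw [up_mate, w.right_mate, depth_left_bdry, depth_right_bdry] at this
    omega
  have hEi : ¬ E i := fun h => by have := hEd i h; omega
  have hE0 : ∀ j, E j → p (w.gap j.succ) = 0 := fun j hj =>
    hp2 _ (by have := hEd j hj; rw [mem_ball]; change w.gapDepth _ < k; omega)
  have hE1 : ∀ j, E j → p (w.gap j.castSucc) = 1 := fun j hj => by
    have h1 := hstep j
    rw [hE0 j hj, if_pos hj, if_neg (by rintro rfl; exact hEi hj)] at h1
    simpa using h1
  -- An end of the arc requires `p = 1` before it, so `p` can rise only at `i`.
  have hstay : ∀ j : Fin n, j ≠ i → p (w.gap j.castSucc) = 0 → p (w.gap j.succ) = 0 := by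
    intro j hj h0
    have h1 := hstep j
    have hjE : ¬ E j := fun h => by rw [hE1 j h] at h0; exact one_ne_zero h0
    rw [h0, if_neg hj, if_neg hjE] at h1
    simpa using h1
  have hleft : ∀ m : Fin (n + 1), m ≤ i.castSucc → p (w.gap m) = 0 := by
    intro m
    induction m using Fin.induction with
    | zero => exact fun _ => hp2 _ (by rw [mem_ball]; exact depth_unbounded.trans_lt hk0)
    | succ m ih =>
      intro hm
      rw [Fin.le_def, Fin.val_succ, Fin.val_castSucc] at hm
      refine hstay m (by rintro rfl; omega) (ih ?_)
      rw [Fin.le_def, Fin.val_castSucc, Fin.val_castSucc]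
      omega
  have hpi : p (w.gap i.succ) = 1 := by
    have h1 := hstep i
    rw [hleft _ le_rfl, if_pos rfl, if_neg hEi] at h1
    simpa using h1
  have hright : ∀ m m' : Fin (n + 1), i.castSucc < m → m ≤ m' → p (w.gap m) = 0 →
      p (w.gap m') = 0 := by
    intro m m' hm
    induction m' using Fin.induction with
    | zero =>
      intro h _
      exact absurd (lt_of_lt_of_le hm h) (Fin.not_lt_zero _)
    | succ m' ih =>
      intro h h0
      rcases eq_or_lt_of_le h with h1 | h1
      · rwa [← h1]
      · rw [Fin.lt_def, Fin.val_succ] at h1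
        rw [Fin.lt_def, Fin.val_castSucc] at hm
        refine hstay m' (by rintro rfl; omega) (ih ?_ h0)
        rw [Fin.le_def, Fin.val_castSucc]
        omega
  have hmatch : ∀ j, E j → StepMatched w.gapDepth i j := by
    intro j hj
    have hij : i < j := by
      by_contra h
      have := hleft j.castSucc (by rw [Fin.le_def]; simpa using h)
      rw [hE1 j hj] at this
      exact one_ne_zero this
    refine ⟨hij, hi, hEd j hj, fun m h1 h2 => ?_⟩
    by_contra h3
    have h4 := hright m j.castSucc h1 h2 (hp2 _ (by
      rw [mem_ball]; change w.gapDepth _ < k; omega))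
    rw [hE1 j hj] at h4
    exact one_ne_zero h4
  -- The arc is not followed to its end. Instead, `p` is `1` after `i` and must be `0` at the last
  -- gap, which touches the unbounded face.
  obtain ⟨j, hj⟩ : ∃ j, E j := by
    by_contra hcon
    push Not at hcon
    have : ∀ m : Fin (n + 1), i.castSucc < m → p (w.gap m) = 1 := by
      intro m
      induction m using Fin.induction with
      | zero => intro h; simp at h
      | succ m ih =>
        intro h
        rw [Fin.lt_def, Fin.val_castSucc, Fin.val_succ] at h
        by_cases hmi : m = i
        · rwa [hmi]
        · have h1 := hstep m
          rw [ih (by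
            rw [Fin.lt_def, Fin.val_castSucc, Fin.val_castSucc]
            have : m.val ≠ i.val := fun h => hmi (Fin.ext h)
            omega), if_neg hmi, if_neg (hcon m), add_zero, CharTwo.add_eq_zero] at h1
          exact h1.symm
    have h1 := this (Fin.last n) (Fin.castSucc_lt_last i)
    rw [w.gap_last, hp2 (w.gap 0) (by rw [mem_ball]; exact depth_unbounded.trans_lt hk0)] at h1
    exact one_ne_zero h1.symm
  refine ⟨j, hmatch j hj, fun j' => ⟨fun hreach => ?_, ?_⟩⟩
  · have key : ∀ a, w.band.Reachable (Sum.inl i) a →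
        ∃ x ∈ R, x.vertex = a ∨ (w.mate x).vertex = a := by
      intro a ha
      rw [SimpleGraph.reachable_iff_reflTransGen] at ha
      induction ha with
      | refl => exact ⟨_, hbase, Or.inl rfl⟩
      | @tail a b _ hab ih =>
        obtain ⟨h, hh, rfl, rfl⟩ := exists_of_band_adj hab
        obtain ⟨x, hx, hxa⟩ := ih
        cases e : h.vertex with
        | inl i' =>
          rw [e] at hxa
          rcases hxa with hxa | hxa
          · rw [vertex_eq_inl e, ← vertex_eq_inl hxa]
            exact ⟨x, hx, Or.inr rfl⟩
          · rw [vertex_eq_inl e, ← vertex_eq_inl hxa, w.mate_mate']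
            exact ⟨x, hx, Or.inl rfl⟩
        | inr v =>
          rw [e] at hxa
          have hin : ∀ y : HalfEdge n w.V, y.vertex = Sum.inr v → y.IsInner := by
            intro y hy
            obtain ⟨k, rfl⟩ := vertex_eq_inr hy
            simp
          obtain ⟨xi, hxi, hxiv, xo, hxo, hxov⟩ : ∃ xi ∈ R, (w.mate xi).vertex = Sum.inr v ∧
              ∃ xo ∈ R, xo.vertex = Sum.inr v := by
            rcases hxa with hxa | hxa
            · obtain ⟨y, hy, hyv⟩ := hprev x hx (hin _ hxa)
              exact ⟨y, hy, hyv.trans hxa, x, hx, hxa⟩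
            · obtain ⟨y, hy, hyv⟩ := hnext x hx (hin _ hxa)
              exact ⟨x, hx, hxa, y, hy, hyv.trans hxa⟩
          rcases inBand_iff.1 hh with hu | hu
          · rw [up_source_unique e hxov hu (hR _ hxo).1]
            exact ⟨xo, hxo, Or.inr rfl⟩
          · rw [up_target_unique e hxiv hu (by rw [w.mate_mate']; exact (hR _ hxi).1),
              w.mate_mate']
            exact ⟨xi, hxi, Or.inl rfl⟩
    obtain ⟨x, hx, h | h⟩ := key _ hreach
    · left
      rw [vertex_eq_inl h] at hx
      exact hbd _ hx
    · right
      have : E j' := by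
        change w.mate (.bdry j') ∈ R
        rwa [← vertex_eq_inl h, w.mate_mate']
      exact (hmatch _ this).unique (hmatch _ hj)
  · have hreach : ∀ x ∈ R, w.band.Reachable (Sum.inl i) x.vertex := by
      intro x hx
      induction hx with
      | refl => exact SimpleGraph.Reachable.refl _
      | tail h1 h2 ih =>
        rw [h2.2.2.2]
        exact ih.trans (band_reachable (inBand_iff.2 (Or.inl (hR _ h1).1)))
    rintro (rfl | rfl)
    · exact SimpleGraph.Reachable.refl _
    · have h1 := band_reachable (inBand_iff.2 (Or.inl (hR _ hj).1))
      rw [w.mate_mate'] at h1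
      exact (hreach _ hj).trans h1

theorem gapDepth_succ_le (i : Fin n) : w.gapDepth i.succ ≤ w.gapDepth i.castSucc + 1 := by
  rw [← depth_left_bdry, ← depth_right_bdry]
  exact depth_right_le _

theorem gapDepth_castSucc_le (i : Fin n) : w.gapDepth i.castSucc ≤ w.gapDepth i.succ + 1 := by
  rw [← depth_left_bdry, ← depth_right_bdry]
  exact depth_left_le _

/-- The matching defined by the band diagram is the one given by the depths of the gaps. -/
theorem bandMatching_iff (hr : w.Reduced) (i j : Fin n) :
    w.bandMatching i j ↔ StepMatched w.gapDepth i j ∨ StepMatched w.gapDepth j i := by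
  have hw := hr.isConn
  constructor
  · rintro ⟨hne, hreach⟩
    have h1 := gapDepth_succ_le (w := w) i
    have h2 := gapDepth_castSucc_le (w := w) i
    rcases lt_trichotomy (w.gapDepth i.castSucc) (w.gapDepth i.succ) with h | h | h
    · obtain ⟨j', hm, hj'⟩ := hw.exists_partner (i := i) (by omega)
      rcases (hj' j).1 hreach with e | e
      · exact (hne e.symm).elim
      · exact Or.inl (e ▸ hm)
    · exfalso
      rw [SimpleGraph.reachable_iff_reflTransGen] at hreach
      rcases Relation.ReflTransGen.cases_head hreach with e | ⟨b, hb, -⟩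
      · exact hne (Sum.inl_injective e)
      · obtain ⟨g, hg, hgi, -⟩ := exists_of_band_adj hb
        rw [inBand_iff, vertex_eq_inl hgi, up_mate, Up, depth_left_bdry, depth_right_bdry] at hg
        omega
    · right
      obtain ⟨i₀, hi₀⟩ := exists_stepMatched_of_down gapDepth_zero
        (fun i => gapDepth_succ_le (w := w) i) (i := i) (by omega)
      obtain ⟨j', hm, hj'⟩ := hw.exists_partner hi₀.2.1
      have := hm.unique hi₀
      subst this
      rcases (hj' j).1 (((hj' _).2 (Or.inr rfl)).trans hreach) with e | e
      · rw [e]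
        exact hi₀
      · exact (hne e.symm).elim
  · have key : ∀ {i j : Fin n}, StepMatched w.gapDepth i j → w.bandMatching i j := by
      intro i j h
      obtain ⟨j', hm, hj'⟩ := hw.exists_partner h.2.1
      exact ⟨h.1.ne, (hj' j).2 (Or.inr (h.unique hm))⟩
    rintro (h | h)
    · exact key h
    · exact ⟨(key h).1.symm, (key h).2.symm⟩

/-- A boundary point is a step up if its partner lies to the right, a step down if it lies to the
left, and level if it has none. The depths follow from left to right, starting at `0`. -/
theorem gapDepth_eq_of_bandMatching_eq {w' : BottomWeb n} (hr : w.Reduced) (hr' : w'.Reduced)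
    (h : w.bandMatching = w'.bandMatching) : w.gapDepth = w'.gapDepth := by
  have hup : ∀ {u : BottomWeb n}, u.Reduced → ∀ i, (∃ j, i < j ∧ u.bandMatching i j) ↔
      u.gapDepth i.castSucc + 1 = u.gapDepth i.succ := by
    intro u hu i
    constructor
    · rintro ⟨j, hij, hm⟩
      rcases (bandMatching_iff hu i j).1 hm with h | h
      · exact h.2.1
      · exact (lt_asymm hij h.1).elim
    · intro h
      obtain ⟨j, hm, -⟩ := hu.isConn.exists_partner h
      exact ⟨j, hm.1, (bandMatching_iff hu i j).2 (Or.inl hm)⟩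
  have hdown : ∀ {u : BottomWeb n}, u.Reduced → ∀ i, (∃ j, j < i ∧ u.bandMatching i j) ↔
      u.gapDepth i.succ + 1 = u.gapDepth i.castSucc := by
    intro u hu i
    constructor
    · rintro ⟨j, hij, hm⟩
      rcases (bandMatching_iff hu i j).1 hm with h | h
      · exact (lt_asymm hij h.1).elim
      · rw [h.2.2.1]
        have h1 := h.2.2.2 i.castSucc (by
          rw [Fin.lt_def, Fin.val_castSucc, Fin.val_castSucc]; exact hij) le_rfl
        have h2 := gapDepth_castSucc_le (w := u) i
        have h3 := h.2.2.1
        omega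
    · intro h
      obtain ⟨i₀, hi₀⟩ := exists_stepMatched_of_down gapDepth_zero
        (fun i => gapDepth_succ_le (w := u) i) h
      exact ⟨i₀, hi₀.1, (bandMatching_iff hu i i₀).2 (Or.inr hi₀)⟩
  funext j
  induction j using Fin.induction with
  | zero => rw [gapDepth_zero, gapDepth_zero]
  | succ i ih =>
    have u1 := hup hr i
    have u2 := hup hr' i
    have d1 := hdown hr i
    have d2 := hdown hr' i
    rw [h] at u1 d1
    have e1 := u1.symm.trans u2
    have e2 := d1.symm.trans d2
    have s1 := gapDepth_succ_le (w := w) i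
    have s2 := gapDepth_castSucc_le (w := w) i
    have s3 := gapDepth_succ_le (w := w') i
    have s4 := gapDepth_castSucc_le (w := w') i
    omega

theorem bandMatching_eq_iff {w' : BottomWeb n} (hr : w.Reduced) (hr' : w'.Reduced) :
    w.bandMatching = w'.bandMatching ↔ w.gapDepth = w'.gapDepth := by
  refine ⟨gapDepth_eq_of_bandMatching_eq hr hr', fun h => ?_⟩
  funext i j
  rw [bandMatching_iff hr, bandMatching_iff hr', h]

/-- Closed gaps overlap only at boundary points, so the point `j + 1/2` reads off the depth of gap
`j`. The terms with `d ≥ 1` suffice, a depth in none of them being `0`. -/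
theorem shadow_eq_iff {w' : BottomWeb n} :
    (∀ d, 1 ≤ d → w.shadow d = w'.shadow d) ↔ w.gapDepth = w'.gapDepth := by
  constructor
  · intro h
    have hx : ∀ (j j' : Fin (n + 1)), ((j : ℕ) : ℝ) + 1 / 2 ∈ closedGap n j' ↔ j' = j := by
      intro j j'
      constructor
      · rintro ⟨h1, h2⟩
        have h3 : j'.val ≤ j.val := by
          by_cases e : j' = 0
          · rw [e]; exact Nat.zero_le _
          · by_contra hlt
            have h4 := h1 e
            have h5 : ((j : ℕ) : ℝ) + 1 ≤ (j' : ℕ) := by exact_mod_cast (by omega)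
            linarith
        have h6 : j.val ≤ j'.val := by
          by_cases e : j' = Fin.last n
          · rw [e]; exact Fin.le_last j
          · by_contra hlt
            have h4 := h2 e
            have h5 : ((j' : ℕ) : ℝ) + 1 ≤ (j : ℕ) := by exact_mod_cast (by omega)
            linarith
        exact Fin.ext (by omega)
      · rintro rfl
        exact ⟨fun _ => by linarith, fun _ => by linarith⟩
    have hs : ∀ (u : BottomWeb n) (d : ℕ) (j : Fin (n + 1)),
        ((j : ℕ) : ℝ) + 1 / 2 ∈ u.shadow d ↔ d ≤ u.gapDepth j := by
      intro u d j
      constructor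
      · rintro ⟨j', h1, h2⟩
        rw [(hx j j').1 h2] at h1
        exact h1
      · exact fun h1 => ⟨j, h1, (hx j j).2 rfl⟩
    funext j
    have key : ∀ d, 1 ≤ d → (d ≤ w.gapDepth j ↔ d ≤ w'.gapDepth j) := fun d hd => by
      rw [← hs, ← hs, h d hd]
    apply le_antisymm
    · by_cases h0 : w.gapDepth j = 0
      · omega
      · exact (key _ (by omega)).1 le_rfl
    · by_cases h0 : w'.gapDepth j = 0
      · omega
      · exact (key _ (by omega)).2 le_rfl
  · intro h d _
    have h1 : ∀ j, w.depth (w.gap j) = w'.depth (w'.gap j) := fun j => congrFun h j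
    simp only [shadow, h1]

end BottomWeb

end SL3Web

/-! ### Growing a web: good half-edges, peaks and frontiers -/

namespace SL3Web

open HalfEdge

namespace BottomWeb

variable {n : ℕ} {w w' : BottomWeb n}

theorem isSource_turn {h : HalfEdge n w.V} (hh : h.IsInner) :
    w.isSource (turn h).vertex = w.isSource h.vertex := by
  obtain ⟨v, k, rfl⟩ := hh
  rfl

theorem turn_ne_self {h : HalfEdge n w.V} (hh : h.IsInner) : turn h ≠ h := by
  obtain ⟨v, k, rfl⟩ := hh
  rw [turn_inner]
  intro e
  have : ∀ k : ZMod 3, k - 1 ≠ k := by decide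
  exact this k (HalfEdge.inner.inj e).2

/-- The condition on the half-edges of a frontier: the descending ones are at the `x`-axis, and the
flat ones point to a vertex whose third sector is closer to the unbounded face. -/
def Good (w : BottomWeb n) (h : HalfEdge n w.V) : Prop :=
  (w.Up (w.mate h) → ¬ h.IsInner) ∧ (w.Flat h → w.Outer (w.mate h))

theorem Up.not_flat {h : HalfEdge n w.V} (hh : w.Up h) : ¬ w.Flat h := by
  rw [Up] at hh
  rw [Flat]
  omega

theorem Up.good {h : HalfEdge n w.V} (hh : w.Up h) : w.Good h := by
  refine ⟨fun h1 => ?_, fun h1 => (hh.not_flat h1).elim⟩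
  rw [up_mate] at h1
  rw [Up] at hh
  omega

theorem IsConn.good_bdry (hw : w.IsConn) (hr : w.Reduced) (i : Fin n) : w.Good (.bdry i) :=
  ⟨fun _ => not_isInner_bdry i, fun h =>
    (hw.outer_or_outer hr h (hw.convex hr _)).resolve_left fun h1 => not_isInner_bdry i h1.1⟩

/-- The bound `hd` rules out a descent. The third sector at the base is `right h`, deeper than `left
h`, so if the edge is flat its outer end is the far one. -/
theorem IsConn.good_turn_mate (hw : w.IsConn) (hr : w.Reduced) {h : HalfEdge n w.V} (hh : w.Up h)
    (hi : (w.mate h).IsInner) (hd : w.depth (w.left h) ≤ w.depth (w.right (turn (w.mate h)))) :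
    w.Good (turn (w.mate h)) := by
  have e : w.left (turn (w.mate h)) = w.left h := by rw [w.left_turn, w.right_mate]
  refine ⟨fun h1 => ?_, fun h1 => ?_⟩
  · rw [up_mate, e] at h1
    omega
  · refine (hw.outer_or_outer hr h1 (hw.convex hr _)).resolve_left fun h2 => ?_
    have h3 := h2.2
    rw [turn_turn_turn hi, w.left_mate, e] at h3
    rw [Up] at hh
    omega

/-- The three ways in which a peak of the frontier can look: the two half-edges form an edge, or
they end at the same vertex, or they end at the two ends of an edge. -/
theorem IsConn.peak (hw : w.IsConn) (hr : w.Reduced) {h g : HalfEdge n w.V}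
    (hhg : w.right h = w.left g) (hh : w.Up h) (hg : ¬ w.Up g) (hgood : w.Good g) :
    (w.mate h = g ∧ ¬ w.Flat g ∧ w.isSource g.vertex = !w.isSource h.vertex) ∨
    ((w.mate h).IsInner ∧ turn (w.mate g) = w.mate h ∧
      w.isSource g.vertex = w.isSource h.vertex) ∨
    ((w.mate h).IsInner ∧ (w.mate g).IsInner ∧ w.Flat g ∧
      turn (w.mate (turn (w.mate g))) = w.mate h ∧
      w.depth (w.right (turn (w.mate g))) = w.depth (w.left h) ∧
      w.isSource g.vertex = !w.isSource h.vertex) := by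
  have hc := hw.convex hr (w.depth (w.right h))
  have hsm : ∀ x, w.isSource x.vertex = !w.isSource (w.mate x).vertex := fun x => by
    rw [w.isSource_mate]
    simp
  have hh' := hh
  rw [Up] at hh'
  have hY : turn (w.mate g) = w.mate h → (w.mate g).IsInner →
      w.isSource g.vertex = w.isSource h.vertex := fun e hi => by
    rw [hsm g, hsm h, ← e, isSource_turn hi]
  rcases w.up_or g with h1 | h1 | h1
  · exact (hg h1).elim
  · have ho := hgood.2 h1
    have ho2 := ho.2
    have h1' := h1
    rw [Flat] at h1'
    rw [w.left_mate, ← h1', ← hhg] at ho2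
    have ml : w.left (turn (w.mate g)) = w.right h := by rw [w.left_turn, w.right_mate, hhg]
    have mr : w.right (turn (w.mate g)) = w.left (turn (turn (w.mate g))) :=
      (w.left_turn _).symm
    by_cases e : turn (w.mate g) = w.mate h
    · exact Or.inr (Or.inl ⟨e ▸ isInner_turn.2 ho.1, e, hY e ho.1⟩)
    -- Both edges lead from the face between `h` and `g` to lower faces; for `turn (mate g)` this is
    -- the outer end of the flat edge `g`.
    · rcases hw.lower_consecutive hr hc (m₁ := turn (w.mate g)) (m₂ := w.mate h)
        (by rw [ml, w.left_mate]) (by rw [ml]) (by rw [mr, ho2])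
        (by rw [w.right_mate]; exact hh') e with h2 | h2
      · right; right
        obtain ⟨h2, h3⟩ := h2
        rw [walk_apply] at h2
        have h4 : (w.mate (turn (w.mate g))).IsInner := by rwa [← isInner_turn, h2]
        refine ⟨h3, ho.1, h1, h2, by rw [mr]; omega, ?_⟩
        rw [hsm g, hsm h, ← h2, isSource_turn h4, ← isSource_turn ho.1, ← hsm]
      · exfalso
        have h3 := h2.1
        rw [walk_apply, w.mate_mate'] at h3
        have h4 : h = w.mate g := turn.injective h3
        rw [h4] at hh
        exact hh.not_flat h1.mate
  · have hi := hgood.1 h1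
    have hf : ¬ w.Flat g := fun h2 => h1.not_flat h2.mate
    rw [up_mate] at h1
    by_cases e : w.mate h = g
    · left
      refine ⟨e, hf, ?_⟩
      rw [← e, w.isSource_mate]
    -- A descending `g` is itself a lower edge of this face. Starting on the axis, it cannot be the
    -- later of two consecutive ones.
    · rcases hw.lower_consecutive hr hc (m₁ := g) (m₂ := w.mate h)
        (by rw [w.left_mate, hhg]) (by rw [hhg]) (by rw [h1, hhg])
        (by rw [w.right_mate]; exact hh') (Ne.symm e) with h2 | h2
      · right; left
        obtain ⟨h2, h3⟩ := h2
        rw [walk_apply] at h2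
        have h4 : (w.mate g).IsInner := by rwa [← isInner_turn, h2]
        exact ⟨h3, h2, hY h2 h4⟩
      · exact (hi h2.2).elim

/-- A sequence of faces from `f` to `g` in which the edges given by the list are crossed from left
to right. -/
def IsPath (w : BottomWeb n) {α : Type} (φ : α → HalfEdge n w.V) : w.F → List α → w.F → Prop
  | f, [], g => f = g
  | f, a :: L, g => w.left (φ a) = f ∧ w.IsPath φ (w.right (φ a)) L g

theorem isPath_append {α : Type} {φ : α → HalfEdge n w.V} {A B : List α} {f g : w.F} :
    w.IsPath φ f (A ++ B) g ↔ ∃ e, w.IsPath φ f A e ∧ w.IsPath φ e B g := by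
  induction A generalizing f with
  | nil => simp [IsPath]
  | cons a A ih => simp [IsPath, ih, and_assoc]

theorem isPath_ofFn {α : Type} {φ : α → HalfEdge n w.V} {m : ℕ} (a : Fin m → α)
    (g : Fin (m + 1) → w.F) (hl : ∀ i, w.left (φ (a i)) = g i.castSucc)
    (hr : ∀ i, w.right (φ (a i)) = g i.succ) :
    w.IsPath φ (g 0) (List.ofFn a) (g (Fin.last m)) := by
  induction m with
  | zero => rfl
  | succ m ih =>
    rw [List.ofFn_succ]
    refine ⟨hl 0, ?_⟩
    rw [hr]
    exact ih (fun i => a i.succ) (fun i => g i.succ) (fun i => hl i.succ) fun i => hr i.succ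

/-- The path ends at depth `0`, so it cannot ascend up to its last crossing. -/
theorem IsPath.exists_peak {α : Type} {φ : α → HalfEdge n w.V} {L : List α} {h : α}
    {f : w.F} (hp : w.IsPath φ f (h :: L) w.unbounded) (hh : w.Up (φ h)) :
    ∃ A a b B, h :: L = A ++ a :: b :: B ∧ w.Up (φ a) ∧ ¬ w.Up (φ b) := by
  induction L generalizing h f with
  | nil =>
    have h1 : w.right (φ h) = w.unbounded := hp.2
    rw [Up, h1, depth_unbounded] at hh
    omega
  | cons g L ih =>
    by_cases hg : w.Up (φ g)
    · obtain ⟨A, a, b, B, h1, h2, h3⟩ := ih hp.2 hg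
      exact ⟨h :: A, a, b, B, by rw [h1]; rfl, h2, h3⟩
    · exact ⟨[], h, g, L, rfl, hh, hg⟩

theorem IsConn.exists_peak (hw : w.IsConn) {α : Type} {φ : α → HalfEdge n w.V} {L : List α}
    (hL : L ≠ []) (hp : w.IsPath φ w.unbounded L w.unbounded) :
    ∃ A a b B, L = A ++ a :: b :: B ∧ w.Up (φ a) ∧ ¬ w.Up (φ b) := by
  cases L with
  | nil => exact (hL rfl).elim
  | cons a L =>
    refine hp.exists_peak ?_
    have h1 := hp.1
    rcases w.up_or (φ a) with h | h | h
    · exact h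
    · have := hw.depth_pos_of_flat h
      rw [h1, depth_unbounded] at this
      omega
    · rw [up_mate, h1, depth_unbounded] at h
      omega

/-! ### Partial isomorphisms and the elementary moves of the frontier -/

/-- Apply `turn` to a pair of half-edges of two webs. -/
def turnPair (p : HalfEdge n w.V × HalfEdge n w'.V) : HalfEdge n w.V × HalfEdge n w'.V :=
  (turn p.1, turn p.2)

/-- Apply `mate` to a pair of half-edges of two webs. -/
def matePair (p : HalfEdge n w.V × HalfEdge n w'.V) : HalfEdge n w.V × HalfEdge n w'.V :=
  (w.mate p.1, w'.mate p.2)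

theorem matePair_matePair (p : HalfEdge n w.V × HalfEdge n w'.V) : matePair (matePair p) = p :=
  Prod.ext (w.mate_mate' _) (w'.mate_mate' _)

theorem turnPair_turnPair_turnPair {p : HalfEdge n w.V × HalfEdge n w'.V} (h : p.1.IsInner)
    (h' : p.2.IsInner) : turnPair (turnPair (turnPair p)) = p :=
  Prod.ext (turn_turn_turn h) (turn_turn_turn h')

/-- A partial isomorphism `P` of two webs, defined on the half-edges of the vertices below a common
frontier, which crosses the edges of the list `L`. -/
structure PartialIso (w w' : BottomWeb n) (P : Set (HalfEdge n w.V × HalfEdge n w'.V))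
    (L : List (HalfEdge n w.V × HalfEdge n w'.V)) : Prop where
  inj : ∀ p ∈ P, ∀ q ∈ P, p.1 = q.1 ↔ p.2 = q.2
  bdry_mem : ∀ i, (.bdry i, .bdry i) ∈ P
  bdry_or_inner : ∀ p ∈ P, (∃ i, p = (.bdry i, .bdry i)) ∨
    (p.1.IsInner ∧ p.2.IsInner ∧ turnPair p ∈ P)
  source : ∀ p ∈ P, w'.isSource p.2.vertex = w.isSource p.1.vertex
  sub : ∀ p ∈ L, p ∈ P
  nodup : L.Nodup
  mate_mem : ∀ p ∈ P, p ∉ L → matePair p ∈ P ∧ matePair p ∉ L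
  path : w.IsPath Prod.fst w.unbounded L w.unbounded
  path' : w'.IsPath Prod.snd w'.unbounded L w'.unbounded

/-- Neither of the two half-edges belongs to the partial isomorphism. -/
def Fresh (P : Set (HalfEdge n w.V × HalfEdge n w'.V)) (x : HalfEdge n w.V × HalfEdge n w'.V) :
    Prop := ∀ q ∈ P, q.1 ≠ x.1 ∧ q.2 ≠ x.2

theorem Fresh.not_mem {P : Set (HalfEdge n w.V × HalfEdge n w'.V)}
    {x : HalfEdge n w.V × HalfEdge n w'.V} (h : Fresh P x) : x ∉ P := fun hx => (h x hx).1 rfl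

theorem Fresh.insert_pair {P : Set (HalfEdge n w.V × HalfEdge n w'.V)}
    {x y : HalfEdge n w.V × HalfEdge n w'.V} (h : Fresh P x) (hy : y.1 ≠ x.1 ∧ y.2 ≠ x.2) :
    Fresh (insert y P) x := by
  rintro q (rfl | hq)
  · exact hy
  · exact h q hq

theorem Fresh.inj_insert {P : Set (HalfEdge n w.V × HalfEdge n w'.V)}
    {x : HalfEdge n w.V × HalfEdge n w'.V} (h : Fresh P x)
    (hP : ∀ p ∈ P, ∀ q ∈ P, p.1 = q.1 ↔ p.2 = q.2) :
    ∀ p ∈ insert x P, ∀ q ∈ insert x P, p.1 = q.1 ↔ p.2 = q.2 := by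
  rintro p (rfl | hp) q (rfl | hq)
  · simp
  · exact iff_of_false (h q hq).1.symm (h q hq).2.symm
  · exact iff_of_false (h p hp).1 (h p hp).2
  · exact hP p hp q hq

/-- The number of half-edges above the frontier, counted twice, plus the length of the frontier. -/
noncomputable def remaining (P : Set (HalfEdge n w.V × HalfEdge n w'.V))
    (L : List (HalfEdge n w.V × HalfEdge n w'.V)) : ℕ := 2 * (Prod.fst '' P)ᶜ.ncard + L.length

namespace PartialIso

variable {P : Set (HalfEdge n w.V × HalfEdge n w'.V)}
  {L A B : List (HalfEdge n w.V × HalfEdge n w'.V)} {x h g : HalfEdge n w.V × HalfEdge n w'.V}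

theorem turn_mem (hP : PartialIso w w' P L) (hx : x ∈ P) (hi : x.1.IsInner ∨ x.2.IsInner) :
    x.1.IsInner ∧ x.2.IsInner ∧ turnPair x ∈ P := by
  rcases hP.bdry_or_inner x hx with ⟨i, rfl⟩ | h
  · simp at hi
  · exact h

/-- At internal vertices `P` is closed under `turnPair`, and two further turns would lead back to
`x`. -/
theorem fresh_turn (hP : PartialIso w w' P L) (hi : x.1.IsInner) (hi' : x.2.IsInner)
    (hx : Fresh P x) : Fresh P (turnPair x) := by
  have key : ∀ q ∈ P, q.1.IsInner ∨ q.2.IsInner → turnPair (turnPair q) ∈ P := by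
    intro q hq hqi
    have h1 := hP.turn_mem hq hqi
    exact (hP.turn_mem h1.2.2 (Or.inl (isInner_turn.2 h1.1))).2.2
  intro q hq
  refine ⟨fun e => ?_, fun e => ?_⟩
  · have hqi : q.1.IsInner := e ▸ isInner_turn.2 hi
    refine (hx _ (key q hq (Or.inl hqi))).1 ?_
    change turn (turn q.1) = _
    rw [e]
    exact turn_turn_turn hi
  · have hqi : q.2.IsInner := e ▸ isInner_turn.2 hi'
    refine (hx _ (key q hq (Or.inr hqi))).2 ?_
    change turn (turn q.2) = _
    rw [e]
    exact turn_turn_turn hi'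

/-- If a pair of `P` off the frontier contained a mate of `x`, its own mate would be `x` by
injectivity, but such a mate is never on the frontier. -/
theorem fresh_mate (hP : PartialIso w w' P L) (hx : x ∈ L)
    (h : ∀ q ∈ L, q.1 ≠ w.mate x.1 ∧ q.2 ≠ w'.mate x.2) : Fresh P (matePair x) := by
  intro q hq
  by_cases hqL : q ∈ L
  · exact h q hqL
  have h1 := hP.mate_mem q hq hqL
  have h2 := hP.inj _ h1.1 _ (hP.sub x hx)
  refine ⟨fun e => ?_, fun e => ?_⟩
  · have e1 : (matePair q).1 = x.1 := by
      change w.mate q.1 = _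
      rw [e]
      exact w.mate_mate' _
    exact h1.2 (Prod.ext e1 (h2.1 e1) ▸ hx)
  · have e1 : (matePair q).2 = x.2 := by
      change w'.mate q.2 = _
      rw [e]
      exact w'.mate_mate' _
    exact h1.2 (Prod.ext (h2.2 e1) e1 ▸ hx)

/-- Crossing an edge and then crossing it back leads to the same face, so both crossings can be
dropped. -/
theorem cancel (hP : PartialIso w w' P (A ++ h :: g :: B)) (hhg : matePair h = g) :
    PartialIso w w' P (A ++ B) ∧ remaining P (A ++ B) < remaining P (A ++ h :: g :: B) := by
  have hsub : ∀ p ∈ A ++ B, p ∈ A ++ h :: g :: B := by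
    intro p hp
    simp only [List.mem_append, List.mem_cons] at hp ⊢
    tauto
  have hnd := hP.nodup
  have hmem : ∀ p, p ∈ A ++ h :: g :: B → p ∉ A ++ B → p = h ∨ p = g := by
    intro p hp hp'
    simp only [List.mem_append, List.mem_cons] at hp hp'
    tauto
  have hh : h ∉ A ++ B ∧ g ∉ A ++ B := by
    have hperm : (A ++ h :: g :: B).Perm (h :: g :: (A ++ B)) :=
      List.perm_middle.trans (List.perm_middle.cons h)
    have := hperm.nodup_iff.1 hnd
    rw [List.nodup_cons, List.nodup_cons] at this
    exact ⟨fun h1 => this.1 (List.mem_cons_of_mem _ h1), this.2.1⟩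
  refine ⟨⟨hP.inj, hP.bdry_mem, hP.bdry_or_inner, hP.source, fun p hp => hP.sub p (hsub p hp),
    ?_, ?_, ?_, ?_⟩, ?_⟩
  · refine hnd.sublist (List.Sublist.append_left ?_ A)
    exact (List.sublist_cons_self _ _).trans (List.sublist_cons_self _ _)
  · intro p hp hpL
    by_cases hpL' : p ∈ A ++ h :: g :: B
    · rcases hmem p hpL' hpL with rfl | rfl
      · rw [hhg]
        exact ⟨hP.sub _ (by simp), hh.2⟩
      · rw [← hhg, matePair_matePair]
        exact ⟨hP.sub _ (by simp), hh.1⟩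
    · obtain ⟨h1, h2⟩ := hP.mate_mem p hp hpL'
      exact ⟨h1, fun h3 => h2 (hsub _ h3)⟩
  · obtain ⟨e, h1, h2, -, h3⟩ := isPath_append.1 hP.path
    refine isPath_append.2 ⟨e, h1, ?_⟩
    rw [← hhg] at h3
    change w.IsPath _ (w.right (w.mate h.1)) _ _ at h3
    rwa [w.right_mate, h2] at h3
  · obtain ⟨e, h1, h2, -, h3⟩ := isPath_append.1 hP.path'
    refine isPath_append.2 ⟨e, h1, ?_⟩
    rw [← hhg] at h3
    change w'.IsPath _ (w'.right (w'.mate h.2)) _ _ at h3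
    rwa [w'.right_mate, h2] at h3
  · simp only [remaining, List.length_append, List.length_cons]
    omega

/-- Pushing the frontier over the vertex at the far end of `h` trades the crossing of `h` for
crossings of the other two edges there, in clockwise order. -/
theorem addVertex (hP : PartialIso w w' P (A ++ h :: B)) (hx : x = matePair h)
    (hi : x.1.IsInner) (hi' : x.2.IsInner) (hf : Fresh P x) :
    PartialIso w w' (insert x (insert (turnPair x) (insert (turnPair (turnPair x)) P)))
      (A ++ turnPair x :: turnPair (turnPair x) :: B) ∧
    remaining (insert x (insert (turnPair x) (insert (turnPair (turnPair x)) P)))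
      (A ++ turnPair x :: turnPair (turnPair x) :: B) < remaining P (A ++ h :: B) := by
  have hf1 := hP.fresh_turn hi hi' hf
  have j : (turnPair x).1.IsInner := isInner_turn.2 hi
  have j' : (turnPair x).2.IsInner := isInner_turn.2 hi'
  have hf2 := hP.fresh_turn j j' hf1
  have ht := turnPair_turnPair_turnPair hi hi'
  set y := turnPair x with hy
  set z := turnPair y with hz
  have l : z.1.IsInner := isInner_turn.2 j
  have l' : z.2.IsInner := isInner_turn.2 j'
  have xy : y.1 ≠ x.1 ∧ y.2 ≠ x.2 := ⟨turn_ne_self hi, turn_ne_self hi'⟩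
  have yz : z.1 ≠ y.1 ∧ z.2 ≠ y.2 := ⟨turn_ne_self j, turn_ne_self j'⟩
  have zx : z.1 ≠ x.1 ∧ z.2 ≠ x.2 := by
    have h1 : x.1 ≠ z.1 := by
      conv_lhs => rw [← ht]
      exact turn_ne_self l
    have h2 : x.2 ≠ z.2 := by
      conv_lhs => rw [← ht]
      exact turn_ne_self l'
    exact ⟨h1.symm, h2.symm⟩
  have hf1' : Fresh (insert z P) y := hf1.insert_pair yz
  have hf' : Fresh (insert y (insert z P)) x := (hf.insert_pair zx).insert_pair xy
  have hxh : matePair x = h := by rw [hx, matePair_matePair]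
  have hhA : h ∉ A ∧ h ∉ B := by
    have := List.perm_middle.nodup_iff.1 hP.nodup
    rw [List.nodup_cons, List.mem_append, not_or] at this
    exact this.1
  have hAB : (A ++ B).Nodup := (List.nodup_cons.1 (List.perm_middle.nodup_iff.1 hP.nodup)).2
  have hPA : ∀ p ∈ A ++ B, p ∈ P := fun p hp => hP.sub p (by
    simp only [List.mem_append, List.mem_cons] at hp ⊢
    tauto)
  have hL : ∀ p, p ∈ A ++ y :: z :: B ↔ p = y ∨ p = z ∨ p ∈ A ++ B := fun p => by
    simp only [List.mem_append, List.mem_cons]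
    tauto
  have hhP : h ∈ P := hP.sub h (by simp)
  have hne : ∀ q ∈ P, q ≠ y ∧ q ≠ z := fun q hq =>
    ⟨fun e => (hf1 q hq).1 (by rw [e]), fun e => (hf2 q hq).1 (by rw [e])⟩
  have hxne : x ≠ y ∧ x ≠ z := ⟨fun e => xy.1 (by rw [← e]), fun e => zx.1 (by rw [← e])⟩
  have ex1 : x.1 = w.mate h.1 := by rw [hx]; rfl
  have ex2 : x.2 = w'.mate h.2 := by rw [hx]; rfl
  have hsx : w'.isSource x.2.vertex = w.isSource x.1.vertex := by
    rw [ex1, ex2, w.isSource_mate, w'.isSource_mate, hP.source h hhP]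
  have hsy : w'.isSource y.2.vertex = w.isSource y.1.vertex := by
    rw [show y.1 = turn x.1 from rfl, show y.2 = turn x.2 from rfl, isSource_turn hi,
      isSource_turn hi', hsx]
  have hsz : w'.isSource z.2.vertex = w.isSource z.1.vertex := by
    rw [show z.1 = turn y.1 from rfl, show z.2 = turn y.2 from rfl, isSource_turn j,
      isSource_turn j', hsy]
  refine ⟨⟨hf'.inj_insert (hf1'.inj_insert (hf2.inj_insert hP.inj)), fun i => ?_, ?_, ?_, ?_, ?_,
    ?_, ?_, ?_⟩, ?_⟩
  · exact Or.inr (Or.inr (Or.inr (hP.bdry_mem i)))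
  · rintro p (rfl | rfl | rfl | hp)
    · exact Or.inr ⟨hi, hi', Or.inr (Or.inl rfl)⟩
    · exact Or.inr ⟨j, j', Or.inr (Or.inr (Or.inl rfl))⟩
    · exact Or.inr ⟨l, l', by rw [ht]; exact Or.inl rfl⟩
    · rcases hP.bdry_or_inner p hp with h1 | ⟨h1, h2, h3⟩
      · exact Or.inl h1
      · exact Or.inr ⟨h1, h2, Or.inr (Or.inr (Or.inr h3))⟩
  · rintro p (rfl | rfl | rfl | hp)
    · exact hsx
    · exact hsy
    · exact hsz
    · exact hP.source p hp
  · intro p hp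
    rcases (hL p).1 hp with rfl | rfl | hp
    · exact Or.inr (Or.inl rfl)
    · exact Or.inr (Or.inr (Or.inl rfl))
    · exact Or.inr (Or.inr (Or.inr (hPA p hp)))
  · have hperm : (A ++ y :: z :: B).Perm (y :: z :: (A ++ B)) :=
      List.perm_middle.trans (List.perm_middle.cons y)
    rw [hperm.nodup_iff, List.nodup_cons, List.nodup_cons]
    refine ⟨?_, fun h1 => hf2.not_mem (hPA _ h1), hAB⟩
    rintro h1
    rcases List.mem_cons.1 h1 with h1 | h1
    · exact yz.1 (by rw [← h1])
    · exact hf1.not_mem (hPA _ h1)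
  · intro p hp hpL
    rw [hL, not_or, not_or] at hpL
    simp only [hL]
    rcases hp with rfl | hp | hp | hp
    · rw [hxh]
      refine ⟨Or.inr (Or.inr (Or.inr hhP)), ?_⟩
      rw [List.mem_append]
      have := hne h hhP
      tauto
    · exact (hpL.1 hp).elim
    · exact (hpL.2.1 hp).elim
    · by_cases hph : p = h
      · rw [hph, ← hx]
        refine ⟨Or.inl rfl, ?_⟩
        rintro (h1 | h1 | h1)
        · exact hxne.1 h1
        · exact hxne.2 h1
        · exact hf.not_mem (hPA _ h1)
      · obtain ⟨h1, h2⟩ := hP.mate_mem p hp (by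
          have := hpL.2.2
          simp only [List.mem_append, List.mem_cons] at this ⊢
          tauto)
        refine ⟨Or.inr (Or.inr (Or.inr h1)), ?_⟩
        have h3 := hne _ h1
        simp only [List.mem_append, List.mem_cons] at h2 ⊢
        tauto
  · obtain ⟨e, h1, h2, h3⟩ := isPath_append.1 hP.path
    refine isPath_append.2 ⟨e, h1, ?_, ?_, ?_⟩
    · change w.left (turn x.1) = _
      rw [w.left_turn, ex1, w.right_mate, h2]
    · exact w.left_turn _
    · change w.IsPath _ (w.right (turn (turn x.1))) _ _
      rwa [← w.left_turn, turn_turn_turn hi, ex1, w.left_mate]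
  · obtain ⟨e, h1, h2, h3⟩ := isPath_append.1 hP.path'
    refine isPath_append.2 ⟨e, h1, ?_, ?_, ?_⟩
    · change w'.left (turn x.2) = _
      rw [w'.left_turn, ex2, w'.right_mate, h2]
    · exact w'.left_turn _
    · change w'.IsPath _ (w'.right (turn (turn x.2))) _ _
      rwa [← w'.left_turn, turn_turn_turn hi', ex2, w'.left_mate]
  -- The frontier grows by one while at least one half-edge is used up, which is why `remaining`
  -- counts half-edges twice.
  · have hlt : (Prod.fst '' (insert x (insert y (insert z P))))ᶜ.ncard <
        (Prod.fst '' P)ᶜ.ncard := by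
      refine Set.ncard_lt_ncard ?_ (Set.toFinite _)
      rw [compl_lt_compl_iff_lt, Set.ssubset_iff_of_subset]
      · refine ⟨x.1, ⟨x, Or.inl rfl, rfl⟩, ?_⟩
        rintro ⟨q, hq, e⟩
        exact (hf q hq).1 e
      · refine Set.image_mono fun q hq => Or.inr (Or.inr (Or.inr hq))
    simp only [remaining, List.length_append, List.length_cons]
    omega

end PartialIso

end BottomWeb

end SL3Web

/-! ### Two webs with equal data grow in parallel -/

namespace SL3Web

open HalfEdge

namespace BottomWeb

variable {n : ℕ} {w w' : BottomWeb n}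

/-- The depths next to the two half-edges agree, and both are good. -/
def Compatible (p : HalfEdge n w.V × HalfEdge n w'.V) : Prop :=
  w.depth (w.left p.1) = w'.depth (w'.left p.2) ∧
    w.depth (w.right p.1) = w'.depth (w'.right p.2) ∧ w.Good p.1 ∧ w'.Good p.2

theorem Compatible.up_iff {p : HalfEdge n w.V × HalfEdge n w'.V} (h : Compatible p) :
    w.Up p.1 ↔ w'.Up p.2 := by
  rw [Up, Up, h.1, h.2.1]

theorem Compatible.flat_iff {p : HalfEdge n w.V × HalfEdge n w'.V} (h : Compatible p) :
    w.Flat p.1 ↔ w'.Flat p.2 := by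
  rw [Flat, Flat, h.1, h.2.1]

namespace PartialIso

variable {P : Set (HalfEdge n w.V × HalfEdge n w'.V)}
  {L A B : List (HalfEdge n w.V × HalfEdge n w'.V)} {x h g : HalfEdge n w.V × HalfEdge n w'.V}

theorem initial (hw : w.IsConn) (hr : w.Reduced) (hw' : w'.IsConn) (hr' : w'.Reduced)
    (hs : w.SameBoundary w') (hd : w.gapDepth = w'.gapDepth) :
    ∃ (P : Set (HalfEdge n w.V × HalfEdge n w'.V)) (L : _), PartialIso w w' P L ∧
      ∀ p ∈ L, Compatible p := by
  let φ : Fin n → HalfEdge n w.V × HalfEdge n w'.V := fun i => (.bdry i, .bdry i)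
  refine ⟨Set.range φ, List.ofFn φ, ⟨?_, fun i => ⟨i, rfl⟩, ?_, ?_, ?_, ?_, ?_, ?_, ?_⟩, ?_⟩
  · rintro _ ⟨i, rfl⟩ _ ⟨j, rfl⟩
    simp [φ]
  · rintro _ ⟨i, rfl⟩
    exact Or.inl ⟨i, rfl⟩
  · rintro _ ⟨i, rfl⟩
    exact (hs i).symm
  · intro p hp
    rwa [List.mem_ofFn'] at hp
  · rw [List.nodup_ofFn]
    intro i j hij
    exact HalfEdge.bdry.inj (congrArg Prod.fst hij)
  · intro p hp hp'
    rw [List.mem_ofFn'] at hp'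
    exact (hp' hp).elim
  · have := isPath_ofFn (w := w) (φ := Prod.fst) φ w.gap (fun i => w.left_bdry i)
      (fun i => w.right_bdry i)
    rwa [w.gap_last] at this
  · have := isPath_ofFn (w := w') (φ := Prod.snd) φ w'.gap (fun i => w'.left_bdry i)
      (fun i => w'.right_bdry i)
    rwa [w'.gap_last] at this
  · intro p hp
    rw [List.mem_ofFn'] at hp
    obtain ⟨i, rfl⟩ := hp
    refine ⟨?_, ?_, hw.good_bdry hr i, hw'.good_bdry hr' i⟩
    · change w.depth (w.left (.bdry i)) = w'.depth (w'.left (.bdry i))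
      rw [w.left_bdry, w'.left_bdry]
      exact congrFun hd _
    · change w.depth (w.left (w.mate (.bdry i))) = w'.depth (w'.left (w'.mate (.bdry i)))
      rw [w.right_bdry, w'.right_bdry]
      exact congrFun hd _

/-- If `h` is not the end of another half-edge of the frontier, the other end of its edge is not
in the partial isomorphism. -/
theorem fresh_mate_of_good (hP : PartialIso w w' P L) (hw : w.IsConn) (hr : w.Reduced)
    (hw' : w'.IsConn) (hr' : w'.Reduced) (hx : x ∈ L) (hL : ∀ p ∈ L, Compatible p)
    (hi : (w.mate x.1).IsInner) (hi' : (w'.mate x.2).IsInner)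
    (hup : ¬ w.Up (w.mate x.1)) : Fresh P (matePair x) := by
  -- If both halves of the edge were good, a flat edge would have two outer ends, and an ascending
  -- one would descend from an internal vertex.
  have key : ∀ {v : BottomWeb n} (_ : v.IsConn) (_ : v.Reduced) {a : HalfEdge n v.V},
      v.Good a → v.Good (v.mate a) → (v.mate a).IsInner → ¬ v.Up (v.mate a) → False := by
    intro v hv hvr a h1 h2 h3 h4
    rcases v.up_or a with h5 | h5 | h5
    · exact h2.1 (by rwa [v.mate_mate']) h3
    · refine hv.not_outer_outer hvr h5 (hv.convex hvr _) ⟨?_, h1.2 h5⟩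
      have := h2.2 h5.mate
      rwa [v.mate_mate'] at this
    · exact h4 h5
  have hup' : ¬ w'.Up (w'.mate x.2) := by
    have h1 := hL x hx
    rw [up_mate] at hup ⊢
    rwa [← h1.1, ← h1.2.1]
  refine hP.fresh_mate hx fun q hq => ⟨fun e => ?_, fun e => ?_⟩
  · exact key hw hr (hL x hx).2.2.1 (e ▸ (hL q hq).2.2.1) hi hup
  · exact key hw' hr' (hL x hx).2.2.2 (e ▸ (hL q hq).2.2.2) hi' hup'

/-- A nonempty frontier can be moved further up. -/
theorem exists_step (hP : PartialIso w w' P L) (hw : w.IsConn) (hr : w.Reduced)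
    (hw' : w'.IsConn) (hr' : w'.Reduced) (hL : ∀ p ∈ L, Compatible p) (hne : L ≠ []) :
    ∃ P' L', PartialIso w w' P' L' ∧ (∀ p ∈ L', Compatible p) ∧
      remaining P' L' < remaining P L := by
  obtain ⟨A, h, g, B, rfl, hh, hg⟩ := hw.exists_peak hne hP.path
  have hhL : h ∈ A ++ h :: g :: B := by simp
  have hgL : g ∈ A ++ h :: g :: B := by simp
  have ch := hL h hhL
  have cg := hL g hgL
  have hh' := ch.up_iff.1 hh
  have hg' : ¬ w'.Up g.2 := fun h1 => hg (cg.up_iff.2 h1)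
  have ehg : w.right h.1 = w.left g.1 := by
    obtain ⟨e, h1, h2, h3, h4⟩ := isPath_append.1 hP.path
    exact h3.symm
  have ehg' : w'.right h.2 = w'.left g.2 := by
    obtain ⟨e, h1, h2, h3, h4⟩ := isPath_append.1 hP.path'
    exact h3.symm
  have sh := hP.source h (hP.sub h hhL)
  have sg := hP.source g (hP.sub g hgL)
  have hAB : ∀ p ∈ A ++ B, Compatible p := fun p hp => hL p (by
    simp only [List.mem_append, List.mem_cons] at hp ⊢
    tauto)
  have hup : ¬ w.Up (w.mate h.1) := by
    intro h1
    rw [up_mate] at h1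
    rw [Up] at hh
    omega
  have dl : w.depth (w.left (turn (w.mate h.1))) = w'.depth (w'.left (turn (w'.mate h.2))) := by
    rw [w.left_turn, w'.left_turn, w.right_mate, w'.right_mate, ch.1]
  have dg : w.depth (w.left h.1) ≤ w.depth (w.right g.1) := by
    have := depth_left_le (w := w) g.1
    rw [← ehg] at this
    rw [Up] at hh
    omega
  have dg' : w'.depth (w'.left h.2) ≤ w'.depth (w'.right g.2) := by
    rwa [← ch.1, ← cg.2.1]
  -- Equal or opposite orientations separate the Y from the other two pictures, and flatness of `g`
  -- separates the edge from the H. Both are shared by the two webs, so the six mixed cases are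
  -- contradictory.
  rcases hw.peak hr ehg hh hg cg.2.2.1 with ⟨a1, a2, a3⟩ | ⟨a1, a2, a3⟩ | ⟨a1, a2, a3, a4, a5, a6⟩ <;>
    rcases hw'.peak hr' ehg' hh' hg' cg.2.2.2 with
      ⟨b1, b2, b3⟩ | ⟨b1, b2, b3⟩ | ⟨b1, b2, b3, b4, b5, b6⟩
  · obtain ⟨h1, h2⟩ := hP.cancel (h := h) (g := g) (Prod.ext a1 b1)
    exact ⟨P, A ++ B, h1, hAB, h2⟩
  · rw [sg, sh, a3] at b3
    simp at b3
  · exact (a2 (cg.flat_iff.2 b3)).elim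
  · rw [sg, sh, a3] at b3
    simp at b3
  -- The Y: after its vertex is added, the second new crossing cancels against `g`, and only the
  -- stem remains.
  · have i : (w.mate g.1).IsInner := by rwa [← isInner_turn, a2]
    have i' : (w'.mate g.2).IsInner := by rwa [← isInner_turn, b2]
    obtain ⟨h1, h2⟩ := hP.addVertex (x := matePair h) rfl a1 b1
      (hP.fresh_mate_of_good hw hr hw' hr' hhL hL a1 b1 hup)
    have e1 : matePair (turnPair (turnPair (matePair h))) = g := by
      refine Prod.ext ?_ ?_
      · change w.mate (turn (turn (w.mate h.1))) = g.1
        rw [← a2, turn_turn_turn i, w.mate_mate']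
      · change w'.mate (turn (turn (w'.mate h.2))) = g.2
        rw [← b2, turn_turn_turn i', w'.mate_mate']
    have r1 : w.right (turn (w.mate h.1)) = w.right g.1 := by
      rw [← w.left_turn, ← a2, turn_turn_turn i, w.left_mate]
    have r2 : w'.right (turn (w'.mate h.2)) = w'.right g.2 := by
      rw [← w'.left_turn, ← b2, turn_turn_turn i', w'.left_mate]
    rw [List.append_cons] at h1 h2
    obtain ⟨h3, h4⟩ := h1.cancel e1
    refine ⟨_, _, h3, ?_, h4.trans h2⟩
    intro p hp
    by_cases hpr : p = turnPair (matePair h)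
    · rw [hpr]
      refine ⟨dl, ?_, hw.good_turn_mate hr hh a1 (by rwa [r1]),
        hw'.good_turn_mate hr' hh' b1 (by rwa [r2])⟩
      change w.depth (w.right (turn (w.mate h.1))) = w'.depth (w'.right (turn (w'.mate h.2)))
      rw [r1, r2, cg.2.1]
    · refine hAB p ?_
      simp only [List.mem_append, List.mem_cons, List.not_mem_nil, or_false] at hp ⊢
      tauto
  · rw [sg, sh, a3] at b6
    simp at b6
  · exact (b2 (cg.flat_iff.1 a3)).elim
  · rw [sg, sh, a6] at b3
    simp at b3
  -- The H: both ends of the crossbar are added and the crossbar cancels. An ascending and a flat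
  -- crossing are replaced by a flat and an ascending one.
  · set x := matePair h with hx
    set y := matePair g with hy
    have hfg : Fresh P y := hP.fresh_mate_of_good hw hr hw' hr' hgL hL a2 b2
      fun h1 => h1.not_flat a3.mate
    obtain ⟨h1, h2⟩ := hP.addVertex (x := x) rfl a1 b1
      (hP.fresh_mate_of_good hw hr hw' hr' hhL hL a1 b1 hup)
    -- The far ends of `h` and `g` have opposite types, so the second new vertex is not the first.
    have es : w.isSource x.1.vertex ≠ w.isSource y.1.vertex := by
      change w.isSource (w.mate h.1).vertex ≠ w.isSource (w.mate g.1).vertex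
      rw [w.isSource_mate, w.isSource_mate, a6]
      simp
    have es' : w'.isSource x.2.vertex ≠ w'.isSource y.2.vertex := by
      change w'.isSource (w'.mate h.2).vertex ≠ w'.isSource (w'.mate g.2).vertex
      rw [w'.isSource_mate, w'.isSource_mate, b6]
      simp
    have hfg' : Fresh (insert x (insert (turnPair x) (insert (turnPair (turnPair x)) P))) y := by
      refine ((hfg.insert_pair ?_).insert_pair ?_).insert_pair ?_
      · refine ⟨fun e => es ?_, fun e => es' ?_⟩
        · rw [← e]
          exact ((isSource_turn (isInner_turn.2 a1)).trans (isSource_turn a1)).symm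
        · rw [← e]
          exact ((isSource_turn (isInner_turn.2 b1)).trans (isSource_turn b1)).symm
      · refine ⟨fun e => es ?_, fun e => es' ?_⟩
        · rw [← e]
          exact (isSource_turn a1).symm
        · rw [← e]
          exact (isSource_turn b1).symm
      · exact ⟨fun e => es (by rw [e]), fun e => es' (by rw [e])⟩
    rw [List.append_cons, List.append_cons] at h1 h2
    obtain ⟨h3, h4⟩ := h1.addVertex (x := y) rfl a2 b2 hfg'
    have i : (w.mate (turn (w.mate g.1))).IsInner := by rwa [← isInner_turn, a4]
    have i' : (w'.mate (turn (w'.mate g.2))).IsInner := by rwa [← isInner_turn, b4]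
    have e1 : matePair (turnPair (turnPair x)) = turnPair y := by
      refine Prod.ext ?_ ?_
      · change w.mate (turn (turn (w.mate h.1))) = turn (w.mate g.1)
        rw [← a4, turn_turn_turn i, w.mate_mate']
      · change w'.mate (turn (turn (w'.mate h.2))) = turn (w'.mate g.2)
        rw [← b4, turn_turn_turn i', w'.mate_mate']
    rw [List.append_assoc _ [turnPair (turnPair x)], List.singleton_append] at h3 h4
    obtain ⟨h5, h6⟩ := h3.cancel e1
    refine ⟨_, _, h5, ?_, h6.trans (h4.trans h2)⟩
    have l2 : w.left (turn (turn (w.mate g.1))) = w.right (turn (w.mate g.1)) := w.left_turn _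
    have l2' : w'.left (turn (turn (w'.mate g.2))) = w'.right (turn (w'.mate g.2)) :=
      w'.left_turn _
    have r2 : w.right (turn (turn (w.mate g.1))) = w.right g.1 := by
      rw [← w.left_turn, turn_turn_turn a2, w.left_mate]
    have r2' : w'.right (turn (turn (w'.mate g.2))) = w'.right g.2 := by
      rw [← w'.left_turn, turn_turn_turn b2, w'.left_mate]
    have r1 : w.right (turn (w.mate h.1)) = w.right (turn (w.mate g.1)) := by
      rw [← w.left_turn, ← a4, turn_turn_turn i, w.left_mate]
    have r1' : w'.right (turn (w'.mate h.2)) = w'.right (turn (w'.mate g.2)) := by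
      rw [← w'.left_turn, ← b4, turn_turn_turn i', w'.left_mate]
    intro p hp
    by_cases hpr : p = turnPair x
    · rw [hpr]
      refine ⟨dl, ?_, hw.good_turn_mate hr hh a1 (by rw [r1, a5]),
        hw'.good_turn_mate hr' hh' b1 (by rw [r1', b5])⟩
      change w.depth (w.right (turn (w.mate h.1))) = w'.depth (w'.right (turn (w'.mate h.2)))
      rw [r1, r1', a5, b5, ch.1]
    by_cases hps : p = turnPair (turnPair y)
    · rw [hps]
      have u1 : w.Up (turn (turn (w.mate g.1))) := by
        rw [Up, l2, r2, a5, ← a3, ← ehg]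
        exact hh
      have u2 : w'.Up (turn (turn (w'.mate g.2))) := by
        rw [Up, l2', r2', b5, ← b3, ← ehg']
        exact hh'
      refine ⟨?_, ?_, u1.good, u2.good⟩
      · change w.depth (w.left (turn (turn (w.mate g.1)))) =
          w'.depth (w'.left (turn (turn (w'.mate g.2))))
        rw [l2, l2', a5, b5, ch.1]
      · change w.depth (w.right (turn (turn (w.mate g.1)))) =
          w'.depth (w'.right (turn (turn (w'.mate g.2))))
        rw [r2, r2', cg.2.1]
    · refine hAB p ?_
      simp only [List.mem_append, List.mem_cons, List.not_mem_nil, or_false] at hp ⊢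
      tauto

theorem exists_complete (hw : w.IsConn) (hr : w.Reduced) (hw' : w'.IsConn) (hr' : w'.Reduced)
    (hs : w.SameBoundary w') (hd : w.gapDepth = w'.gapDepth) :
    ∃ P : Set (HalfEdge n w.V × HalfEdge n w'.V), PartialIso w w' P [] := by
  have key : ∀ (N : ℕ) (P : Set (HalfEdge n w.V × HalfEdge n w'.V)) (L : _),
      PartialIso w w' P L → (∀ p ∈ L, Compatible p) → remaining P L = N →
      ∃ P : Set (HalfEdge n w.V × HalfEdge n w'.V), PartialIso w w' P [] := by
    intro N
    induction N using Nat.strong_induction_on with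
    | _ N ih =>
      intro P L hP hL hN
      by_cases hne : L = []
      · exact ⟨P, hne ▸ hP⟩
      · obtain ⟨P', L', h1, h2, h3⟩ := hP.exists_step hw hr hw' hr' hL hne
        exact ih _ (hN ▸ h3) P' L' h1 h2 rfl
  obtain ⟨P, L, h1, h2⟩ := initial hw hr hw' hr' hs hd
  exact key _ P L h1 h2 rfl

end PartialIso

end BottomWeb

end SL3Web

/-! ### From a complete partial isomorphism to an isotopy -/

namespace SL3Web

open HalfEdge

namespace BottomWeb

variable {n : ℕ} {w w' : BottomWeb n}

namespace PartialIso

variable {P : Set (HalfEdge n w.V × HalfEdge n w'.V)}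

/-- With an empty frontier the domain of `P` is closed under `mate` and under turning at internal
vertices, hence is everything by connectivity. -/
theorem exists_snd (hP : PartialIso w w' P []) (hw : w.IsConn) (h : HalfEdge n w.V) :
    ∃ h', (h, h') ∈ P := by
  refine w.induction_of_reachable (Q := fun h => ∃ h', (h, h') ∈ P)
    (fun i => ⟨_, hP.bdry_mem i⟩) ?_ ?_ h (hw.conn.preconnected _ _)
  · rintro v k ⟨h', h1⟩
    obtain ⟨-, -, h2⟩ := hP.turn_mem h1 (Or.inl (isInner_inner v k))
    obtain ⟨-, -, h3⟩ := hP.turn_mem h2 (Or.inl (isInner_turn.2 (isInner_inner v k)))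
    refine ⟨turn (turn h'), ?_⟩
    have : k - 1 - 1 = k + 1 := (show ∀ k : ZMod 3, k - 1 - 1 = k + 1 by decide) k
    rwa [turnPair, turnPair, turn_inner, turn_inner, this] at h3
  · rintro h ⟨h', h1⟩
    exact ⟨_, (hP.mate_mem _ h1 (by simp)).1⟩

theorem exists_fst (hP : PartialIso w w' P []) (hw' : w'.IsConn) (h' : HalfEdge n w'.V) :
    ∃ h, (h, h') ∈ P := by
  refine w'.induction_of_reachable (Q := fun h' => ∃ h, (h, h') ∈ P)
    (fun i => ⟨_, hP.bdry_mem i⟩) ?_ ?_ h' (hw'.conn.preconnected _ _)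
  · rintro v k ⟨h, h1⟩
    obtain ⟨-, -, h2⟩ := hP.turn_mem h1 (Or.inr (isInner_inner v k))
    obtain ⟨-, -, h3⟩ := hP.turn_mem h2 (Or.inr (isInner_turn.2 (isInner_inner v k)))
    refine ⟨turn (turn h), ?_⟩
    have : k - 1 - 1 = k + 1 := (show ∀ k : ZMod 3, k - 1 - 1 = k + 1 by decide) k
    rwa [turnPair, turnPair, turn_inner, turn_inner, this] at h3
  · rintro h' ⟨h, h1⟩
    exact ⟨_, (hP.mate_mem _ h1 (by simp)).1⟩

/-- A complete partial isomorphism is a bijection of half-edges preserving all the data. -/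
theorem exists_equiv (hP : PartialIso w w' P []) (hw : w.IsConn) (hw' : w'.IsConn) :
    ∃ ψ : HalfEdge n w.V ≃ HalfEdge n w'.V, (∀ i, ψ (.bdry i) = .bdry i) ∧
      (∀ h, ψ (turn h) = turn (ψ h)) ∧ (∀ h, ψ (w.mate h) = w'.mate (ψ h)) ∧
      (∀ h, (ψ h).IsInner ↔ h.IsInner) ∧
      ∀ h, w'.isSource (ψ h).vertex = w.isSource h.vertex := by
  choose f hf using hP.exists_snd hw
  have hu : ∀ h h', (h, h') ∈ P → f h = h' := fun h h' hh =>
    (hP.inj _ (hf h) _ hh).1 rfl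
  have hbij : Function.Bijective f := by
    refine ⟨fun a b hab => (hP.inj _ (hf a) _ (hf b)).2 hab, fun h' => ?_⟩
    obtain ⟨h, hh⟩ := hP.exists_fst hw' h'
    exact ⟨h, hu h h' hh⟩
  have hb : ∀ i, f (.bdry i) = .bdry i := fun i => hu _ _ (hP.bdry_mem i)
  refine ⟨Equiv.ofBijective f hbij, hb, ?_, ?_, ?_, fun h => hP.source _ (hf h)⟩
  · intro h
    cases h with
    | bdry i =>
      change f (turn (.bdry i)) = turn (f (.bdry i))
      rw [turn_bdry, hb, hb, turn_bdry]
    | inner v k => exact hu _ _ (hP.turn_mem (hf _) (Or.inl (isInner_inner v k))).2.2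
  · intro h
    exact hu _ _ (hP.mate_mem _ (hf h) (by simp)).1
  · intro h
    exact ⟨fun hh => (hP.turn_mem (hf h) (Or.inr hh)).1,
      fun hh => (hP.turn_mem (hf h) (Or.inl hh)).2.1⟩

end PartialIso

/-- A bijection of half-edges that preserves all the data maps faces to faces. -/
theorem IsConn.left_eq_left_of_equiv (hw : w.IsConn) {ψ : HalfEdge n w.V ≃ HalfEdge n w'.V}
    (ht : ∀ h, ψ (turn h) = turn (ψ h)) (hm : ∀ h, ψ (w.mate h) = w'.mate (ψ h))
    {h g : HalfEdge n w.V} (hg : w.left h = w.left g) : w'.left (ψ h) = w'.left (ψ g) := by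
  obtain ⟨t, rfl⟩ := (hw.sameCycle hg).exists_nat_pow_eq
  clear hg
  induction t with
  | zero => rfl
  | succ t ih =>
    rw [ih, pow_succ', Equiv.Perm.mul_apply, walk_apply, ht, hm, ← walk_apply, left_walk]

theorem IsConn.left_eq_left_iff_of_equiv (hw : w.IsConn) (hw' : w'.IsConn)
    {ψ : HalfEdge n w.V ≃ HalfEdge n w'.V}
    (ht : ∀ h, ψ (turn h) = turn (ψ h)) (hm : ∀ h, ψ (w.mate h) = w'.mate (ψ h))
    (h g : HalfEdge n w.V) : w'.left (ψ h) = w'.left (ψ g) ↔ w.left h = w.left g := by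
  refine ⟨fun e => ?_, hw.left_eq_left_of_equiv ht hm⟩
  have := hw'.left_eq_left_of_equiv (ψ := ψ.symm)
    (fun x => by rw [Equiv.symm_apply_eq, ht, Equiv.apply_symm_apply])
    (fun x => by rw [Equiv.symm_apply_eq, hm, Equiv.apply_symm_apply]) e
  rwa [Equiv.symm_apply_apply, Equiv.symm_apply_apply] at this

/-- The bijection of faces induced by a bijection of half-edges. -/
theorem IsConn.exists_faceEquiv (hw : w.IsConn) (hw' : w'.IsConn)
    {ψ : HalfEdge n w.V ≃ HalfEdge n w'.V} (hb : ∀ i, ψ (.bdry i) = .bdry i)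
    (ht : ∀ h, ψ (turn h) = turn (ψ h)) (hm : ∀ h, ψ (w.mate h) = w'.mate (ψ h)) :
    ∃ φ : w.F ≃ w'.F, (∀ h, w'.left (ψ h) = φ (w.left h)) ∧ ∀ j, w'.gap j = φ (w.gap j) := by
  by_cases h0 : Nonempty (HalfEdge n w.V)
  · obtain ⟨h0⟩ := h0
    choose s hs using hw.exists_left_eq h0
    have key := hw.left_eq_left_iff_of_equiv hw' ht hm
    have hφ : ∀ h, w'.left (ψ h) = w'.left (ψ (s (w.left h))) := fun h =>
      (key _ _).2 (hs _).symm
    have hbij : Function.Bijective fun f => w'.left (ψ (s f)) := by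
      constructor
      · intro f g hfg
        have := (key _ _).1 hfg
        rwa [hs, hs] at this
      · intro f'
        obtain ⟨h', rfl⟩ := hw'.exists_left_eq (ψ h0) f'
        obtain ⟨h, rfl⟩ := ψ.surjective h'
        exact ⟨w.left h, (hφ h).symm⟩
    refine ⟨Equiv.ofBijective _ hbij, hφ, fun j => ?_⟩
    have hc : ∀ i : Fin n, w'.gap i.castSucc = w'.left (ψ (s (w.gap i.castSucc))) := fun i => by
      rw [← w.left_bdry, ← hφ, hb, w'.left_bdry]
    induction j using Fin.lastCases with
    | cast i => exact hc i
    | last =>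
      obtain ⟨i⟩ := hw.nonempty_fin h0
      have := hc ⟨0, i.pos⟩
      rw [w.gap_last, w'.gap_last]
      exact this
  -- Without half-edges the unbounded face is the only one in either web.
  · have hsub : Subsingleton w.F := ⟨hw.face_const (c := id) fun h => (h0 ⟨h⟩).elim⟩
    have hsub' : Subsingleton w'.F :=
      ⟨hw'.face_const (c := id) fun h => (h0 ⟨ψ.symm h⟩).elim⟩
    exact ⟨⟨fun _ => w'.unbounded, fun _ => w.unbounded, fun _ => Subsingleton.elim _ _,
      fun _ => Subsingleton.elim _ _⟩, fun h => (h0 ⟨h⟩).elim, fun _ => Subsingleton.elim _ _⟩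

/-- Commuting with `turn`, the bijection acts at each vertex as a cyclic relabelling, which is read
off from the image of the half-edge `inner v 0`. -/
theorem nonempty_iso_of_equiv (hw : w.IsConn) (hw' : w'.IsConn)
    {ψ : HalfEdge n w.V ≃ HalfEdge n w'.V} (hb : ∀ i, ψ (.bdry i) = .bdry i)
    (ht : ∀ h, ψ (turn h) = turn (ψ h)) (hm : ∀ h, ψ (w.mate h) = w'.mate (ψ h))
    (hi : ∀ h, (ψ h).IsInner ↔ h.IsInner)
    (hs : ∀ h, w'.isSource (ψ h).vertex = w.isSource h.vertex) : Nonempty (w.Iso w') := by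
  obtain ⟨φ, hφ, hgap⟩ := hw.exists_faceEquiv hw' hb ht hm
  have := hw.noCircle
  have := hw'.noCircle
  have hz : ∀ k : ZMod 3, k = 0 ∨ k = 0 - 1 ∨ k = 0 - 1 - 1 := by decide
  choose f r hfr using fun v => (hi (.inner v 0)).2 (isInner_inner v 0)
  have hψ : ∀ v k, ψ (.inner v k) = .inner (f v) (k + r v) := by
    intro v k
    have h1 : ψ (.inner v (0 - 1)) = .inner (f v) (r v - 1) := by
      rw [← turn_inner, ht, hfr, turn_inner]
    have h2 : ψ (.inner v (0 - 1 - 1)) = .inner (f v) (r v - 1 - 1) := by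
      rw [← turn_inner, ht, h1, turn_inner]
    rcases hz k with rfl | rfl | rfl
    · rw [hfr, zero_add]
    · rw [h1, show r v - 1 = 0 - 1 + r v by ring]
    · rw [h2, show r v - 1 - 1 = 0 - 1 - 1 + r v by ring]
  have hbij : Function.Bijective f := by
    constructor
    · intro a b hab
      have h1 : ψ (.inner a (- r a)) = ψ (.inner b (- r b)) := by
        rw [hψ, hψ, hab, neg_add_cancel, neg_add_cancel]
      exact (HalfEdge.inner.inj (ψ.injective h1)).1
    · intro v'
      obtain ⟨h, hh⟩ := ψ.surjective (.inner v' 0)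
      obtain ⟨v, k, rfl⟩ := (hi h).1 (hh ▸ isInner_inner v' 0)
      rw [hψ] at hh
      exact ⟨v, (HalfEdge.inner.inj hh).1⟩
  have hmap : ∀ h, mapHalfEdge f r h = ψ h := by
    intro h
    cases h with
    | bdry i => exact (hb i).symm
    | inner v k => exact (hψ v k).symm
  exact ⟨{
    vert := Equiv.ofBijective f hbij
    rot := r
    circle := Equiv.equivOfIsEmpty _ _
    face := φ
    map_mate := fun h => by
      change mapHalfEdge f r _ = w'.mate (mapHalfEdge f r h)
      rw [hmap, hmap, hm]
    map_source := fun h => by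
      change w'.isSource (mapHalfEdge f r h).vertex = _
      rw [hmap, hs]
    map_left := fun h => by
      change w'.left (mapHalfEdge f r h) = _
      rw [hmap, hφ]
    map_gap := hgap
    map_circleLeft := fun c => isEmptyElim c
    map_circleRight := fun c => isEmptyElim c }⟩

/-- A reduced web is determined by its boundary orientation and the depths of the faces touching
the `x`-axis. -/
theorem nonempty_iso (hr : w.Reduced) (hr' : w'.Reduced) (hs : w.SameBoundary w')
    (hd : w.gapDepth = w'.gapDepth) : Nonempty (w.Iso w') := by
  have hw := hr.isConn
  have hw' := hr'.isConn
  obtain ⟨P, hP⟩ := PartialIso.exists_complete hw hr hw' hr' hs hd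
  obtain ⟨ψ, h1, h2, h3, h4, h5⟩ := hP.exists_equiv hw hw'
  exact nonempty_iso_of_equiv hw hw' h1 h2 h3 h4 h5

end BottomWeb

end SL3Web

/-! ### The proposition -/

theorem proposition3p8 :
    (∀ (n : ℕ) (w : SL3Web.BottomWeb n), w.Reduced → w.Anchored) ∧
    (∀ (n : ℕ) (w w' : SL3Web.BottomWeb n), w.Reduced → w'.Reduced →
      (w.bandMatching = w'.bandMatching ↔ ∀ d, 1 ≤ d → w.shadow d = w'.shadow d) ∧
      (w.SameBoundary w' →
        (w.bandMatching = w'.bandMatching → Nonempty (w.Iso w')) ∧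
        ((∀ d, 1 ≤ d → w.shadow d = w'.shadow d) → Nonempty (w.Iso w')))) := by
  refine ⟨fun n w hr => SL3Web.BottomWeb.anchored_of_reduced hr, fun n w w' hr hr' => ?_⟩
  have h1 := SL3Web.BottomWeb.bandMatching_eq_iff hr hr'
  have h2 := SL3Web.BottomWeb.shadow_eq_iff (w := w) (w' := w')
  refine ⟨h1.trans h2.symm, fun hs => ?_⟩
  exact ⟨fun h => SL3Web.BottomWeb.nonempty_iso hr hr' hs (h1.1 h),
    fun h => SL3Web.BottomWeb.nonempty_iso hr hr' hs (h2.1 h)⟩
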